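/- **Theorem (quadratic conditional lower bound for the Flipped Fréchet measure in the plane).** *The measure.* A polygonal curve of length $n$ in the plane is given by its $n$ vertices and parametrised over an interval of length $n-1$, affinely on each of its $n-1$ edges. A traversal of it is a continuous, non-decreasing surjection of $[0,1]$ onto the parameter interval. For two curves $P,Q$, a pair $\tau=(f,g)$ of traversals of $P$ and $Q$ maintains the separation $\min_{t\in[0,1]}\|P(f(t))-Q(g(t))\|$, and the Flipped Fréchet measure is $$FF(P,Q)=\sup_{(f,g)}\ \min_{t\in[0,1]}\|P(f(t))-Q(g(t))\|.$$ *The machines.* The statement holds for each of the following two models; both take unit cost per step and allow indirect addressing. (a) The word RAM: the words hold the integers $0,\dots,W$, where $W$ is bounded by a fixed power of the size of the instance (that is, words of $O(\log n)$ bits for curves of length $n$, of $O(\log (ND))$ bits for Orthogonal Vectors, of $O(n+\log m)$ bits for $k$-SAT with $n$ variables and $m$ clauses); the operations are integer arithmetic, bitwise operations and comparisons. The curves given to it have integer coordinates in $\{0,\dots,n\}$, and its numerical outputs are fractions. (b) The real RAM: a word RAM that has in addition registers and arrays of real numbers with exact $+,-,\cdot,/,\sqrt{\ }$, comparison, and conversion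 of words to reals. The curves given to it have arbitrary real coordinates. *The hypotheses.* Orthogonal Vectors (OV): given two families $u_1,\dots,u_N$ and $v_1,\dots,v_N$ of vectors in $\{0,1\}^D$, decide whether $u_i(k)\,v_j(k)=0$ for all $k$, for some $i,j$. The OV hypothesis for a model says that on this model, for no $\varepsilon>0$, OV can be decided in time $D^{O(1)}N^{2-\varepsilon}$. SETH for a model says that on this model, for every $\varepsilon>0$ there is a $k$ such that $k$-SAT with $n$ variables and $m$ clauses cannot be decided in time $m^{O(1)}2^{(1-\varepsilon)n}$. *The theorem.* Fix one of the two models, and suppose that the OV hypothesis or SETH holds for it. Let $\beta\ge\frac{\sqrt5}{2\sqrt2}$ and $\delta>0$. Then on this model there is no algorithm that, for any two curves $P,Q$ of length $n$ in the plane, in time $O(n^{2-\delta})$ 1. computes a number $v$ with $\beta\cdot FF(P,Q)\le v\le FF(P,Q)$ (in particular, with $\beta=1$, none that computes $FF(P,Q)$); or 2. outputs a traversal of $P$ and $Q$ that maintains a separation of at least $\beta\cdot FF(P,Q)$. Here a traversal is output as a finite sequence of pairs of positions (edge index and fraction of the edge), with linear interpolation in between, each agent staying on one edge between consecutive positions,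 and the length of the sequence counts as running time. -/

import Mathlib

open Set

noncomputable section

/-! ## Polygonal curves and the flipped Fréchet measure -/

/-- The Euclidean plane. -/
abbrev Plane : Type := EuclideanSpace ℝ (Fin 2)

/-- The polygonal curve with vertices `v 0, v 1, …`, parametrised affinely on each edge: at the
parameter `x = i + l` with `0 ≤ l < 1` it is the point `(1 - l) v i + l v (i+1)`.
The curve with the `n` vertices `v 0, …, v (n-1)` is its restriction to `[0, n-1]`
(which does not depend on `v i` for `i ≥ n`). -/
def polyline {E : Type*} [AddCommGroup E] [Module ℝ E] (v : ℕ → E) (x : ℝ) : E :=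
  AffineMap.lineMap (v ⌊x⌋₊) (v (⌊x⌋₊ + 1)) (x - (⌊x⌋₊ : ℝ))

/-- `f` (restricted to `[0,1]`) is a traversal of a polygonal curve with `n` vertices: a continuous,
non-decreasing surjection of `[0,1]` onto the parameter interval `[0, n-1]`. -/
def IsTraversal (n : ℕ) (f : ℝ → ℝ) : Prop :=
  ContinuousOn f (Icc 0 1) ∧ MonotoneOn f (Icc 0 1) ∧ f '' Icc 0 1 = Icc 0 ((n : ℝ) - 1)

/-- The separation `min_{t ∈ [0,1]} ‖P(f(t)) - Q(g(t))‖` maintained by the pair `(f, g)`. -/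
def separation (P Q : ℕ → Plane) (f g : ℝ → ℝ) : ℝ :=
  sInf ((fun t => ‖polyline P (f t) - polyline Q (g t)‖) '' Icc 0 1)

/-- The flipped Fréchet measure of the polygonal curves with the vertices `P 0, …, P (n-1)` and
`Q 0, …, Q (m-1)`: the supremum of the separations maintained by the traversals of both curves. -/
def FF (n m : ℕ) (P Q : ℕ → Plane) : ℝ :=
  sSup {d : ℝ | ∃ f g : ℝ → ℝ, IsTraversal n f ∧ IsTraversal m g ∧ d = separation P Q f g}

/-! ## The machines -/

/-- Memory of a random access machine: word registers, word arrays, real registers, real arrays. -/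
structure State where
  reg : ℕ → ℕ
  arr : ℕ → ℕ → ℕ
  rreg : ℕ → ℝ
  rarr : ℕ → ℕ → ℝ

/-- Binary operations on words. -/
inductive WordOp
  | add | sub | mul | div | mod | and | or | xor | shl | shr

/-- Integer arithmetic (truncated subtraction, integer division) and bitwise operations. -/
def WordOp.eval : WordOp → ℕ → ℕ → ℕ
  | .add, a, b => a + b
  | .sub, a, b => a - b
  | .mul, a, b => a * b
  | .div, a, b => a / b
  | .mod, a, b => a % b
  | .and, a, b => a &&& b
  | .or, a, b => a ||| b
  | .xor, a, b => a ^^^ b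
  | .shl, a, b => a <<< b
  | .shr, a, b => a >>> b

/-- Binary operations on reals. -/
inductive RealOp
  | add | sub | mul | div

/-- Exact real arithmetic (division by zero returns zero). -/
def RealOp.eval : RealOp → ℝ → ℝ → ℝ
  | .add, a, b => a + b
  | .sub, a, b => a - b
  | .mul, a, b => a * b
  | .div, a, b => a / b

/-- Instructions; each takes one step. `x y z` name registers and `a` names an array; array
cells are addressed indirectly, by the content of a word register. -/
inductive Instr
  /-- `reg x := c` -/
  | const (x c : ℕ)
  /-- `reg x := op (reg y) (reg z)` -/
  | op (o : WordOp) (x y z : ℕ)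
  /-- `reg x := arr a [reg y]` -/
  | load (x a y : ℕ)
  /-- `arr a [reg y] := reg x` -/
  | store (a y x : ℕ)
  /-- `rreg x := reg y`, a word converted to a real -/
  | rcast (x y : ℕ)
  /-- `rreg x := op (rreg y) (rreg z)` -/
  | rop (o : RealOp) (x y z : ℕ)
  /-- `rreg x := √(rreg y)` -/
  | rsqrt (x y : ℕ)
  /-- `rreg x := rarr a [reg y]` -/
  | rload (x a y : ℕ)
  /-- `rarr a [reg y] := rreg x` -/
  | rstore (a y x : ℕ)

/-- The effect of an instruction. -/
def Instr.apply : Instr → State → State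
  | .const x c, s => { s with reg := Function.update s.reg x c }
  | .op o x y z, s => { s with reg := Function.update s.reg x (o.eval (s.reg y) (s.reg z)) }
  | .load x a y, s => { s with reg := Function.update s.reg x (s.arr a (s.reg y)) }
  | .store a y x, s =>
      { s with arr := Function.update s.arr a (Function.update (s.arr a) (s.reg y) (s.reg x)) }
  | .rcast x y, s => { s with rreg := Function.update s.rreg x (s.reg y : ℝ) }
  | .rop o x y z, s => { s with rreg := Function.update s.rreg x (o.eval (s.rreg y) (s.rreg z)) }
  | .rsqrt x y, s => { s with rreg := Function.update s.rreg x (Real.sqrt (s.rreg y)) }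
  | .rload x a y, s => { s with rreg := Function.update s.rreg x (s.rarr a (s.reg y)) }
  | .rstore a y x, s =>
      { s with rarr := Function.update s.rarr a (Function.update (s.rarr a) (s.reg y) (s.rreg x)) }

/-- The word written by an instruction does not exceed `W`, the largest number a word can hold.
An instruction that would exceed it gets stuck. -/
def Instr.Fits (W : ℕ) : Instr → State → Prop
  | .const _ c, _ => c ≤ W
  | .op o _ y z, s => o.eval (s.reg y) (s.reg z) ≤ W
  | .load _ a y, s => s.arr a (s.reg y) ≤ W
  | .store _ y x, s => s.reg y ≤ W ∧ s.reg x ≤ W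
  | .rcast _ y, s => s.reg y ≤ W
  | .rop _ _ _ _, _ => True
  | .rsqrt _ _, _ => True
  | .rload _ _ y, s => s.reg y ≤ W
  | .rstore _ y _, s => s.reg y ≤ W

/-- Tests: comparison of two word registers or of two real registers. -/
inductive Cond
  | lt (x y : ℕ)
  | eq (x y : ℕ)
  | rlt (x y : ℕ)

def Cond.Holds : Cond → State → Prop
  | .lt x y, s => s.reg x < s.reg y
  | .eq x y, s => s.reg x = s.reg y
  | .rlt x y, s => s.rreg x < s.rreg y

/-- Programs. -/
inductive Prog
  | skip
  | instr (i : Instr)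
  | seq (p q : Prog)
  | ite (c : Cond) (p q : Prog)
  | loop (c : Cond) (p : Prog)

/-- `Exec W p s t s'`: on a machine whose words hold the numbers `0, …, W`, the program `p` started
in the state `s` halts after `t` steps in the state `s'`. Every instruction and every evaluation of
a test is one step; `loop c p` runs `p` as long as the test `c` holds. -/
inductive Exec (W : ℕ) : Prog → State → ℕ → State → Prop
  | skip (s : State) : Exec W .skip s 1 s
  | instr (i : Instr) (s : State) (h : i.Fits W s) : Exec W (.instr i) s 1 (i.apply s)
  | seq {p q : Prog} {s s' s'' : State} {t t' : ℕ} (hp : Exec W p s t s')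
      (hq : Exec W q s' t' s'') : Exec W (.seq p q) s (t + t') s''
  | iteTrue {c : Cond} {p q : Prog} {s s' : State} {t : ℕ} (hc : c.Holds s)
      (hp : Exec W p s t s') : Exec W (.ite c p q) s (t + 1) s'
  | iteFalse {c : Cond} {p q : Prog} {s s' : State} {t : ℕ} (hc : ¬ c.Holds s)
      (hq : Exec W q s t s') : Exec W (.ite c p q) s (t + 1) s'
  | loopTrue {c : Cond} {p : Prog} {s s' s'' : State} {t t' : ℕ} (hc : c.Holds s)
      (hp : Exec W p s t s') (hl : Exec W (.loop c p) s' t' s'') :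
      Exec W (.loop c p) s (t + t' + 1) s''
  | loopFalse {c : Cond} {p : Prog} {s : State} (hc : ¬ c.Holds s) : Exec W (.loop c p) s 1 s

/-- The two machine models: the word RAM, and the real RAM, which has in addition registers and
arrays of real numbers, with exact arithmetic, square roots and comparisons at unit cost. -/
inductive Model
  | wordRAM
  | realRAM

/-- The instruction does not touch real registers or real arrays. -/
def Instr.WordOnly : Instr → Prop
  | .const _ _ | .op _ _ _ _ | .load _ _ _ | .store _ _ _ => True
  | .rcast _ _ | .rop _ _ _ _ | .rsqrt _ _ | .rload _ _ _ | .rstore _ _ _ => False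

def Cond.WordOnly : Cond → Prop
  | .lt _ _ | .eq _ _ => True
  | .rlt _ _ => False

def Prog.WordOnly : Prog → Prop
  | .skip => True
  | .instr i => i.WordOnly
  | .seq p q => p.WordOnly ∧ q.WordOnly
  | .ite c p q => c.WordOnly ∧ p.WordOnly ∧ q.WordOnly
  | .loop c p => c.WordOnly ∧ p.WordOnly

/-- The programs of a machine model. -/
def Prog.For (p : Prog) : Model → Prop
  | .wordRAM => p.WordOnly
  | .realRAM => True

/-! ## Orthogonal Vectors and k-SAT -/

/-- Input of an Orthogonal Vectors instance: registers 0 and 1 hold `N` and `D`, the arrays 0 and 1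
hold the coordinates of the vectors of the two sets, vector after vector. All else is zero. -/
def ovInput {N D : ℕ} (U V : Fin N → Fin D → Bool) : State where
  reg := fun r => if r = 0 then N else if r = 1 then D else 0
  arr := fun a x =>
    if h : x / D < N ∧ x % D < D then
      if a = 0 then (U ⟨x / D, h.1⟩ ⟨x % D, h.2⟩).toNat
      else if a = 1 then (V ⟨x / D, h.1⟩ ⟨x % D, h.2⟩).toNat
      else 0
    else 0
  rreg := fun _ => 0
  rarr := fun _ _ => 0

/-- Some `u ∈ U` and `v ∈ V` are orthogonal. -/
def HasOrthogonalPair {N D : ℕ} (U V : Fin N → Fin D → Bool) : Prop :=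
  ∃ i j, ∀ k, ¬ (U i k = true ∧ V j k = true)

/-- Orthogonal Vectors can be decided in time `D^{O(1)} N^{2-ε}` (answer in register 0), with words
of `O(log (N D))` bits. -/
def OVSolvable (M : Model) (ε : ℝ) : Prop :=
  ∃ (p : Prog) (C : ℝ) (c κ : ℕ), p.For M ∧
    ∀ (N D : ℕ), 1 ≤ N → 1 ≤ D → ∀ U V : Fin N → Fin D → Bool,
      ∃ (t : ℕ) (s : State), Exec ((N * D + 1) ^ κ) p (ovInput U V) t s ∧
        (t : ℝ) ≤ C * (D : ℝ) ^ c * (N : ℝ) ^ (2 - ε) ∧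
        (s.reg 0 = 1 ↔ HasOrthogonalPair U V)

/-- The Orthogonal Vectors hypothesis. -/
def OVHypothesis (M : Model) : Prop :=
  ∀ ε : ℝ, 0 < ε → ¬ OVSolvable M ε

/-- A `k`-CNF formula with `n` variables and `m` clauses, each a list of `k` literals
(a literal is a variable with its sign; literals may be repeated). -/
abbrev KCNF (k n m : ℕ) : Type := Fin m → Fin k → Fin n × Bool

def KCNF.Satisfiable {k n m : ℕ} (F : KCNF k n m) : Prop :=
  ∃ x : Fin n → Bool, ∀ j, ∃ l, x (F j l).1 = (F j l).2

/-- Input of a `k`-SAT instance: registers 0 and 1 hold `n` and `m`, the arrays 0 and 1 hold the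
variables and the signs of the literals, clause after clause. All else is zero. -/
def satInput {k n m : ℕ} (F : KCNF k n m) : State where
  reg := fun r => if r = 0 then n else if r = 1 then m else 0
  arr := fun a x =>
    if h : x / k < m ∧ x % k < k then
      if a = 0 then ((F ⟨x / k, h.1⟩ ⟨x % k, h.2⟩).1 : ℕ)
      else if a = 1 then (F ⟨x / k, h.1⟩ ⟨x % k, h.2⟩).2.toNat
      else 0
    else 0
  rreg := fun _ => 0
  rarr := fun _ _ => 0

/-- `k`-SAT with `n` variables and `m` clauses can be decided in time `m^{O(1)} 2^{(1-ε)n}` (answer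
in register 0), with words of `O(n + log m)` bits. -/
def KSATSolvable (M : Model) (k : ℕ) (ε : ℝ) : Prop :=
  ∃ (p : Prog) (C : ℝ) (c κ : ℕ), p.For M ∧
    ∀ (n m : ℕ) (F : KCNF k n m),
      ∃ (t : ℕ) (s : State), Exec ((2 ^ n * (m + 2)) ^ κ) p (satInput F) t s ∧
        (t : ℝ) ≤ C * ((m : ℝ) + 1) ^ c * (2 : ℝ) ^ ((1 - ε) * (n : ℝ)) ∧
        (s.reg 0 = 1 ↔ F.Satisfiable)

/-- The Strong Exponential Time Hypothesis. -/
def SETH (M : Model) : Prop :=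
  ∀ ε : ℝ, 0 < ε → ∃ k : ℕ, ¬ KSATSolvable M k ε

/-! ## Algorithms for the flipped Fréchet measure -/

/-- The inputs for the two models: pairs of curves in the plane with `n` vertices each. On the
real RAM the coordinates are arbitrary reals, on the word RAM integers between `0` and `n`. -/
def CurveInput (n : ℕ) : Model → Type
  | .wordRAM => { PQ : (ℕ → ℕ × ℕ) × (ℕ → ℕ × ℕ) //
      ∀ i < n, (PQ.1 i).1 ≤ n ∧ (PQ.1 i).2 ≤ n ∧ (PQ.2 i).1 ≤ n ∧ (PQ.2 i).2 ≤ n }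
  | .realRAM => (ℕ → Plane) × (ℕ → Plane)

/-- The point of the plane with natural coordinates. -/
def gridPoint (z : ℕ × ℕ) : Plane := !₂[(z.1 : ℝ), (z.2 : ℝ)]

/-- The vertices of the first curve. -/
def CurveInput.fst {n : ℕ} : {M : Model} → CurveInput n M → ℕ → Plane
  | .wordRAM, I => fun i => gridPoint (I.1.1 i)
  | .realRAM, I => I.1

/-- The vertices of the second curve. -/
def CurveInput.snd {n : ℕ} : {M : Model} → CurveInput n M → ℕ → Plane
  | .wordRAM, I => fun i => gridPoint (I.1.2 i)
  | .realRAM, I => I.2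

/-- Input of two curves: register 0 holds `n`; the arrays 0, 1, 2, 3 (of words, respectively of
reals) hold the x- and y-coordinates of the first `n` vertices of the first curve and of the second
curve. All else is zero. -/
def CurveInput.state {n : ℕ} : {M : Model} → CurveInput n M → State
  | .wordRAM, I =>
    { reg := fun r => if r = 0 then n else 0
      arr := fun a i =>
        if i < n then
          if a = 0 then (I.1.1 i).1 else if a = 1 then (I.1.1 i).2
          else if a = 2 then (I.1.2 i).1 else if a = 3 then (I.1.2 i).2 else 0
        else 0
      rreg := fun _ => 0
      rarr := fun _ _ => 0 }
  | .realRAM, I =>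
    { reg := fun r => if r = 0 then n else 0
      arr := fun _ _ => 0
      rreg := fun _ => 0
      rarr := fun a i =>
        if i < n then
          if a = 0 then I.1 i 0 else if a = 1 then I.1 i 1
          else if a = 2 then I.2 i 0 else if a = 3 then I.2 i 1 else 0
        else 0 }

/-- The final state `s` shows the number `v`: as the fraction `reg 0 / reg 1` on the word RAM, in
the real register 0 on the real RAM. -/
def OutputsValue (s : State) (v : ℝ) : Model → Prop
  | .wordRAM => 0 < s.reg 1 ∧ v = (s.reg 0 : ℝ) / (s.reg 1 : ℝ)
  | .realRAM => v = s.rreg 0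

/-- A program computes in time `O(n^{2-δ})`, with words of `O(log n)` bits, a number `v` with
`β · FF ≤ v ≤ FF` for any two curves of length `n`. For `β = 1` this is `v = FF`. -/
def FFValueSolvable (M : Model) (β δ : ℝ) : Prop :=
  ∃ (p : Prog) (C : ℝ) (κ : ℕ), p.For M ∧
    ∀ n : ℕ, 1 ≤ n → ∀ I : CurveInput n M,
      ∃ (t : ℕ) (s : State) (v : ℝ), Exec ((n + 1) ^ κ) p I.state t s ∧
        (t : ℝ) ≤ C * (n : ℝ) ^ (2 - δ) ∧
        OutputsValue s v M ∧ β * FF n n I.fst I.snd ≤ v ∧ v ≤ FF n n I.fst I.snd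

/-- A piecewise linear traversal of two curves, given by `m + 1` pairs of positions. The `k`-th
position on the first curve is at the fraction `lam k` of edge `i k`, on the second curve at the
fraction `mu k` of edge `j k`. -/
structure TraversalCode where
  m : ℕ
  i : ℕ → ℕ
  lam : ℕ → ℝ
  j : ℕ → ℕ
  mu : ℕ → ℝ

namespace TraversalCode

/-- Parameter of the `k`-th position on the first curve. -/
def posFst (T : TraversalCode) (k : ℕ) : ℝ := T.i k + T.lam k

/-- Parameter of the `k`-th position on the second curve. -/
def posSnd (T : TraversalCode) (k : ℕ) : ℝ := T.j k + T.mu k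

/-- The first coordinate of the encoded traversal: at time `k / m` it is at the `k`-th position,
with linear interpolation in between. -/
def f (T : TraversalCode) (t : ℝ) : ℝ := polyline T.posFst (T.m * t)

/-- The second coordinate of the encoded traversal. -/
def g (T : TraversalCode) (t : ℝ) : ℝ := polyline T.posSnd (T.m * t)

/-- The code describes a traversal of two curves with `n` vertices, where moreover from the `k`-th to
the `(k+1)`-st pair of positions each agent stays on one edge, namely on `i k` and `j k`. -/
def Valid (T : TraversalCode) (n : ℕ) : Prop :=
  (∀ k ≤ T.m, 0 ≤ T.lam k ∧ T.lam k ≤ 1 ∧ 0 ≤ T.mu k ∧ T.mu k ≤ 1) ∧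
  (∀ k < T.m, T.posFst (k + 1) ≤ T.i k + 1 ∧ T.posSnd (k + 1) ≤ T.j k + 1) ∧
  IsTraversal n T.f ∧ IsTraversal n T.g

end TraversalCode

/-- The final state `s` shows the traversal `T`: register 0 holds `m`; on the word RAM the arrays
0 to 5 hold `i k`, numerator and denominator of `lam k`, `j k`, numerator and denominator of `mu k`;
on the real RAM the word arrays 0 and 1 hold `i k` and `j k`, the real arrays 0 and 1 hold `lam k`
and `mu k`. -/
def OutputsTraversal (s : State) (T : TraversalCode) : Model → Prop
  | .wordRAM => T.m = s.reg 0 ∧ ∀ k ≤ T.m,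
      T.i k = s.arr 0 k ∧ 0 < s.arr 2 k ∧ T.lam k = (s.arr 1 k : ℝ) / (s.arr 2 k : ℝ) ∧
      T.j k = s.arr 3 k ∧ 0 < s.arr 5 k ∧ T.mu k = (s.arr 4 k : ℝ) / (s.arr 5 k : ℝ)
  | .realRAM => T.m = s.reg 0 ∧ ∀ k ≤ T.m,
      T.i k = s.arr 0 k ∧ T.lam k = s.rarr 0 k ∧ T.j k = s.arr 1 k ∧ T.mu k = s.rarr 1 k

/-- A program computes in time `O(n^{2-δ})` (the length of the output is counted), with words of
`O(log n)` bits, for any two curves of length `n` a traversal that maintains a separation of at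
least `β · FF`. -/
def FFTraversalSolvable (M : Model) (β δ : ℝ) : Prop :=
  ∃ (p : Prog) (C : ℝ) (κ : ℕ), p.For M ∧
    ∀ n : ℕ, 1 ≤ n → ∀ I : CurveInput n M,
      ∃ (t : ℕ) (s : State) (T : TraversalCode), Exec ((n + 1) ^ κ) p I.state t s ∧
        (t : ℝ) + T.m ≤ C * (n : ℝ) ^ (2 - δ) ∧
        OutputsTraversal s T M ∧ T.Valid n ∧
        β * FF n n I.fst I.snd ≤ separation I.fst I.snd T.f T.g

end

/-!
# Quadratic lower bounds for the flipped Fréchet measure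

A fast algorithm for the flipped Fréchet measure gives a fast algorithm for Orthogonal Vectors,
which the Orthogonal Vectors hypothesis excludes, and so does the SETH by splitting the variables
of a formula into two halves and listing the assignments of each half
(`kSATSolvable_of_ovSolvable`).

**The curves.** Both curves walk counterclockwise around the same centre, at the distances 3 and 4
from it, and can stay far apart only on opposite sides. In each round a bit of the first curve may
draw its east vertex, and a bit of the second curve its west vertex, in to the centre. A round in
lockstep with a distance of more than 3 is possible if and only if not both bits are set, and then
the distance 4 is possible (`FarPath.bits_disjoint`, `reach_round`). The first curve consists of
one block of rounds per vector of the first family, separated by excursions to the far north and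
south, during which only the points near both ends of the second curve are far enough away. Hence
at a distance of more than 3 the second agent waits near its start until some block, passes a
window of consecutive rounds in lockstep with that block, and waits near its end during the later
blocks (`Gadgets.exists_window`); conversely, a block and a window with disjoint bits give a
traversal with separation 4 (`Gadgets.exists_far_traversal`). The vectors are encoded such that a
window with bits disjoint from those of a block is the code of one whole vector orthogonal to that
of the block (`window_aligned`). So the measure is at least 4 if there is an orthogonal pair
(`four_le_FF`) and at most 3 otherwise (`FF_le_three`), and `β * 4 > 3` separates the two cases
(`three_lt_mul`).

To bound separations from above, the pairs of positions at a distance of at most 3 form barriers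
in the parameter rectangle, each a chain of horizontal and vertical segments. On a part of an
edge, nearness of both ends to a fixed point implies nearness in between, because discs are
convex; therefore a barrier is checked at finitely many pairs of points. To construct a traversal,
it suffices to move one agent at a time along an edge, while the other one waits at a vertex, and
to separate this vertex from the edge by a linear functional.

**The algorithms.** A program for values is run on the curves of the instance, and its output is
compared with 3. The edges visited in a piece of a traversal name a vector of each family; if
there is an orthogonal pair, then a traversal with separation more than 3 names such a pair in one
of its pieces (`exists_orthAt_of_code`), and all of its pieces can be tested, as there are
subquadratically many.

**The machines.** Word expressions are compiled to straight-line code over scratch registers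
(`Ex.code_exec`), and `Runs` specifies programs up to the content of these registers. The given
algorithm is run as a subroutine on the odd registers (`runs_sub`); all values met are
polynomially bounded, so that words of logarithmic length suffice (`Ex.ok_of_deg`).
-/

/-! ### Word expressions and their compilation -/

/-- Expressions over word registers and word arrays; `ifLt a b c d` is `c` if `a < b`, else `d`. -/
inductive Ex
  | lit (c : ℕ)
  | reg (r : ℕ)
  | op (o : WordOp) (a b : Ex)
  | get (a : ℕ) (e : Ex)
  | ifLt (a b c d : Ex)

/-- The scratch registers: the even ones from 20 on. -/
def scr (i : ℕ) : ℕ := 2 * i + 20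

/-- `r` is a scratch register. -/
def IsScr (r : ℕ) : Prop := r % 2 = 0 ∧ 20 ≤ r

/-- The two states agree up to scratch registers (for reals, all even registers are scratch). -/
def Agree (s σ : State) : Prop :=
  (∀ r, ¬ IsScr r → s.reg r = σ.reg r) ∧ s.arr = σ.arr ∧
    (∀ r, s.rreg (2 * r + 1) = σ.rreg (2 * r + 1)) ∧ s.rarr = σ.rarr

namespace Ex

/-- The value of an expression. -/
def eval (s : State) : Ex → ℕ
  | lit c => c
  | reg r => s.reg r
  | op o a b => o.eval (a.eval s) (b.eval s)
  | get a e => s.arr a (e.eval s)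
  | ifLt a b c d => if a.eval s < b.eval s then c.eval s else d.eval s

/-- All values met in the evaluation are at most `W`. -/
def Ok (W : ℕ) (s : State) : Ex → Prop
  | lit c => c ≤ W
  | reg r => s.reg r ≤ W
  | op o a b => a.Ok W s ∧ b.Ok W s ∧ o.eval (a.eval s) (b.eval s) ≤ W
  | get a e => e.Ok W s ∧ s.arr a (e.eval s) ≤ W
  | ifLt a b c d => a.Ok W s ∧ b.Ok W s ∧ c.Ok W s ∧ d.Ok W s

/-- The expression reads no scratch register. -/
def Clean : Ex → Prop
  | lit _ => True
  | reg r => ¬ IsScr r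
  | op _ a b => a.Clean ∧ b.Clean
  | get _ e => e.Clean
  | ifLt a b c d => a.Clean ∧ b.Clean ∧ c.Clean ∧ d.Clean

/-- Code that writes the value of the expression into the scratch register `scr d`, using only the
scratch registers from `scr d` on. -/
def code : Ex → ℕ → Prog
  | lit c, d => .instr (.const (scr d) c)
  | reg r, d => .instr (.op .or (scr d) r r)
  | op o a b, d => .seq (a.code d) (.seq (b.code (d + 1)) (.instr (.op o (scr d) (scr d) (scr (d + 1)))))
  | get a e, d => .seq (e.code d) (.instr (.load (scr d) a (scr d)))
  | ifLt a b c e, d =>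
      .seq (a.code d) (.seq (b.code (d + 1)) (.ite (.lt (scr d) (scr (d + 1))) (c.code d) (e.code d)))

/-- An upper bound on the running time of `code`. -/
def cost : Ex → ℕ
  | lit _ => 1
  | reg _ => 1
  | op _ a b => a.cost + b.cost + 1
  | get _ e => e.cost + 1
  | ifLt a b c d => a.cost + b.cost + c.cost + d.cost + 1

/-- The degree of a polynomial bound on the values met in the evaluation. -/
def deg : Ex → ℕ
  | lit c => c
  | reg _ => 1
  | op _ a b => a.deg + b.deg + 1
  | get _ e => e.deg + 1
  | ifLt a b c d => a.deg + b.deg + c.deg + d.deg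

/-- The expression uses only operations under which polynomial bounds are preserved. -/
def Poly : Ex → Prop
  | lit _ => True
  | reg _ => True
  | op o a b => (o = .add ∨ o = .sub ∨ o = .mul ∨ o = .div ∨ o = .mod ∨ o = .shr) ∧ a.Poly ∧ b.Poly
  | get _ e => e.Poly
  | ifLt a b c d => a.Poly ∧ b.Poly ∧ c.Poly ∧ d.Poly

/-- The expression does not read the array `x`. -/
def NoGet (x : ℕ) : Ex → Prop
  | lit _ => True
  | reg _ => True
  | op _ a b => a.NoGet x ∧ b.NoGet x
  | get a e => a ≠ x ∧ e.NoGet x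
  | ifLt a b c d => a.NoGet x ∧ b.NoGet x ∧ c.NoGet x ∧ d.NoGet x

end Ex

lemma isScr_scr (d : ℕ) : IsScr (scr d) := by unfold IsScr scr; omega

lemma not_isScr_odd (r : ℕ) : ¬ IsScr (2 * r + 1) := by unfold IsScr; omega

lemma Agree.refl (s : State) : Agree s s := ⟨fun _ _ => rfl, rfl, fun _ => rfl, rfl⟩

lemma Agree.scr_update {s σ : State} (h : Agree s σ) (d v : ℕ) :
    Agree { s with reg := Function.update s.reg (scr d) v } σ := by
  refine ⟨fun r hr => ?_, h.2⟩
  have : r ≠ scr d := fun e => hr (e ▸ isScr_scr d)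
  simp [Function.update_of_ne this, h.1 r hr]

/-- The compiled code evaluates the expression, and leaves everything but scratch registers from
`scr d` on unchanged. -/
lemma Ex.code_exec {W : ℕ} {σ : State} (e : Ex) (hc : e.Clean) (ho : e.Ok W σ) (d : ℕ)
    (s : State) (h : Agree s σ) :
    ∃ t s', Exec W (e.code d) s t s' ∧ t ≤ e.cost ∧ Agree s' σ ∧ s'.reg (scr d) = e.eval σ ∧
      ∀ i < d, s'.reg (scr i) = s.reg (scr i) := by
  have upd : ∀ (s : State) (d v i : ℕ), i < d →
      (Function.update s.reg (scr d) v) (scr i) = s.reg (scr i) := by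
    intro s d v i hi
    rw [Function.update_of_ne]; unfold scr; omega
  induction e generalizing d s with
  | lit c =>
    exact ⟨1, _, .instr _ _ ho, le_rfl, h.scr_update d c, by simp [Ex.eval, Instr.apply],
      fun i hi => upd s d c i hi⟩
  | reg r =>
    have e1 : s.reg r = σ.reg r := h.1 r hc
    refine ⟨1, _, .instr _ _ ?_, le_rfl, h.scr_update d _, ?_, fun i hi => upd s d _ i hi⟩
    · simpa [Instr.Fits, WordOp.eval, e1, Ex.Ok] using ho
    · simp [Ex.eval, WordOp.eval, e1, Instr.apply]
  | op o a b iha ihb =>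
    obtain ⟨t1, s1, x1, c1, a1, r1, k1⟩ := iha hc.1 ho.1 d s h
    obtain ⟨t2, s2, x2, c2, a2, r2, k2⟩ := ihb hc.2 ho.2.1 (d + 1) s1 a1
    have r1' : s2.reg (scr d) = a.eval σ := by rw [k2 d (by omega), r1]
    refine ⟨_, _, .seq x1 (.seq x2 (.instr _ _ ?_)), ?_, a2.scr_update d _, ?_, fun i hi => ?_⟩
    · simpa [Instr.Fits, r1', r2] using ho.2.2
    · simp only [Ex.cost]; omega
    · simp [Ex.eval, r1', r2, Instr.apply]
    · rw [← k1 i hi, ← k2 i (by omega)]; exact upd s2 d _ i hi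
  | get a e ih =>
    obtain ⟨t1, s1, x1, c1, a1, r1, k1⟩ := ih hc ho.1 d s h
    refine ⟨_, _, .seq x1 (.instr _ _ ?_), ?_, a1.scr_update d _, ?_, fun i hi => ?_⟩
    · simpa [Instr.Fits, r1, a1.2.1] using ho.2
    · simp only [Ex.cost]; omega
    · simp [Ex.eval, r1, a1.2.1, Instr.apply]
    · rw [← k1 i hi]; exact upd s1 d _ i hi
  | ifLt a b c e iha ihb ihc ihe =>
    obtain ⟨t1, s1, x1, c1, a1, r1, k1⟩ := iha hc.1 ho.1 d s h
    obtain ⟨t2, s2, x2, c2, a2, r2, k2⟩ := ihb hc.2.1 ho.2.1 (d + 1) s1 a1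
    have r1' : s2.reg (scr d) = a.eval σ := by rw [k2 d (by omega), r1]
    by_cases hlt : a.eval σ < b.eval σ
    · obtain ⟨t3, s3, x3, c3, a3, r3, k3⟩ := ihc hc.2.2.1 ho.2.2.1 d s2 a2
      refine ⟨_, _, .seq x1 (.seq x2 (.iteTrue ?_ x3)), ?_, a3, ?_, fun i hi => ?_⟩
      · simpa [Cond.Holds, r1', r2] using hlt
      · simp only [Ex.cost]; omega
      · simp [Ex.eval, hlt, r3]
      · rw [k3 i hi, k2 i (by omega), k1 i hi]
    · obtain ⟨t3, s3, x3, c3, a3, r3, k3⟩ := ihe hc.2.2.2 ho.2.2.2 d s2 a2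
      refine ⟨_, _, .seq x1 (.seq x2 (.iteFalse ?_ x3)), ?_, a3, ?_, fun i hi => ?_⟩
      · simpa [Cond.Holds, r1', r2] using hlt
      · simp only [Ex.cost]; omega
      · simp [Ex.eval, hlt, r3]
      · rw [k3 i hi, k2 i (by omega), k1 i hi]

lemma Ex.code_wordOnly (e : Ex) (d : ℕ) : (e.code d).WordOnly := by
  induction e generalizing d with
  | lit c => trivial
  | reg r => trivial
  | op o a b iha ihb => exact ⟨iha d, ihb _, trivial⟩
  | get a e ih => exact ⟨ih d, trivial⟩
  | ifLt a b c e iha ihb ihc ihe => exact ⟨iha d, ihb _, trivial, ihc d, ihe d⟩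

/-- All words in the memory are at most `V`. -/
def WB (V : ℕ) (s : State) : Prop := (∀ r, s.reg r ≤ V) ∧ ∀ a x, s.arr a x ≤ V

lemma Ex.eval_le {V : ℕ} {s : State} (hV : 2 ≤ V) (h : WB V s) (e : Ex) (he : e.Poly) :
    e.eval s ≤ V ^ e.deg := by
  have hp : ∀ k, 1 ≤ V ^ k := fun k => Nat.one_le_pow _ _ (by omega)
  induction e with
  | lit c => exact (Nat.lt_two_pow_self).le.trans (Nat.pow_le_pow_left hV c)
  | reg r => simpa [Ex.eval, Ex.deg] using h.1 r
  | op o a b iha ihb =>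
    have ha := iha he.2.1
    have hb := ihb he.2.2
    have hA := hp a.deg
    have hB := hp b.deg
    have hab : V ^ a.deg * V ^ b.deg * 2 ≤ V ^ (a.deg + b.deg + 1) := by
      rw [pow_succ, pow_add]; exact Nat.mul_le_mul_left _ hV
    have hA' : V ^ a.deg ≤ V ^ a.deg * V ^ b.deg := Nat.le_mul_of_pos_right _ hB
    have hB' : V ^ b.deg ≤ V ^ a.deg * V ^ b.deg := Nat.le_mul_of_pos_left _ hA
    simp only [Ex.eval, Ex.deg]
    rcases he.1 with rfl | rfl | rfl | rfl | rfl | rfl <;> simp only [WordOp.eval]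
    · omega
    · omega
    · have := Nat.mul_le_mul ha hb; omega
    · have := Nat.div_le_self (a.eval s) (b.eval s); omega
    · have := Nat.mod_le (a.eval s) (b.eval s); omega
    · have : a.eval s >>> b.eval s ≤ a.eval s := by
        rw [Nat.shiftRight_eq_div_pow]; exact Nat.div_le_self _ _
      omega
  | get a e ih =>
    refine (h.2 _ _).trans ?_
    simp only [Ex.deg, pow_succ]
    exact Nat.le_mul_of_pos_left _ (hp _)
  | ifLt a b c d iha ihb ihc ihd =>
    simp only [Ex.eval, Ex.deg]
    split_ifs
    · exact (ihc he.2.2.1).trans (Nat.pow_le_pow_right (by omega) (by omega))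
    · exact (ihd he.2.2.2).trans (Nat.pow_le_pow_right (by omega) (by omega))

lemma Ex.ok_of_deg {V : ℕ} {s : State} (hV : 2 ≤ V) (h : WB V s) (e : Ex) (he : e.Poly)
    {W : ℕ} (hW : V ^ e.deg ≤ W) : e.Ok W s := by
  have hmono : ∀ {i j : ℕ}, i ≤ j → V ^ i ≤ V ^ j := fun hij => Nat.pow_le_pow_right (by omega) hij
  have hself := Ex.eval_le hV h e he
  induction e with
  | lit c => exact hself.trans hW
  | reg r => exact hself.trans hW
  | op o a b iha ihb =>
    refine ⟨iha he.2.1 (le_trans (hmono ?_) hW) (Ex.eval_le hV h a he.2.1),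
      ihb he.2.2 (le_trans (hmono ?_) hW) (Ex.eval_le hV h b he.2.2), hself.trans hW⟩ <;>
    simp only [Ex.deg] <;> omega
  | get a e ih =>
    refine ⟨ih he (le_trans (hmono ?_) hW) (Ex.eval_le hV h e he), hself.trans hW⟩
    simp only [Ex.deg]; omega
  | ifLt a b c d iha ihb ihc ihd =>
    refine ⟨iha he.1 (le_trans (hmono ?_) hW) (Ex.eval_le hV h a he.1),
      ihb he.2.1 (le_trans (hmono ?_) hW) (Ex.eval_le hV h b he.2.1),
      ihc he.2.2.1 (le_trans (hmono ?_) hW) (Ex.eval_le hV h c he.2.2.1),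
      ihd he.2.2.2 (le_trans (hmono ?_) hW) (Ex.eval_le hV h d he.2.2.2)⟩ <;>
    simp only [Ex.deg] <;> omega

lemma Ex.eval_noGet {s : State} {a : ℕ} (e : Ex) (he : e.NoGet a) (F : ℕ → ℕ) :
    e.eval { s with arr := Function.update s.arr a F } = e.eval s := by
  induction e with
  | lit c => rfl
  | reg r => rfl
  | op o x y ihx ihy => simp [Ex.eval, ihx he.1, ihy he.2]
  | get x e ih => simp [Ex.eval, ih he.2, Function.update_of_ne he.1]
  | ifLt x y z w ihx ihy ihz ihw =>
    simp [Ex.eval, ihx he.1, ihy he.2.1, ihz he.2.2.1, ihw he.2.2.2]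

/-! ### Specifications of programs up to scratch registers -/

/-- From every state that agrees with `σ`, the program `p` halts within `T` steps in a state that
agrees with one satisfying `Q`. -/
def Runs (W : ℕ) (p : Prog) (σ : State) (T : ℕ) (Q : State → Prop) : Prop :=
  ∀ s, Agree s σ → ∃ t s' σ', Exec W p s t s' ∧ t ≤ T ∧ Agree s' σ' ∧ Q σ'

lemma Runs.mono {W : ℕ} {p : Prog} {σ : State} {T T' : ℕ} {Q Q' : State → Prop}
    (h : Runs W p σ T Q) (hT : T ≤ T') (hQ : ∀ σ', Q σ' → Q' σ') : Runs W p σ T' Q' := by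
  intro s hs
  obtain ⟨t, s', σ', h1, h2, h3, h4⟩ := h s hs
  exact ⟨t, s', σ', h1, h2.trans hT, h3, hQ _ h4⟩

lemma Runs.seq {W : ℕ} {p q : Prog} {σ : State} {T T' : ℕ} {Q R : State → Prop}
    (h : Runs W p σ T Q) (h' : ∀ σ', Q σ' → Runs W q σ' T' R) :
    Runs W (.seq p q) σ (T + T') R := by
  intro s hs
  obtain ⟨t, s', σ', h1, h2, h3, h4⟩ := h s hs
  obtain ⟨t', s'', σ'', k1, k2, k3, k4⟩ := h' σ' h4 s' h3
  exact ⟨_, s'', σ'', .seq h1 k1, by omega, k3, k4⟩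

/-- `σ` with the value `v` in the word register `x`. -/
def State.set (σ : State) (x v : ℕ) : State := { σ with reg := Function.update σ.reg x v }

/-- `σ` with the word array `a` replaced by `F`. -/
def State.setArr (σ : State) (a : ℕ) (F : ℕ → ℕ) : State :=
  { σ with arr := Function.update σ.arr a F }

/-- `σ` with the real array `a` replaced by `F`. -/
def State.setRarr (σ : State) (a : ℕ) (F : ℕ → ℝ) : State :=
  { σ with rarr := Function.update σ.rarr a F }

/-- The assignment of an expression to a register. -/
def assign (x : ℕ) (e : Ex) : Prog := .seq (e.code 0) (.instr (.op .or x (scr 0) (scr 0)))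

lemma Agree.set {s σ : State} (h : Agree s σ) (x v : ℕ) : Agree (s.set x v) (σ.set x v) := by
  refine ⟨fun r hr => ?_, h.2⟩
  by_cases hx : r = x
  · subst hx; simp [State.set]
  · simp [State.set, Function.update_of_ne hx, h.1 r hr]

lemma Ex.eval_le_of_ok {W : ℕ} {σ : State} (e : Ex) (h : e.Ok W σ) : e.eval σ ≤ W := by
  induction e with
  | lit c => exact h
  | reg r => exact h
  | op o a b _ _ => exact h.2.2
  | get a e _ => exact h.2
  | ifLt a b c d _ _ ihc ihd =>
    simp only [Ex.eval]; split_ifs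
    · exact ihc h.2.2.1
    · exact ihd h.2.2.2

lemma runs_assign {W : ℕ} {σ : State} {e : Ex} {x : ℕ} (hc : e.Clean) (ho : e.Ok W σ)
    {Q : State → Prop} (hQ : Q (σ.set x (e.eval σ))) : Runs W (assign x e) σ (e.cost + 1) Q := by
  intro s hs
  obtain ⟨t, s', h1, h2, h3, h4, -⟩ := e.code_exec hc ho 0 s hs
  refine ⟨_, _, _, .seq h1 (.instr _ _ ?_), by omega, ?_, hQ⟩
  · simpa [Instr.Fits, WordOp.eval, h4] using e.eval_le_of_ok ho
  · have := h3.set x (e.eval σ)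
    simpa [Instr.apply, WordOp.eval, h4, State.set] using this

/-- Writing the value of `v` into the word array `a` at the position `i`. -/
def wput (a : ℕ) (i v : Ex) : Prog :=
  .seq (i.code 0) (.seq (v.code 1) (.instr (.store a (scr 0) (scr 1))))

/-- Writing the value of `v`, converted to a real, into the real array `a` at the position `i`. -/
def rput (a : ℕ) (i v : Ex) : Prog :=
  .seq (i.code 0) (.seq (v.code 1) (.seq (.instr (.rcast 0 (scr 1))) (.instr (.rstore a (scr 0) 0))))

lemma runs_wput {W : ℕ} {σ : State} {a : ℕ} {i v : Ex} (hi : i.Clean) (hio : i.Ok W σ)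
    (hv : v.Clean) (hvo : v.Ok W σ) {Q : State → Prop}
    (hQ : Q (σ.setArr a (Function.update (σ.arr a) (i.eval σ) (v.eval σ)))) :
    Runs W (wput a i v) σ (i.cost + v.cost + 1) Q := by
  intro s hs
  obtain ⟨t, s1, h1, h2, h3, h4, -⟩ := i.code_exec hi hio 0 s hs
  obtain ⟨t', s2, k1, k2, k3, k4, k5⟩ := v.code_exec hv hvo 1 s1 h3
  have e0 : s2.reg (scr 0) = i.eval σ := by rw [k5 0 (by omega), h4]
  refine ⟨_, _, _, .seq h1 (.seq k1 (.instr _ _ ?_)), by omega, ?_, hQ⟩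
  · exact ⟨by rw [e0]; exact i.eval_le_of_ok hio, by rw [k4]; exact v.eval_le_of_ok hvo⟩
  · refine ⟨k3.1, ?_, k3.2.2⟩
    simp [Instr.apply, State.setArr, e0, k4, k3.2.1]

lemma runs_rput {W : ℕ} {σ : State} {a : ℕ} {i v : Ex} (hi : i.Clean) (hio : i.Ok W σ)
    (hv : v.Clean) (hvo : v.Ok W σ) {Q : State → Prop}
    (hQ : Q (σ.setRarr a (Function.update (σ.rarr a) (i.eval σ) (v.eval σ : ℝ)))) :
    Runs W (rput a i v) σ (i.cost + v.cost + 2) Q := by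
  intro s hs
  obtain ⟨t, s1, h1, h2, h3, h4, -⟩ := i.code_exec hi hio 0 s hs
  obtain ⟨t', s2, k1, k2, k3, k4, k5⟩ := v.code_exec hv hvo 1 s1 h3
  have e0 : s2.reg (scr 0) = i.eval σ := by rw [k5 0 (by omega), h4]
  refine ⟨_, _, _, .seq h1 (.seq k1 (.seq (.instr _ _ ?_) (.instr _ _ ?_))), by omega, ?_, hQ⟩
  · show s2.reg (scr 1) ≤ W
    rw [k4]; exact v.eval_le_of_ok hvo
  · show s2.reg (scr 0) ≤ W
    rw [e0]; exact i.eval_le_of_ok hio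
  · refine ⟨k3.1, k3.2.1, fun r => ?_, ?_⟩
    · have : 2 * r + 1 ≠ 0 := by omega
      simpa [Instr.apply, State.setRarr, Function.update_of_ne this] using k3.2.2.1 r
    · simp [Instr.apply, State.setRarr, e0, k4, k3.2.2.2]

/-- Counting loop: the register 8 runs from its present value to that of the register 6. -/
def countLoop (body : Prog) : Prog :=
  .loop (.lt 8 6) (.seq body (assign 8 (.op .add (.reg 8) (.lit 1))))

/-- Rule for counting loops; `I k` is the invariant before the round `k`. -/
lemma runs_countLoop {W n T : ℕ} {body : Prog} (I : ℕ → State → Prop) (hW : n ≤ W) (hW1 : 1 ≤ W)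
    (hreg : ∀ k σ, I k σ → σ.reg 8 = k ∧ σ.reg 6 = n)
    (hbody : ∀ k < n, ∀ σ, I k σ →
      Runs W body σ T (fun σ' => σ'.reg 8 = k ∧ I (k + 1) (σ'.set 8 (k + 1))))
    {σ : State} (h0 : I 0 σ) : Runs W (countLoop body) σ (n * (T + 5) + 1) (I n) := by
  have hstep : ∀ k < n, ∀ σ, I k σ →
      Runs W (.seq body (assign 8 (.op .add (.reg 8) (.lit 1)))) σ (T + 4) (I (k + 1)) := by
    intro k hk σ hσ
    refine Runs.seq (hbody k hk σ hσ) (T' := 4) ?_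
    rintro σ' ⟨h8, hI⟩
    refine runs_assign (e := .op .add (.reg 8) (.lit 1)) ?_ ?_ ?_
    · simp [Ex.Clean, IsScr]
    · refine ⟨?_, hW1, ?_⟩
      · simp only [Ex.Ok, h8]; omega
      · simp only [WordOp.eval, Ex.eval, h8]; omega
    · simpa [Ex.eval, WordOp.eval, h8] using hI
  have main : ∀ j k, k + j = n → ∀ σ, I k σ →
      Runs W (countLoop body) σ (j * (T + 5) + 1) (I n) := by
    intro j
    induction j with
    | zero =>
      intro k hk σ hσ s hs
      have hr := hreg k σ hσ
      obtain rfl : k = n := by omega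
      refine ⟨1, s, σ, .loopFalse ?_, by omega, hs, hσ⟩
      simp only [Cond.Holds, hs.1 8 (by simp [IsScr]), hs.1 6 (by simp [IsScr]), hr]
      omega
    | succ j ih =>
      intro k hk σ hσ s hs
      have hr := hreg k σ hσ
      obtain ⟨t, s', σ', h1, h2, h3, h4⟩ := hstep k (by omega) σ hσ s hs
      obtain ⟨t', s'', σ'', k1, k2, k3, k4⟩ := ih (k + 1) (by omega) σ' h4 s' h3
      refine ⟨_, s'', σ'', .loopTrue ?_ h1 k1, ?_, k3, k4⟩
      · simp only [Cond.Holds, hs.1 8 (by simp [IsScr]), hs.1 6 (by simp [IsScr]), hr]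
        omega
      · have : (j + 1) * (T + 5) = j * (T + 5) + (T + 5) := by ring
        omega
  exact main n 0 (by omega) σ h0

/-- Filling the array `a` with the values of an expression in the register 8. -/
def fill (put : ℕ → Ex → Ex → Prog) (a : ℕ) (e : Ex) : Prog :=
  .seq (assign 8 (.lit 0)) (countLoop (put a (.reg 8) e))

lemma runs_fill {W n a : ℕ} {e : Ex} {σ : State} (hW : n ≤ W) (hW1 : 1 ≤ W)
    (h6 : σ.reg 6 = n) (hc : e.Clean) (hg : e.NoGet a) (ho : ∀ k < n, e.Ok W (σ.set 8 k))
    (hog : ∀ (σ : State) F, e.Ok W σ → e.Ok W (σ.setArr a F))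
    {Q : State → Prop} (hQ : Q ((σ.set 8 n).setArr a
      (fun x => if x < n then e.eval (σ.set 8 x) else σ.arr a x))) :
    Runs W (fill wput a e) σ (n * (e.cost + 7) + 3) Q := by
  refine Runs.mono (Runs.seq (T := 2) (T' := n * (e.cost + 2 + 5) + 1)
    (Q := fun σ' => σ' = σ.set 8 0) (runs_assign (e := .lit 0) trivial (Nat.zero_le _) rfl) ?_)
    (by rw [show e.cost + 2 + 5 = e.cost + 7 from rfl]; omega) (Q := fun σ' => σ' = (σ.set 8 n).setArr a
      (fun x => if x < n then e.eval (σ.set 8 x) else σ.arr a x)) (by rintro _ rfl; exact hQ)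
  rintro _ rfl
  refine runs_countLoop (fun k σ' => σ' = (σ.set 8 k).setArr a
      (fun x => if x < k then e.eval (σ.set 8 x) else σ.arr a x)) hW hW1 ?_ ?_ ?_
  · rintro k _ rfl
    simp [State.set, State.setArr, h6]
  · rintro k hk _ rfl
    refine Runs.mono (runs_wput (i := .reg 8) (v := e) (by simp [Ex.Clean, IsScr]) ?_ hc ?_
      (Q := fun σ' => σ' = (σ.set 8 k).setArr a
        (fun x => if x < k + 1 then e.eval (σ.set 8 x) else σ.arr a x)) ?_)
      (by simp only [Ex.cost]; omega) ?_
    · simp only [Ex.Ok, State.set, State.setArr, Function.update_self]; omega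
    · exact hog _ _ (ho k hk)
    · have := e.eval_noGet hg (s := σ.set 8 k) (fun x => if x < k then e.eval (σ.set 8 x) else σ.arr a x)
      simp only [State.setArr] at this ⊢
      rw [this]
      simp only [Function.update_self, Function.update_idem]
      congr 2
      funext x
      by_cases hx : x = k
      · subst hx; simp [Ex.eval, State.set]
      · have : x < k + 1 ↔ x < k := by omega
        simp [Ex.eval, State.set, Function.update_of_ne hx, this]
    · rintro _ rfl
      refine ⟨by simp [State.set, State.setArr], ?_⟩
      simp [State.set, State.setArr]
  · simp [State.set, State.setArr, Function.update_eq_self]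

lemma runs_rfill {W n a : ℕ} {e : Ex} {σ : State} (hW : n ≤ W) (hW1 : 1 ≤ W)
    (h6 : σ.reg 6 = n) (hc : e.Clean) (ho : ∀ k < n, e.Ok W (σ.set 8 k))
    (hog : ∀ (σ : State) F, e.Ok W σ → e.Ok W (σ.setRarr a F))
    (heg : ∀ (σ : State) F, e.eval (σ.setRarr a F) = e.eval σ)
    {Q : State → Prop} (hQ : Q ((σ.set 8 n).setRarr a
      (fun x => if x < n then (e.eval (σ.set 8 x) : ℝ) else σ.rarr a x))) :
    Runs W (fill rput a e) σ (n * (e.cost + 8) + 3) Q := by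
  refine Runs.mono (Runs.seq (T := 2) (T' := n * (e.cost + 3 + 5) + 1)
    (Q := fun σ' => σ' = σ.set 8 0) (runs_assign (e := .lit 0) trivial (Nat.zero_le _) rfl) ?_)
    (by rw [show e.cost + 3 + 5 = e.cost + 8 from rfl]; omega) (Q := fun σ' => σ' = (σ.set 8 n).setRarr a
      (fun x => if x < n then (e.eval (σ.set 8 x) : ℝ) else σ.rarr a x)) (by rintro _ rfl; exact hQ)
  rintro _ rfl
  refine runs_countLoop (fun k σ' => σ' = (σ.set 8 k).setRarr a
      (fun x => if x < k then (e.eval (σ.set 8 x) : ℝ) else σ.rarr a x)) hW hW1 ?_ ?_ ?_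
  · rintro k _ rfl
    simp [State.set, State.setRarr, h6]
  · rintro k hk _ rfl
    refine Runs.mono (runs_rput (i := .reg 8) (v := e) (by simp [Ex.Clean, IsScr]) ?_ hc ?_
      (Q := fun σ' => σ' = (σ.set 8 k).setRarr a
        (fun x => if x < k + 1 then (e.eval (σ.set 8 x) : ℝ) else σ.rarr a x)) ?_)
      (by simp only [Ex.cost]; omega) ?_
    · simp only [Ex.Ok, State.set, State.setRarr, Function.update_self]; omega
    · exact hog _ _ (ho k hk)
    · rw [heg]
      simp only [State.setRarr, Function.update_self, Function.update_idem]
      congr 2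
      funext x
      by_cases hx : x = k
      · subst hx; simp [Ex.eval, State.set]
      · have : x < k + 1 ↔ x < k := by omega
        simp [Ex.eval, State.set, Function.update_of_ne hx, this]
    · rintro _ rfl
      refine ⟨by simp [State.set, State.setRarr], ?_⟩
      simp [State.set, State.setRarr]
  · simp [State.set, State.setRarr, Function.update_eq_self]

/-! ### Running a program as a subroutine -/

/-- The memory of the subroutine: the odd registers, and all arrays but the first two word arrays. -/
def subState (s : State) : State where
  reg := fun r => s.reg (2 * r + 1)
  arr := fun a => s.arr (a + 2)
  rreg := fun r => s.rreg (2 * r + 1)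
  rarr := s.rarr

/-- The instruction, acting on the memory of the subroutine. -/
def Instr.sub : Instr → Instr
  | .const x c => .const (2 * x + 1) c
  | .op o x y z => .op o (2 * x + 1) (2 * y + 1) (2 * z + 1)
  | .load x a y => .load (2 * x + 1) (a + 2) (2 * y + 1)
  | .store a y x => .store (a + 2) (2 * y + 1) (2 * x + 1)
  | .rcast x y => .rcast (2 * x + 1) (2 * y + 1)
  | .rop o x y z => .rop o (2 * x + 1) (2 * y + 1) (2 * z + 1)
  | .rsqrt x y => .rsqrt (2 * x + 1) (2 * y + 1)
  | .rload x a y => .rload (2 * x + 1) a (2 * y + 1)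
  | .rstore a y x => .rstore a (2 * y + 1) (2 * x + 1)

/-- The test, on the memory of the subroutine. -/
def Cond.sub : Cond → Cond
  | .lt x y => .lt (2 * x + 1) (2 * y + 1)
  | .eq x y => .eq (2 * x + 1) (2 * y + 1)
  | .rlt x y => .rlt (2 * x + 1) (2 * y + 1)

/-- The program, acting on the memory of the subroutine. -/
def Prog.sub : Prog → Prog
  | .skip => .skip
  | .instr i => .instr i.sub
  | .seq p q => .seq p.sub q.sub
  | .ite c p q => .ite c.sub p.sub q.sub
  | .loop c p => .loop c.sub p.sub

lemma Prog.sub_wordOnly {p : Prog} (h : p.WordOnly) : p.sub.WordOnly := by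
  have hi : ∀ i : Instr, i.WordOnly → i.sub.WordOnly := by rintro (_ | _) h <;> exact h
  have hc : ∀ c : Cond, c.WordOnly → c.sub.WordOnly := by rintro (_ | _) h <;> exact h
  induction p with
  | skip => trivial
  | instr i => exact hi i h
  | seq p q ihp ihq => exact ⟨ihp h.1, ihq h.2⟩
  | ite c p q ihp ihq => exact ⟨hc c h.1, ihp h.2.1, ihq h.2.2⟩
  | loop c p ih => exact ⟨hc c h.1, ih h.2⟩

lemma Prog.sub_for {p : Prog} {M : Model} (h : p.For M) : p.sub.For M := by
  cases M
  · exact Prog.sub_wordOnly h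
  · trivial

lemma update_comp_odd {α : Type*} (f : ℕ → α) (x : ℕ) (v : α) :
    (fun r => Function.update f (2 * x + 1) v (2 * r + 1)) =
      Function.update (fun r => f (2 * r + 1)) x v := by
  funext r
  by_cases h : r = x
  · subst h; simp
  · rw [Function.update_of_ne h, Function.update_of_ne (by omega)]

lemma update_comp_add_two {α : Type*} (f : ℕ → α) (x : ℕ) (v : α) :
    (fun r => Function.update f (x + 2) v (r + 2)) = Function.update (fun r => f (r + 2)) x v := by
  funext r
  by_cases h : r = x
  · subst h; simp
  · rw [Function.update_of_ne h, Function.update_of_ne (by omega)]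

lemma subState_apply (i : Instr) (s : State) : subState (i.sub.apply s) = i.apply (subState s) := by
  cases i <;> simp [subState, Instr.sub, Instr.apply, update_comp_odd, update_comp_add_two]

/-- The even registers and the first two word arrays, which no subroutine touches, coincide. -/
def SameOutside (s s' : State) : Prop :=
  (∀ r, r % 2 = 0 → s'.reg r = s.reg r) ∧ ∀ a < 2, s'.arr a = s.arr a

lemma sameOutside_apply (i : Instr) (s : State) : SameOutside s (i.sub.apply s) := by
  refine ⟨fun r hr => ?_, fun a ha => ?_⟩
  · cases i <;> simp only [Instr.sub, Instr.apply] <;> exact Function.update_of_ne (by omega) _ _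
  · have ha' : ∀ b, a ≠ b + 2 := by omega
    cases i <;> simp [Instr.sub, Instr.apply, Function.update_of_ne (ha' _)]

lemma SameOutside.trans {s s' s'' : State} (h : SameOutside s s') (h' : SameOutside s' s'') :
    SameOutside s s'' :=
  ⟨fun r hr => (h'.1 r hr).trans (h.1 r hr), fun a ha => (h'.2 a ha).trans (h.2 a ha)⟩

lemma SameOutside.refl (s : State) : SameOutside s s := ⟨fun _ _ => rfl, fun _ _ => rfl⟩

lemma Cond.sub_holds (c : Cond) (s : State) : c.sub.Holds s ↔ c.Holds (subState s) := by
  cases c <;> rfl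

lemma Instr.sub_fits (W : ℕ) (i : Instr) (s : State) : i.sub.Fits W s ↔ i.Fits W (subState s) := by
  cases i <;> rfl

/-- A subroutine simulates its program, and leaves the rest of the memory unchanged. -/
lemma Exec.sub {W : ℕ} {p : Prog} {σ σ' : State} {t : ℕ} (h : Exec W p σ t σ') :
    ∀ s, subState s = σ → ∃ s', Exec W p.sub s t s' ∧ subState s' = σ' ∧ SameOutside s s' := by
  induction h with
  | skip σ => exact fun s hs => ⟨s, .skip s, hs, .refl s⟩
  | instr i σ hf =>
    rintro s rfl
    exact ⟨_, .instr _ _ ((i.sub_fits W s).2 hf), subState_apply i s, sameOutside_apply i s⟩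
  | seq hp hq ihp ihq =>
    intro s hs
    obtain ⟨s1, h1, h2, h3⟩ := ihp s hs
    obtain ⟨s2, k1, k2, k3⟩ := ihq s1 h2
    exact ⟨s2, .seq h1 k1, k2, h3.trans k3⟩
  | iteTrue hc hp ih =>
    rintro s rfl
    obtain ⟨s1, h1, h2, h3⟩ := ih s rfl
    exact ⟨s1, .iteTrue ((Cond.sub_holds _ s).2 hc) h1, h2, h3⟩
  | iteFalse hc hp ih =>
    rintro s rfl
    obtain ⟨s1, h1, h2, h3⟩ := ih s rfl
    exact ⟨s1, .iteFalse (fun h => hc ((Cond.sub_holds _ s).1 h)) h1, h2, h3⟩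
  | loopTrue hc hp hl ihp ihl =>
    rintro s rfl
    obtain ⟨s1, h1, h2, h3⟩ := ihp s rfl
    obtain ⟨s2, k1, k2, k3⟩ := ihl s1 h2
    exact ⟨s2, .loopTrue ((Cond.sub_holds _ s).2 hc) h1 k1, k2, h3.trans k3⟩
  | loopFalse hc =>
    rintro s rfl
    exact ⟨s, .loopFalse (fun h => hc ((Cond.sub_holds _ s).1 h)), rfl, .refl s⟩

/-- Longer words do no harm. -/
lemma Exec.mono {W W' : ℕ} (hW : W ≤ W') {p : Prog} {s s' : State} {t : ℕ}
    (h : Exec W p s t s') : Exec W' p s t s' := by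
  have hf : ∀ (i : Instr) (s : State), i.Fits W s → i.Fits W' s := by
    intro i s h
    cases i <;> simp only [Instr.Fits] at h ⊢ <;> omega
  induction h with
  | skip σ => exact .skip σ
  | instr i σ h => exact .instr i σ (hf i σ h)
  | seq _ _ ihp ihq => exact .seq ihp ihq
  | iteTrue hc _ ih => exact .iteTrue hc ih
  | iteFalse hc _ ih => exact .iteFalse hc ih
  | loopTrue hc _ _ ihp ihl => exact .loopTrue hc ihp ihl
  | loopFalse hc => exact .loopFalse hc

/-- A program writes no words larger than `W`. -/
lemma Exec.wb {W V : ℕ} (hW : W ≤ V) {p : Prog} {s s' : State} {t : ℕ}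
    (h : Exec W p s t s') (hs : WB V s) : WB V s' := by
  have upd : ∀ (f : ℕ → ℕ) (x v : ℕ), (∀ r, f r ≤ V) → v ≤ V →
      ∀ r, Function.update f x v r ≤ V := by
    intro f x v hf hv r
    by_cases h : r = x
    · subst h; simpa using hv
    · rw [Function.update_of_ne h]; exact hf r
  induction h with
  | skip σ => exact hs
  | instr i σ h =>
    cases i with
    | const x c => exact ⟨upd _ _ _ hs.1 (h.trans hW), hs.2⟩
    | op o x y z => exact ⟨upd _ _ _ hs.1 (le_trans h hW), hs.2⟩
    | load x a y => exact ⟨upd _ _ _ hs.1 (le_trans h hW), hs.2⟩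
    | store a y x =>
      refine ⟨hs.1, fun b => ?_⟩
      by_cases hb : b = a
      · subst hb
        simpa [Instr.apply] using upd _ _ _ (hs.2 b) (h.2.trans hW)
      · simpa [Instr.apply, Function.update_of_ne hb] using hs.2 b
    | rcast x y => exact hs
    | rop o x y z => exact hs
    | rsqrt x y => exact hs
    | rload x a y => exact hs
    | rstore a y x => exact hs
  | seq _ _ ihp ihq => exact ihq (ihp hs)
  | iteTrue hc _ ih => exact ih hs
  | iteFalse hc _ ih => exact ih hs
  | loopTrue hc _ _ ihp ihl => exact ihl (ihp hs)
  | loopFalse hc => exact hs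

/-- Rule for subroutines. -/
lemma runs_sub {W W' : ℕ} (hW : W ≤ W') {p : Prog} {σ s' : State} {t : ℕ}
    (h : Exec W p (subState σ) t s') {Q : State → Prop}
    (hQ : ∀ σ', subState σ' = s' → SameOutside σ σ' → Q σ') :
    Runs W' p.sub σ t Q := by
  intro s hs
  have hsub : subState s = subState σ := by
    have h1 : (fun r => s.reg (2 * r + 1)) = fun r => σ.reg (2 * r + 1) :=
      funext fun r => hs.1 _ (not_isScr_odd r)
    have h2 : (fun r => s.rreg (2 * r + 1)) = fun r => σ.rreg (2 * r + 1) := funext hs.2.2.1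
    simp [subState, h1, h2, hs.2.1, hs.2.2.2]
  obtain ⟨s1, h1, h2, h3⟩ := (h.mono hW).sub s hsub
  -- the abstract final state: scratch registers as in `σ`, everything else as in `s1`
  refine ⟨t, s1, { s1 with reg := fun r => if r % 2 = 0 then σ.reg r else s1.reg r }, h1, le_rfl,
    ⟨fun r hr => ?_, rfl, fun _ => rfl, rfl⟩, hQ _ ?_ ⟨fun r hr => by simp [hr], fun a ha => ?_⟩⟩
  · by_cases h0 : r % 2 = 0
    · simp [h0, h3.1 r h0, hs.1 r hr]
    · simp [h0]
  · rw [← h2]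
    simp [subState]
  · show s1.arr a = σ.arr a
    rw [h3.2 a ha, hs.2.1]

/-! ### Polygonal curves with integer vertices -/

/-- The vertices of a curve with natural coordinates, as points of the plane. -/
noncomputable abbrev crv (P : ℕ → ℕ × ℕ) : ℕ → Plane := fun i => gridPoint (P i)

lemma polyline_add {E : Type*} [AddCommGroup E] [Module ℝ E] (v : ℕ → E) (i : ℕ) {l : ℝ}
    (h0 : 0 ≤ l) (h1 : l ≤ 1) : polyline v (i + l) = AffineMap.lineMap (v i) (v (i + 1)) l := by
  rcases h1.lt_or_eq with h1 | rfl
  · have : ⌊(i : ℝ) + l⌋₊ = i := by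
      rw [Nat.floor_eq_iff (by positivity)]; constructor <;> linarith
    simp [polyline, this]
  · have : ⌊(i : ℝ) + 1⌋₊ = i + 1 := by exact_mod_cast Nat.floor_natCast (R := ℝ) (i + 1)
    simp [polyline, this]

lemma polyline_natCast {E : Type*} [AddCommGroup E] [Module ℝ E] (v : ℕ → E) (i : ℕ) :
    polyline v (i : ℝ) = v i := by
  simpa using polyline_add v i le_rfl zero_le_one

/-- The curve is at the point `(a, b)` at the parameter `x`. -/
def At (P : ℕ → ℕ × ℕ) (x a b : ℝ) : Prop := polyline (crv P) x = !₂[a, b]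

lemma at_edge {P : ℕ → ℕ × ℕ} {i : ℕ} {p p' : ℕ × ℕ} (hp : P i = p) (hp' : P (i + 1) = p')
    {l x : ℝ} (h0 : 0 ≤ l) (h1 : l ≤ 1) (hx : x = i + l) :
    At P x ((1 - l) * p.1 + l * p'.1) ((1 - l) * p.2 + l * p'.2) := by
  subst hx
  unfold At
  rw [polyline_add _ _ h0 h1, crv, crv, hp, hp']
  ext k
  fin_cases k <;> simp [AffineMap.lineMap_apply, gridPoint] <;> ring

lemma at_vertex {P : ℕ → ℕ × ℕ} {i : ℕ} {p : ℕ × ℕ} (hp : P i = p) {x : ℝ} (hx : x = i) :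
    At P x p.1 p.2 := by
  subst hx
  unfold At
  rw [polyline_natCast, crv, hp, gridPoint]

lemma dist_at {P Q : ℕ → ℕ × ℕ} {x y a b c d : ℝ} (hP : At P x a b) (hQ : At Q y c d) :
    ‖polyline (crv P) x - polyline (crv Q) y‖ = √((a - c) ^ 2 + (b - d) ^ 2) := by
  unfold At at hP hQ
  rw [hP, hQ, EuclideanSpace.norm_eq]
  simp [Fin.sum_univ_two]

lemma norm_polyline_edge_le {v : ℕ → Plane} {z : Plane} {r x x' x'' : ℝ} {i : ℕ}
    (hi : (i : ℝ) ≤ x) (hx : x ≤ x'') (hx' : x'' ≤ x') (hi' : x' ≤ i + 1)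
    (h : ‖polyline v x - z‖ ≤ r) (h' : ‖polyline v x' - z‖ ≤ r) : ‖polyline v x'' - z‖ ≤ r := by
  have key : ∀ w, (i : ℝ) ≤ w → w ≤ i + 1 →
      polyline v w = AffineMap.lineMap (v i) (v (i + 1)) (w - i) := by
    intro w h1 h2
    have := polyline_add v i (l := w - i) (by linarith) (by linarith)
    rwa [add_sub_cancel] at this
  have hc : Convex ℝ (AffineMap.lineMap (k := ℝ) (v i) (v (i + 1)) ⁻¹' Metric.closedBall z r) :=
    (convex_closedBall z r).affine_preimage _
  rw [key _ hi (by linarith), ← mem_closedBall_iff_norm] at h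
  rw [key _ (by linarith) hi', ← mem_closedBall_iff_norm] at h'
  rw [key _ (by linarith) (by linarith), ← mem_closedBall_iff_norm]
  exact hc.ordConnected.out h h' ⟨by linarith, by linarith⟩

/-! ### Barriers in the space of pairs of positions -/

lemma IsTraversal.apply_zero {n : ℕ} (hn : 1 ≤ n) {f : ℝ → ℝ} (h : IsTraversal n f) : f 0 = 0 := by
  have hn' : (1 : ℝ) ≤ n := by exact_mod_cast hn
  have h0 : (0 : ℝ) ∈ f '' Icc 0 1 := by rw [h.2.2]; constructor <;> linarith
  obtain ⟨t, ht, hft⟩ := h0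
  have h1 : f 0 ≤ f t := h.2.1 (by simp) ht ht.1
  have h2 : f 0 ∈ Icc (0 : ℝ) (n - 1) := by rw [← h.2.2]; exact mem_image_of_mem f (by simp)
  linarith [h2.1]

lemma IsTraversal.apply_one {n : ℕ} (hn : 1 ≤ n) {f : ℝ → ℝ} (h : IsTraversal n f) :
    f 1 = n - 1 := by
  have hn' : (1 : ℝ) ≤ n := by exact_mod_cast hn
  have h0 : (n - 1 : ℝ) ∈ f '' Icc 0 1 := by rw [h.2.2]; constructor <;> linarith
  obtain ⟨t, ht, hft⟩ := h0
  have h1 : f t ≤ f 1 := h.2.1 ht (by simp) ht.2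
  have h2 : f 1 ∈ Icc (0 : ℝ) (n - 1) := by rw [← h.2.2]; exact mem_image_of_mem f (by simp)
  linarith [h2.2]

/-- A pair of traversals that maintains a separation of more than 3. -/
structure FarPath (n : ℕ) (P Q : ℕ → ℕ × ℕ) (f g : ℝ → ℝ) : Prop where
  pos : 1 ≤ n
  fst : IsTraversal n f
  snd : IsTraversal n g
  far : ∀ t ∈ Icc (0 : ℝ) 1, 3 < ‖polyline (crv P) (f t) - polyline (crv Q) (g t)‖

/-- When the first agent is at `x`, the second one has not yet reached `y`. -/
def Below (f g : ℝ → ℝ) (x y : ℝ) : Prop := ∀ t ∈ Icc (0 : ℝ) 1, f t = x → g t < y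

/-- When the first agent is at `x`, the second one has passed `y`. -/
def Above (f g : ℝ → ℝ) (x y : ℝ) : Prop := ∀ t ∈ Icc (0 : ℝ) 1, f t = x → y < g t

lemma Below.weaken {f g : ℝ → ℝ} {x y y' : ℝ} (h : Below f g x y) (hy : y ≤ y') :
    Below f g x y' := fun t ht hx => (h t ht hx).trans_le hy

section Barrier

variable {n : ℕ} {P Q : ℕ → ℕ × ℕ} {f g : ℝ → ℝ}

lemma FarPath.exists_time (H : FarPath n P Q f g) {x : ℝ} (h0 : 0 ≤ x) (h1 : x ≤ n - 1) :
    ∃ t ∈ Icc (0 : ℝ) 1, f t = x := by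
  have : x ∈ f '' Icc 0 1 := by rw [H.fst.2.2]; exact ⟨h0, h1⟩
  exact this

lemma FarPath.not_above_of_below (H : FarPath n P Q f g) {x y : ℝ} (h0 : 0 ≤ x) (h1 : x ≤ n - 1)
    (hb : Below f g x y) (ha : Above f g x y) : False := by
  obtain ⟨t, ht, hx⟩ := H.exists_time h0 h1
  exact lt_asymm (hb t ht hx) (ha t ht hx)

/-- Nearness at both ends of a part of an edge excludes all positions in between, since discs are
convex. -/
lemma FarPath.ne_of_near (H : FarPath n P Q f g) {i : ℕ} {x x' y a b a' b' c d : ℝ}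
    (hx : (i : ℝ) ≤ x) (hx' : x' ≤ i + 1)
    (hP : At P x a b) (hP' : At P x' a' b') (hQ : At Q y c d)
    (h : (a - c) ^ 2 + (b - d) ^ 2 ≤ 9) (h' : (a' - c) ^ 2 + (b' - d) ^ 2 ≤ 9)
    {t : ℝ} (ht : t ∈ Icc (0 : ℝ) 1) (hf : x ≤ f t) (hf' : f t ≤ x') : g t ≠ y := by
  intro hg
  have h3 : √(9 : ℝ) = 3 := by
    rw [show (9 : ℝ) = 3 ^ 2 by norm_num]; exact Real.sqrt_sq (by norm_num)
  have e1 := (dist_at hP hQ).trans_le (Real.sqrt_le_sqrt h)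
  have e2 := (dist_at hP' hQ).trans_le (Real.sqrt_le_sqrt h')
  have := norm_polyline_edge_le hx hf hf' hx' e1 e2
  rw [h3, ← hg] at this
  exact absurd (H.far t ht) (not_lt.2 this)

lemma FarPath.ne_of_near' (H : FarPath n P Q f g) {j : ℕ} {x y y' a b c d c' d' : ℝ}
    (hy : (j : ℝ) ≤ y) (hy' : y' ≤ j + 1)
    (hP : At P x a b) (hQ : At Q y c d) (hQ' : At Q y' c' d')
    (h : (a - c) ^ 2 + (b - d) ^ 2 ≤ 9) (h' : (a - c') ^ 2 + (b - d') ^ 2 ≤ 9)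
    {t : ℝ} (ht : t ∈ Icc (0 : ℝ) 1) (hg : y ≤ g t) (hg' : g t ≤ y') : f t ≠ x := by
  intro hf
  have h3 : √(9 : ℝ) = 3 := by
    rw [show (9 : ℝ) = 3 ^ 2 by norm_num]; exact Real.sqrt_sq (by norm_num)
  have e1 := (dist_at hP hQ).trans_le (Real.sqrt_le_sqrt h)
  have e2 := (dist_at hP hQ').trans_le (Real.sqrt_le_sqrt h')
  rw [norm_sub_rev] at e1 e2
  have := norm_polyline_edge_le hy hg hg' hy' e1 e2
  rw [h3, norm_sub_rev, ← hf] at this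
  exact absurd (H.far t ht) (not_lt.2 this)

/-- A barrier over an interval of positions of the first agent cannot be crossed upwards. -/
lemma FarPath.below_fst (H : FarPath n P Q f g) (i : ℕ) {x x' y a b a' b' c d : ℝ}
    (hb : Below f g x y) (hP : At P x a b) (hP' : At P x' a' b') (hQ : At Q y c d)
    (hx : (i : ℝ) ≤ x) (hxx : x ≤ x') (hx' : x' ≤ i + 1)
    (h : (a - c) ^ 2 + (b - d) ^ 2 ≤ 9) (h' : (a' - c) ^ 2 + (b' - d) ^ 2 ≤ 9) :
    Below f g x' y := by
  intro t' ht' hft'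
  have hr : f t' ∈ Icc (0 : ℝ) (n - 1) := by rw [← H.fst.2.2]; exact mem_image_of_mem f ht'
  obtain ⟨t, ht, hft⟩ := H.exists_time (x := x) ((Nat.cast_nonneg i).trans hx)
    (by linarith [hr.2])
  have hg := hb t ht hft
  rcases hxx.eq_or_lt with rfl | hlt
  · exact hb t' ht' hft'
  have htt : t ≤ t' := by
    by_contra hc
    have := H.fst.2.1 ht' ht (not_le.1 hc).le
    linarith
  have hsub : Icc t t' ⊆ Icc (0 : ℝ) 1 := Icc_subset_Icc ht.1 ht'.2
  by_contra hge
  obtain ⟨u, hu, hgu⟩ := intermediate_value_Icc htt (H.snd.1.mono hsub) ⟨hg.le, not_lt.1 hge⟩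
  exact H.ne_of_near hx hx' hP hP' hQ h h' (hsub hu)
    (hft ▸ H.fst.2.1 ht (hsub hu) hu.1) (hft' ▸ H.fst.2.1 (hsub hu) ht' hu.2) hgu

lemma FarPath.above_fst (H : FarPath n P Q f g) {x x' y : ℝ} (ha : Above f g x y) (hx : 0 ≤ x)
    (hxx : x ≤ x') : Above f g x' y := by
  intro t' ht' hft'
  have hr : f t' ∈ Icc (0 : ℝ) (n - 1) := by rw [← H.fst.2.2]; exact mem_image_of_mem f ht'
  obtain ⟨t, ht, hft⟩ := H.exists_time hx (by linarith [hr.2])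
  rcases hxx.eq_or_lt with rfl | hlt
  · exact ha t' ht' hft'
  have htt : t ≤ t' := by
    by_contra hc
    have := H.fst.2.1 ht' ht (not_le.1 hc).le
    linarith
  exact (ha t ht hft).trans_le (H.snd.2.1 ht ht' htt)

/-- A barrier over an interval of positions of the second agent: above its lower end is above its
upper end. -/
lemma FarPath.above_snd (H : FarPath n P Q f g) (j : ℕ) {x y y' a b c d c' d' : ℝ}
    (ha : Above f g x y) (hP : At P x a b) (hQ : At Q y c d) (hQ' : At Q y' c' d')
    (hy : (j : ℝ) ≤ y) (hy' : y' ≤ j + 1)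
    (h : (a - c) ^ 2 + (b - d) ^ 2 ≤ 9) (h' : (a - c') ^ 2 + (b - d') ^ 2 ≤ 9) :
    Above f g x y' := by
  intro t ht hft
  by_contra hc
  exact H.ne_of_near' hy hy' hP hQ hQ' h h' ht (ha t ht hft).le (not_lt.1 hc) hft

lemma FarPath.below_snd (H : FarPath n P Q f g) (j : ℕ) {x y y' a b c d c' d' : ℝ}
    (hb : Below f g x y') (hP : At P x a b) (hQ : At Q y c d) (hQ' : At Q y' c' d')
    (hy : (j : ℝ) ≤ y) (hy' : y' ≤ j + 1)
    (h : (a - c) ^ 2 + (b - d) ^ 2 ≤ 9) (h' : (a - c') ^ 2 + (b - d') ^ 2 ≤ 9) :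
    Below f g x y := by
  intro t ht hft
  by_contra hc
  exact H.ne_of_near' hy hy' hP hQ hQ' h h' ht (not_lt.1 hc) (hb t ht hft).le hft

lemma FarPath.below_or_above (H : FarPath n P Q f g) {x y a b c d : ℝ} (hP : At P x a b)
    (hQ : At Q y c d) (h : (a - c) ^ 2 + (b - d) ^ 2 ≤ 9) : Below f g x y ∨ Above f g x y := by
  have h3 : √(9 : ℝ) = 3 := by
    rw [show (9 : ℝ) = 3 ^ 2 by norm_num]; exact Real.sqrt_sq (by norm_num)
  have e1 := (dist_at hP hQ).trans_le (Real.sqrt_le_sqrt h)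
  have hne : ∀ t ∈ Icc (0 : ℝ) 1, f t = x → g t ≠ y := by
    rintro t ht rfl rfl
    exact absurd (H.far t ht) (not_lt.2 (h3 ▸ e1))
  by_contra hcon
  rw [not_or] at hcon
  simp only [Below, Above, not_forall, not_lt] at hcon
  obtain ⟨⟨t, ht, hft, hgt⟩, ⟨u, hu, hfu, hgu⟩⟩ := hcon
  have key : ∀ r ∈ uIcc t u, r ∈ Icc (0 : ℝ) 1 ∧ f r = x := by
    intro r hr
    rcases le_total t u with h | h
    · rw [uIcc_of_le h] at hr
      have hr1 : r ∈ Icc (0 : ℝ) 1 := ⟨ht.1.trans hr.1, hr.2.trans hu.2⟩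
      exact ⟨hr1, le_antisymm (hfu ▸ H.fst.2.1 hr1 hu hr.2) (hft ▸ H.fst.2.1 ht hr1 hr.1)⟩
    · rw [uIcc_of_ge h] at hr
      have hr1 : r ∈ Icc (0 : ℝ) 1 := ⟨hu.1.trans hr.1, hr.2.trans ht.2⟩
      exact ⟨hr1, le_antisymm (hft ▸ H.fst.2.1 hr1 ht hr.2) (hfu ▸ H.fst.2.1 hu hr1 hr.1)⟩
  obtain ⟨r, hr, hgr⟩ := intermediate_value_uIcc (H.snd.1.mono fun r hr => (key r hr).1)
    (show y ∈ uIcc (g t) (g u) from mem_uIcc.2 (Or.inr ⟨hgu, hgt⟩))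
  exact hne r (key r hr).1 (key r hr).2 hgr

end Barrier

/-! ### Vector gadgets -/

/-- The vertices of the two curves. The first one consists of `N` blocks; each starts at `(7, 14)`,
walks counterclockwise `L` times around the centre `(7, 7)` and ends at `(7, 0)`. In the `k`-th round
of the block `i` the east vertex is drawn in to the centre if the bit `x i k` is set. The second
curve comes from the far west, goes `M` times around the centre, always opposite to the first one, and
returns to the far west. In the `m`-th round the west vertex is drawn in to the centre if
the bit `y m` is set. -/
structure Gadgets (N L M n : ℕ) (x : ℕ → ℕ → Bool) (y : ℕ → Bool) (P Q : ℕ → ℕ × ℕ) : Prop where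
  start : ∀ i < N, P ((4 * L + 2) * i) = (7, 14)
  pe : ∀ i < N, ∀ k < L, P ((4 * L + 2) * i + 1 + 4 * k) = (if x i k then 7 else 11, 7)
  pn : ∀ i < N, ∀ k < L, P ((4 * L + 2) * i + 1 + 4 * k + 1) = (7, 10)
  pw : ∀ i < N, ∀ k < L, P ((4 * L + 2) * i + 1 + 4 * k + 2) = (4, 7)
  ps : ∀ i < N, ∀ k < L, P ((4 * L + 2) * i + 1 + 4 * k + 3) = (7, 4)
  finish : ∀ i < N, P ((4 * L + 2) * i + 1 + 4 * L) = (7, 0)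
  pad : ∀ j, (4 * L + 2) * N ≤ j → P j = (7, 0)
  q0 : Q 0 = (0, 7)
  q1 : Q 1 = (7, 2)
  q2 : Q 2 = (7, 7)
  q3 : Q 3 = (9, 7)
  qe : ∀ m ≤ M, Q (4 * m + 4) = (10, 7)
  qn : ∀ m ≤ M, Q (4 * m + 4 + 1) = (7, 10)
  qw : ∀ m < M, Q (4 * m + 4 + 2) = (if y m then 7 else 3, 7)
  qs : ∀ m < M, Q (4 * m + 4 + 3) = (7, 4)
  r0 : Q (4 * M + 6) = (7, 12)
  r1 : Q (4 * M + 6 + 1) = (7, 7)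
  r2 : Q (4 * M + 6 + 2) = (9, 7)
  r3 : ∀ j, 4 * M + 9 ≤ j → Q j = (0, 7)
  first : ∀ i < N, x i 0 = true
  N_pos : 0 < N
  L_pos : 0 < L
  hn : (4 * L + 2) * N ≤ n
  hn' : 4 * M + 10 ≤ n
  px : ∀ j, 4 ≤ (P j).1
  qy_le : ∀ j ≤ 4 * M + 5, (Q j).2 ≤ 10
  qy_ge : ∀ j, 4 ≤ j → 4 ≤ (Q j).2

section Lock

variable {n : ℕ} {P Q : ℕ → ℕ × ℕ} {f g : ℝ → ℝ}

/-- One round of the lower barrier of the corridor around the diagonal: the second agent cannot fall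
behind by a full round. -/
lemma FarPath.lock_above (H : FarPath n P Q f g) {i j : ℕ} {b c : Bool}
    (p1 : P (i + 1) = (7, 10)) (p2 : P (i + 2) = (4, 7)) (p3 : P (i + 3) = (7, 4))
    (p4 : P (i + 4) = (if b then 7 else 11, 7))
    (q0 : Q j = (10, 7)) (q1 : Q (j + 1) = (7, 10)) (q2 : Q (j + 2) = (if c then 7 else 3, 7))
    (q3 : Q (j + 3) = (7, 4)) (q4 : Q (j + 4) = (10, 7)) (q5 : Q (j + 5) = (7, 10))
    (h : Above f g i (j + 1 / 2)) : Above f g (i + 4) (j + 4 + 1 / 2) := by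
  have hi : (0 : ℝ) ≤ i := Nat.cast_nonneg i
  have A1 := at_vertex p1 (x := i + 1) (by push_cast; ring)
  have A2 := at_vertex p2 (x := i + 2) (by push_cast; ring)
  have A3 := at_vertex p3 (x := i + 3) (by push_cast; ring)
  have A4 := at_vertex p4 (x := i + 4) (by push_cast; ring)
  have B0 := at_edge q0 q1 (l := 1 / 2) (x := j + 1 / 2) (by norm_num) (by norm_num) rfl
  have B1 := at_vertex q1 (x := j + 1) (by push_cast; ring)
  have B2 := at_edge q1 q2 (l := 1 / 2) (x := j + 1 + 1 / 2) (by norm_num) (by norm_num)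
    (by push_cast; ring)
  have B3 := at_vertex q2 (x := j + 2) (by push_cast; ring)
  have B4 := at_edge q2 q3 (l := 1 / 2) (x := j + 2 + 1 / 2) (by norm_num) (by norm_num)
    (by push_cast; ring)
  have B5 := at_vertex q3 (x := j + 3) (by push_cast; ring)
  have B6 := at_edge q3 q4 (l := 1 / 2) (x := j + 3 + 1 / 2) (by norm_num) (by norm_num)
    (by push_cast; ring)
  have B7 := at_vertex q4 (x := j + 4) (by push_cast; ring)
  have B8 := at_edge q4 q5 (l := 1 / 2) (x := j + 4 + 1 / 2) (by norm_num) (by norm_num)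
    (by push_cast; ring)
  have h1 := H.above_fst (x' := i + 1) h hi (by linarith)
  have h2 := H.above_snd j h1 A1 B0 B1 (by norm_num) (by norm_num) (by norm_num) (by norm_num)
  have h6 : Above f g (i + 3) (j + 3) := by
    cases c
    · have h3 := H.above_snd (j + 1) h2 A1 B1 B2 (by push_cast; linarith) (by push_cast; linarith)
        (by norm_num) (by norm_num)
      have h4 := H.above_fst (x' := i + 2) h3 (by linarith) (by linarith)
      have h5 := H.above_snd (j + 1) h4 A2 B2 B3 (by push_cast; linarith) (by push_cast; linarith)
        (by norm_num) (by norm_num)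
      have h6 := H.above_snd (j + 2) h5 A2 B3 B4 (by push_cast; linarith) (by push_cast; linarith)
        (by norm_num) (by norm_num)
      have h7 := H.above_fst (x' := i + 3) h6 (by linarith) (by linarith)
      exact H.above_snd (j + 2) h7 A3 B4 B5 (by push_cast; linarith) (by push_cast; linarith)
        (by norm_num) (by norm_num)
    · have h3 := H.above_snd (j + 1) h2 A1 B1 B3 (by push_cast; linarith) (by push_cast; linarith)
        (by norm_num) (by norm_num)
      have h7 := H.above_fst (x' := i + 3) h3 (by linarith) (by linarith)
      exact H.above_snd (j + 2) h7 A3 B3 B5 (by push_cast; linarith) (by push_cast; linarith)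
        (by norm_num) (by norm_num)
  have h7 := H.above_snd (j + 3) h6 A3 B5 B6 (by push_cast; linarith) (by push_cast; linarith)
    (by norm_num) (by norm_num)
  have h8 := H.above_fst (x' := i + 4) h7 (by linarith) (by linarith)
  cases b
  · have h9 := H.above_snd (j + 3) h8 A4 B6 B7 (by push_cast; linarith) (by push_cast; linarith)
      (by norm_num) (by norm_num)
    exact H.above_snd (j + 4) h9 A4 B7 B8 (by push_cast; linarith) (by push_cast; linarith)
      (by norm_num) (by norm_num)
  · have h9 := H.above_snd (j + 3) h8 A4 B6 B7 (by push_cast; linarith) (by push_cast; linarith)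
      (by norm_num) (by norm_num)
    exact H.above_snd (j + 4) h9 A4 B7 B8 (by push_cast; linarith) (by push_cast; linarith)
      (by norm_num) (by norm_num)

/-- One round of the upper barrier of the corridor: the second agent cannot get ahead by a full
round. -/
lemma FarPath.lock_below (H : FarPath n P Q f g) {i j : ℕ} {b b' c : Bool}
    (p0 : P i = (if b then 7 else 11, 7))
    (p1 : P (i + 1) = (7, 10)) (p2 : P (i + 2) = (4, 7)) (p3 : P (i + 3) = (7, 4))
    (p4 : P (i + 4) = (if b' then 7 else 11, 7))
    (q0 : Q j = (10, 7)) (q1 : Q (j + 1) = (7, 10)) (q2 : Q (j + 2) = (if c then 7 else 3, 7))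
    (q3 : Q (j + 3) = (7, 4)) (q4 : Q (j + 4) = (10, 7))
    (h : Below f g i (j - 1 / 2)) : Below f g (i + 4) (j + 3 + 1 / 2) := by
  have hi : (0 : ℝ) ≤ i := Nat.cast_nonneg i
  have A0 := at_vertex p0 (x := i) rfl
  have A1 := at_vertex p1 (x := i + 1) (by push_cast; ring)
  have A2 := at_vertex p2 (x := i + 2) (by push_cast; ring)
  have A3 := at_vertex p3 (x := i + 3) (by push_cast; ring)
  have A4 := at_vertex p4 (x := i + 4) (by push_cast; ring)
  have B0 := at_edge q0 q1 (l := 1 / 2) (x := j + 1 / 2) (by norm_num) (by norm_num) rfl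
  have B2 := at_edge q1 q2 (l := 1 / 2) (x := j + 1 + 1 / 2) (by norm_num) (by norm_num)
    (by push_cast; ring)
  have B3 := at_vertex q2 (x := j + 2) (by push_cast; ring)
  have B4 := at_edge q2 q3 (l := 1 / 2) (x := j + 2 + 1 / 2) (by norm_num) (by norm_num)
    (by push_cast; ring)
  have B6 := at_edge q3 q4 (l := 1 / 2) (x := j + 3 + 1 / 2) (by norm_num) (by norm_num)
    (by push_cast; ring)
  have h1 : Below f g (i + 1) (j + 1 / 2) := by
    have h0 : Below f g i (j + 1 / 2) := h.weaken (by linarith)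
    cases b <;>
    exact H.below_fst i h0 A0 A1 B0 (by linarith) (by linarith) (by linarith)
      (by norm_num) (by norm_num)
  have h3 : Below f g (i + 3) (j + 2 + 1 / 2) := by
    cases c
    · have h2 := H.below_fst (i + 1) (h1.weaken (y' := j + 1 + 1 / 2) (by linarith)) A1 A2 B2
        (by push_cast; linarith) (by linarith) (by push_cast; linarith) (by norm_num) (by norm_num)
      exact H.below_fst (i + 2) (h2.weaken (y' := j + 2 + 1 / 2) (by linarith)) A2 A3 B4
        (by push_cast; linarith) (by linarith) (by push_cast; linarith) (by norm_num) (by norm_num)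
    · have h2 := H.below_fst (i + 1) (h1.weaken (y' := j + 2) (by linarith)) A1 A2 B3
        (by push_cast; linarith) (by linarith) (by push_cast; linarith) (by norm_num) (by norm_num)
      exact (H.below_fst (i + 2) h2 A2 A3 B3 (by push_cast; linarith) (by linarith)
        (by push_cast; linarith) (by norm_num) (by norm_num)).weaken (by linarith)
  have h4 := h3.weaken (y' := j + 3 + 1 / 2) (by linarith)
  cases b' <;>
  exact H.below_fst (i + 3) h4 A3 A4 B6 (by push_cast; linarith) (by linarith)
    (by push_cast; linarith) (by norm_num) (by norm_num)

/-- If both bits are set, then the second agent has no place for the time at which the first one is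
at the centre. -/
lemma FarPath.bits_disjoint (H : FarPath n P Q f g) {i j : ℕ} {b c : Bool} (hin : (i : ℝ) ≤ n - 1)
    (p0 : P i = (if b then 7 else 11, 7))
    (q0 : Q j = (10, 7)) (q1 : Q (j + 1) = (7, 10)) (q2 : Q (j + 2) = (if c then 7 else 3, 7))
    (q3 : Q (j + 3) = (7, 4)) (q4 : Q (j + 4) = (10, 7))
    (h : Above f g i (j + 1 / 2)) (h' : Below f g i (j + 3 + 1 / 2)) : ¬ (b = true ∧ c = true) := by
  rintro ⟨rfl, rfl⟩
  have A0 := at_vertex p0 (x := i) rfl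
  have B0 := at_edge q0 q1 (l := 1 / 2) (x := j + 1 / 2) (by norm_num) (by norm_num) rfl
  have B1 := at_vertex q1 (x := j + 1) (by push_cast; ring)
  have B3 := at_vertex q2 (x := j + 2) (by push_cast; ring)
  have B5 := at_vertex q3 (x := j + 3) (by push_cast; ring)
  have B6 := at_edge q3 q4 (l := 1 / 2) (x := j + 3 + 1 / 2) (by norm_num) (by norm_num)
    (by push_cast; ring)
  have h1 := H.above_snd j h A0 B0 B1 (by linarith) (by linarith) (by norm_num) (by norm_num)
  have h2 := H.above_snd (j + 1) h1 A0 B1 B3 (by push_cast; linarith) (by push_cast; linarith)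
    (by norm_num) (by norm_num)
  have h3 := H.above_snd (j + 2) h2 A0 B3 B5 (by push_cast; linarith) (by push_cast; linarith)
    (by norm_num) (by norm_num)
  have h4 := H.above_snd (j + 3) h3 A0 B5 B6 (by push_cast; linarith) (by push_cast; linarith)
    (by norm_num) (by norm_num)
  exact H.not_above_of_below (Nat.cast_nonneg i) hin h' h4

/-- One round of the first agent under a barrier formed by the centre and the point `(9, 7)` on the
second curve. -/
lemma FarPath.block_round (H : FarPath n P Q f g) {i q : ℕ} {b : Bool}
    (p0 : P i = (if b then 7 else 11, 7))
    (p1 : P (i + 1) = (7, 10)) (p2 : P (i + 2) = (4, 7)) (p3 : P (i + 3) = (7, 4))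
    (q0 : Q q = (7, 7)) (q1 : Q (q + 1) = (9, 7)) (h : Below f g i (q + 1)) :
    Below f g (i + 1) q ∧ Below f g (i + 3) q := by
  have A0 := at_vertex p0 (x := i) rfl
  have A := at_edge p0 p1 (l := 1 / 2) (x := i + 1 / 2) (by norm_num) (by norm_num) rfl
  have A1 := at_vertex p1 (x := i + 1) (by push_cast; ring)
  have A2 := at_vertex p2 (x := i + 2) (by push_cast; ring)
  have A3 := at_vertex p3 (x := i + 3) (by push_cast; ring)
  have B0 := at_vertex q0 (x := q) rfl
  have B1 := at_vertex q1 (x := q + 1) (by push_cast; ring)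
  have h1 : Below f g (i + 1) q := by
    cases b
    · have h1 := H.below_fst i h A0 A B1 (by linarith) (by linarith) (by linarith) (by norm_num)
        (by norm_num)
      have h2 := H.below_snd q h1 A B0 B1 (by linarith) (by linarith) (by norm_num) (by norm_num)
      exact H.below_fst i h2 A A1 B0 (by linarith) (by linarith) (by linarith) (by norm_num)
        (by norm_num)
    · have h2 := H.below_snd q h A0 B0 B1 (by linarith) (by linarith) (by norm_num) (by norm_num)
      exact H.below_fst i h2 A0 A1 B0 (by linarith) (by linarith) (by linarith) (by norm_num)
        (by norm_num)
  have h2 := H.below_fst (i + 1) h1 A1 A2 B0 (by push_cast; linarith) (by linarith)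
    (by push_cast; linarith) (by norm_num) (by norm_num)
  exact ⟨h1, H.below_fst (i + 2) h2 A2 A3 B0 (by push_cast; linarith) (by linarith)
    (by push_cast; linarith) (by norm_num) (by norm_num)⟩

lemma FarPath.block_next (H : FarPath n P Q f g) {i q : ℕ} {b : Bool}
    (p0 : P i = (7, 4)) (p1 : P (i + 1) = (if b then 7 else 11, 7))
    (q0 : Q q = (7, 7)) (q1 : Q (q + 1) = (9, 7)) (h : Below f g i q) :
    Below f g (i + 1) (q + 1) := by
  have A0 := at_vertex p0 (x := i) rfl
  have A := at_edge p0 p1 (l := 1 / 2) (x := i + 1 / 2) (by norm_num) (by norm_num) rfl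
  have A1 := at_vertex p1 (x := i + 1) (by push_cast; ring)
  have B0 := at_vertex q0 (x := q) rfl
  have B1 := at_vertex q1 (x := q + 1) (by push_cast; ring)
  cases b
  · have h1 := H.below_fst i h A0 A B0 (by linarith) (by linarith) (by linarith) (by norm_num)
      (by norm_num)
    exact H.below_fst i (h1.weaken (y' := q + 1) (by linarith)) A A1 B1 (by linarith) (by linarith)
      (by linarith) (by norm_num) (by norm_num)
  · exact (H.below_fst i h A0 A1 B0 (by linarith) (by linarith) (by linarith) (by norm_num)
      (by norm_num)).weaken (by linarith)

end Lock

section Window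

variable {N L M n : ℕ} {x : ℕ → ℕ → Bool} {y : ℕ → Bool} {P Q : ℕ → ℕ × ℕ} {f g : ℝ → ℝ}

lemma Gadgets.pe_succ (G : Gadgets N L M n x y P Q) {i k : ℕ} (hi : i < N) (hk : k + 1 < L) :
    P ((4 * L + 2) * i + 1 + 4 * k + 4) = (if x i (k + 1) then 7 else 11, 7) := by
  rw [← G.pe i hi (k + 1) hk]; congr 1

lemma Gadgets.qe_succ (G : Gadgets N L M n x y P Q) {m : ℕ} (hm : m < M) :
    Q (4 * m + 4 + 4) = (10, 7) := by
  rw [← G.qe (m + 1) hm]; congr 1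

lemma Gadgets.qn_succ (G : Gadgets N L M n x y P Q) {m : ℕ} (hm : m < M) :
    Q (4 * m + 4 + 5) = (7, 10) := by
  rw [← G.qn (m + 1) hm]; congr 1

lemma Gadgets.le_n (G : Gadgets N L M n x y P Q) {i : ℕ} (hi : i < N) :
    (4 * L + 2) * i + (4 * L + 2) ≤ n := by
  have : (4 * L + 2) * (i + 1) ≤ (4 * L + 2) * N := Nat.mul_le_mul_left _ hi
  have := G.hn
  rw [mul_add, mul_one] at *
  omega

lemma Gadgets.cast_le (G : Gadgets N L M n x y P Q) {i j : ℕ} (hi : i < N)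
    (hj : j < (4 * L + 2) * i + (4 * L + 2)) : (j : ℝ) ≤ n - 1 := by
  have : j + 1 ≤ n := by have := G.le_n hi; omega
  have : ((j + 1 : ℕ) : ℝ) ≤ n := by exact_mod_cast this
  push_cast at this
  linarith

/-- Walking through a block under a barrier formed by the centre and the point `(9, 7)` on the second
curve. -/
lemma Gadgets.block_below (G : Gadgets N L M n x y P Q) (H : FarPath n P Q f g) {i q : ℕ}
    (hi : i < N) (q0 : Q q = (7, 7)) (q1 : Q (q + 1) = (9, 7))
    (h : Below f g ((4 * L + 2) * i + 1 : ℕ) (q + 1)) :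
    ∀ k < L, Below f g ((4 * L + 2) * i + 1 + 4 * k : ℕ) (q + 1) ∧
      Below f g ((4 * L + 2) * i + 1 + 4 * k + 1 : ℕ) q ∧
      Below f g ((4 * L + 2) * i + 1 + 4 * k + 3 : ℕ) q := by
  intro k
  induction k with
  | zero =>
    intro hk
    have h' := H.block_round (i := (4 * L + 2) * i + 1 + 4 * 0) (G.pe i hi 0 hk) (G.pn i hi 0 hk)
      (G.pw i hi 0 hk) (G.ps i hi 0 hk) q0 q1 h
    exact ⟨h, by exact_mod_cast h'.1, by exact_mod_cast h'.2⟩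
  | succ k ih =>
    intro hk
    have h0 := (ih (by omega)).2.2
    have h1 : Below f g ((4 * L + 2) * i + 1 + 4 * (k + 1) : ℕ) (q + 1) := by
      have := H.block_next (G.ps i hi k (by omega)) (G.pe_succ hi hk) q0 q1 h0
      exact_mod_cast this
    have h' := H.block_round (G.pe i hi _ hk) (G.pn i hi _ hk)
      (G.pw i hi _ hk) (G.ps i hi _ hk) q0 q1 h1
    exact ⟨h1, by exact_mod_cast h'.1, by exact_mod_cast h'.2⟩

/-- Some block is entered when the second agent has passed its initial point at the centre, but not
yet its final one. -/
lemma Gadgets.exists_block (G : Gadgets N L M n x y P Q) (H : FarPath n P Q f g) :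
    ∃ i < N, Above f g ((4 * L + 2) * i + 1 : ℕ) (2 : ℕ) ∧
      Below f g ((4 * L + 2) * i + 1 : ℕ) ((4 * M + 6 + 1 : ℕ) + 1) := by
  have hL := G.L_pos
  by_contra hcon
  push Not at hcon
  have B1 := at_vertex G.q1 (x := (1 : ℕ)) rfl
  have B2 := at_vertex G.q2 (x := (2 : ℕ)) rfl
  have C0 := at_vertex G.r0 (x := (4 * M + 6 : ℕ)) rfl
  have C1 := at_vertex G.r1 (x := (4 * M + 6 : ℕ) + 1) (by push_cast; ring)
  -- entering a block below the final point `(7, 12)` implies leaving it below the initial one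
  have step : ∀ i < N, Below f g ((4 * L + 2) * i : ℕ) (4 * M + 6 : ℕ) →
      Below f g ((4 * L + 2) * i + 1 + 4 * L : ℕ) (1 : ℕ) := by
    intro i hi h
    have e0 := G.pe i hi 0 hL
    rw [G.first i hi] at e0
    have A0 := at_vertex (G.start i hi) rfl
    have A := at_edge (G.start i hi) e0 (l := 2 / 3) (x := ((4 * L + 2) * i : ℕ) + 2 / 3)
      (by norm_num) (by norm_num) rfl
    have A1 := at_vertex e0 (x := ((4 * L + 2) * i : ℕ) + 1) (by push_cast; ring)
    have h1 := H.below_fst ((4 * L + 2) * i) h A0 A C0 (by linarith) (by linarith) (by linarith)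
      (by norm_num) (by norm_num)
    have h2 := H.below_fst ((4 * L + 2) * i) (h1.weaken (y' := (4 * M + 6 : ℕ) + 1) (by linarith))
      A A1 C1 (by linarith) (by linarith) (by linarith) (by norm_num) (by norm_num)
    have h2' : Below f g ((4 * L + 2) * i + 1 : ℕ) ((4 * M + 6 + 1 : ℕ) + 1) := by
      have := h2.weaken (y' := (4 * M + 6 + 1 : ℕ) + 1) (by push_cast; linarith)
      exact_mod_cast this
    have A1' := at_vertex e0 (x := ((4 * L + 2) * i + 1 : ℕ)) (by push_cast; ring)
    rcases H.below_or_above A1' B2 (by norm_num) with h3 | h3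
    swap
    · exact absurd h2' (hcon i hi h3)
    have h4 := (G.block_below H hi G.q2 G.q3
      (h3.weaken (by push_cast; linarith)) (L - 1) (by omega)).2.2
    have hidx : (4 * L + 2) * i + 1 + 4 * (L - 1) + 3 + 1 = (4 * L + 2) * i + 1 + 4 * L := by omega
    have pS := G.ps i hi (L - 1) (by omega)
    have pT := G.finish i hi
    rw [← hidx] at pT ⊢
    have A3 := at_vertex pS rfl
    have A4 := at_vertex pT rfl
    have h5 := H.below_snd 1 h4 A3 B1 B2 (by norm_num) (by norm_num) (by norm_num) (by norm_num)
    exact H.below_fst _ h5 A3 A4 B1 le_rfl (by push_cast; linarith) (by push_cast; linarith)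
      (by norm_num) (by norm_num)
  have all : ∀ i < N, Below f g ((4 * L + 2) * i : ℕ) (4 * M + 6 : ℕ) := by
    intro i
    induction i with
    | zero =>
      intro hi
      have A0 := at_vertex (G.start 0 hi) rfl
      rcases H.below_or_above A0 C0 (by norm_num) with h | h
      · exact h
      · have h1 := h 0 (by simp) (by simpa using H.fst.apply_zero H.pos)
        rw [H.snd.apply_zero H.pos] at h1
        have : (0 : ℝ) ≤ (4 * M + 6 : ℕ) := Nat.cast_nonneg _
        linarith
    | succ i ih =>
      intro hi
      have h := step i (by omega) (ih (by omega))
      have p0 := G.finish i (by omega)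
      have p1 := G.start (i + 1) hi
      have hidx : (4 * L + 2) * (i + 1) = (4 * L + 2) * i + 1 + 4 * L + 1 := by ring
      rw [hidx] at p1 ⊢
      generalize (4 * L + 2) * i + 1 + 4 * L = j at *
      have A0 := at_vertex p0 rfl
      have A1 := at_edge p0 p1 (l := 1 / 3) (x := j + 1 / 3) (by norm_num) (by norm_num) rfl
      have A2 := at_edge p0 p1 (l := 2 / 3) (x := j + 2 / 3) (by norm_num) (by norm_num) rfl
      have A3 := at_vertex p1 rfl
      have h1 := H.below_fst j h A0 A1 B1 (by linarith) (by linarith) (by linarith)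
        (by norm_num) (by norm_num)
      have h2 := H.below_fst j (h1.weaken (y' := (4 * M + 6 : ℕ) + 1) (by push_cast; linarith))
        A1 A2 C1 (by linarith) (by linarith) (by linarith) (by norm_num) (by norm_num)
      have h3 := H.below_snd (4 * M + 6) h2 A2 C0 C1 (by linarith) (by linarith)
        (by norm_num) (by norm_num)
      exact H.below_fst j h3 A2 A3 C0 (by linarith) (by push_cast; linarith) (by push_cast; linarith)
        (by norm_num) (by norm_num)
  -- after the last block the first agent stays where it is
  have hN := G.N_pos
  have hend : ∀ j, Below f g ((4 * L + 2) * (N - 1) + 1 + 4 * L + j : ℕ) (1 : ℕ) := by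
    have hidx : (4 * L + 2) * (N - 1) + 1 + 4 * L + 1 = (4 * L + 2) * N := by
      obtain ⟨N', rfl⟩ : ∃ N', N = N' + 1 := ⟨N - 1, by omega⟩
      simp only [Nat.add_sub_cancel]; ring
    have p0 := G.finish (N - 1) (by omega)
    have pd := G.pad
    rw [← hidx] at pd
    have h0 := step (N - 1) (by omega) (all (N - 1) (by omega))
    generalize (4 * L + 2) * (N - 1) + 1 + 4 * L = j0 at *
    intro j
    induction j with
    | zero => simpa using h0
    | succ j ih =>
      have p : P (j0 + j) = (7, 0) := by
        cases j with
        | zero => simpa using p0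
        | succ j => exact pd _ (by omega)
      have A := at_vertex p rfl
      have A' := at_vertex (pd (j0 + (j + 1)) (by omega)) rfl
      exact H.below_fst (j0 + j) ih A A' B1 le_rfl (by push_cast; linarith) (by push_cast; linarith)
        (by norm_num) (by norm_num)
  have hle := G.le_n (i := N - 1) (by omega)
  have h1 := hend (n - 1 - ((4 * L + 2) * (N - 1) + 1 + 4 * L)) 1 (by simp) (by
    rw [H.fst.apply_one H.pos,
      show (4 * L + 2) * (N - 1) + 1 + 4 * L + (n - 1 - ((4 * L + 2) * (N - 1) + 1 + 4 * L)) = n - 1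
        by omega, Nat.cast_sub (by omega)]
    simp)
  rw [H.snd.apply_one H.pos] at h1
  have : (6 : ℝ) ≤ n := by exact_mod_cast (by omega : 6 ≤ n)
  norm_num at h1
  linarith

/-- A pair of traversals that keeps a distance of more than 3 walks through some block while
the second agent walks through a window of rounds with disjoint bits, in lockstep. -/
theorem Gadgets.exists_window (G : Gadgets N L M n x y P Q) (H : FarPath n P Q f g) :
    ∃ i < N, ∃ m₀, ∀ k < L, m₀ + k < M ∧ ¬ (x i k = true ∧ y (m₀ + k) = true) ∧
      Above f g ((4 * L + 2) * i + 1 + 4 * k : ℕ) ((4 * (m₀ + k) + 4 : ℕ) + 1 / 2) ∧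
      Below f g ((4 * L + 2) * i + 1 + 4 * k : ℕ) ((4 * (m₀ + k) + 4 : ℕ) + 3 + 1 / 2) := by
  obtain ⟨i, hi, ha, hb⟩ := G.exists_block H
  have hL := G.L_pos
  have hbelow := G.block_below H hi G.r1 G.r2 hb
  have e0 := G.pe i hi 0 hL
  rw [G.first i hi] at e0
  have A0 := at_vertex e0 (x := ((4 * L + 2) * i + 1 : ℕ)) (by push_cast; ring)
  have hinit : Above f g ((4 * L + 2) * i + 1 : ℕ) ((4 * 0 + 4 : ℕ) + 1 / 2) := by
    have q4 := G.qe 0 (Nat.zero_le _)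
    have q5 := G.qn 0 (Nat.zero_le _)
    have B2 := at_vertex G.q2 rfl
    have B3 := at_vertex G.q3 rfl
    have B4 := at_vertex q4 rfl
    have B5 := at_edge q4 q5 (l := 1 / 2) (x := (4 * 0 + 4 : ℕ) + 1 / 2) (by norm_num) (by norm_num)
      rfl
    have h1 := H.above_snd 2 ha A0 B2 B3 (by norm_num) (by norm_num) (by norm_num) (by norm_num)
    have h2 := H.above_snd 3 h1 A0 B3 B4 (by norm_num) (by norm_num) (by norm_num) (by norm_num)
    exact H.above_snd 4 h2 A0 B4 B5 (by norm_num) (by norm_num) (by norm_num) (by norm_num)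
  classical
  -- `m₀` is the round of the second agent when the first one enters the block
  set p : ℕ → Prop := fun m => Above f g ((4 * L + 2) * i + 1 : ℕ) ((4 * m + 4 : ℕ) + 1 / 2) with hp
  obtain ⟨m₀, hm₀, hab, hmax⟩ : ∃ m₀ ≤ M, p m₀ ∧ (m₀ < M → ¬ p (m₀ + 1)) :=
    ⟨Nat.findGreatest p M, Nat.findGreatest_le M, Nat.findGreatest_spec (Nat.zero_le _) hinit,
      fun h => Nat.findGreatest_is_greatest (Nat.lt_succ_self _) h⟩
  have hbel : m₀ < M →
      Below f g ((4 * L + 2) * i + 1 : ℕ) ((4 * m₀ + 4 : ℕ) + 3 + 1 / 2) := by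
    intro hm
    have q3 := G.qs m₀ hm
    have q4 := G.qe (m₀ + 1) hm
    have q5 := G.qn (m₀ + 1) hm
    have B3 := at_edge q3 q4 (l := 1 / 2) (x := (4 * m₀ + 4 : ℕ) + 3 + 1 / 2) (by norm_num)
      (by norm_num) (by push_cast; ring)
    have B4 := at_vertex q4 rfl
    have B5 := at_edge q4 q5 (l := 1 / 2) (x := (4 * (m₀ + 1) + 4 : ℕ) + 1 / 2) (by norm_num)
      (by norm_num) rfl
    rcases H.below_or_above A0 B5 (by norm_num) with h | h
    swap
    · exact absurd h (hmax hm)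
    have h1 := H.below_snd _ h A0 B4 B5 le_rfl (by linarith) (by norm_num) (by norm_num)
    exact H.below_snd (4 * m₀ + 4 + 3) h1 A0 B3 B4 (by push_cast; linarith) (by push_cast; linarith)
      (by norm_num) (by norm_num)
  have key : ∀ k < L, m₀ + k < M ∧
      Above f g ((4 * L + 2) * i + 1 + 4 * k : ℕ) ((4 * (m₀ + k) + 4 : ℕ) + 1 / 2) ∧
      Below f g ((4 * L + 2) * i + 1 + 4 * k : ℕ) ((4 * (m₀ + k) + 4 : ℕ) + 3 + 1 / 2) := by
    -- after its last round the second agent would be trapped when the first one is in the north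
    have trap : ∀ k < L,
        ¬ Above f g ((4 * L + 2) * i + 1 + 4 * k : ℕ) ((4 * M + 4 : ℕ) + 1 / 2) := by
      intro k hk h
      have hb' := (hbelow k hk).2.1
      have A1 := at_vertex (G.pn i hi k hk) rfl
      have B0 := at_edge (G.qe M le_rfl) (G.qn M le_rfl) (l := 1 / 2)
        (x := (4 * M + 4 : ℕ) + 1 / 2) (by norm_num) (by norm_num) rfl
      have B1 := at_vertex (G.qn M le_rfl) rfl
      have C0 := at_vertex G.r0 rfl
      have C1 := at_vertex G.r1 rfl
      have h1 := H.above_fst (x' := ((4 * L + 2) * i + 1 + 4 * k + 1 : ℕ)) h (Nat.cast_nonneg _)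
        (by push_cast; linarith)
      have h2 := H.above_snd (4 * M + 4) h1 A1 B0 B1 (by linarith) (by push_cast; linarith)
        (by norm_num) (by norm_num)
      have h3 := H.above_snd (4 * M + 4 + 1) h2 A1 B1 C0 (by push_cast; linarith)
        (by push_cast; linarith) (by norm_num) (by norm_num)
      have h4 := H.above_snd (4 * M + 6) h3 A1 C0 C1 (by push_cast; linarith)
        (by push_cast; linarith) (by norm_num) (by norm_num)
      exact H.not_above_of_below (Nat.cast_nonneg _) (G.cast_le hi (by omega)) hb' h4
    intro k
    induction k with
    | zero =>
      intro hk
      have hlt : m₀ < M := by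
        by_contra hc
        obtain rfl : m₀ = M := by omega
        exact trap 0 hk hab
      exact ⟨hlt, hab, hbel hlt⟩
    | succ k ih =>
      intro hk
      obtain ⟨hlt, h1, h2⟩ := ih (by omega)
      have h3 := H.lock_above (G.pn i hi k (by omega)) (G.pw i hi k (by omega))
        (G.ps i hi k (by omega)) (G.pe_succ hi hk) (G.qe _ hlt.le) (G.qn _ hlt.le) (G.qw _ hlt)
        (G.qs _ hlt) (G.qe_succ hlt) (G.qn_succ hlt) h1
      have h3' : Above f g ((4 * L + 2) * i + 1 + 4 * (k + 1) : ℕ)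
          ((4 * (m₀ + (k + 1)) + 4 : ℕ) + 1 / 2) := by
        convert h3 using 1 <;> push_cast <;> ring
      have hlt' : m₀ + (k + 1) < M := by
        by_contra hc
        have : m₀ + (k + 1) = M := by omega
        rw [this] at h3'
        exact trap (k + 1) hk h3'
      have h4 := H.lock_below (j := 4 * (m₀ + (k + 1)) + 4) (G.pe i hi k (by omega))
        (G.pn i hi k (by omega)) (G.pw i hi k (by omega))
        (G.ps i hi k (by omega)) (G.pe_succ hi hk) (G.qe _ hlt'.le) (G.qn _ hlt'.le) (G.qw _ hlt')
        (G.qs _ hlt') (G.qe_succ hlt') (by convert h2 using 1; push_cast; ring)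
      refine ⟨hlt', h3', ?_⟩
      convert h4 using 1; push_cast; ring
  refine ⟨i, hi, m₀, fun k hk => ?_⟩
  obtain ⟨hlt, h1, h2⟩ := key k hk
  exact ⟨hlt, H.bits_disjoint (G.cast_le hi (by omega)) (G.pe i hi k hk) (G.qe _ hlt.le)
    (G.qn _ hlt.le) (G.qw _ hlt) (G.qs _ hlt) (G.qe_succ hlt) h1 h2, h1, h2⟩

end Window

/-! ### Traversals in which one agent moves at a time -/

/-- One of the agents walks along an edge while the other one waits at a vertex, at a distance of at
least 4. -/
inductive FarStep (P Q : ℕ → ℕ × ℕ) : ℕ × ℕ → ℕ × ℕ → Prop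
  | fst (i j : ℕ) (h : ∀ l ∈ Icc (0 : ℝ) 1, 4 ≤ ‖polyline (crv P) (i + l) - polyline (crv Q) j‖) :
      FarStep P Q (i, j) (i + 1, j)
  | snd (i j : ℕ) (h : ∀ l ∈ Icc (0 : ℝ) 1, 4 ≤ ‖polyline (crv P) i - polyline (crv Q) (j + l)‖) :
      FarStep P Q (i, j) (i, j + 1)

/-- A sequence of steps is a pair of continuous monotone motions, both at rest after some time. -/
lemma exists_motion {P Q : ℕ → ℕ × ℕ} (h0 : 4 ≤ ‖polyline (crv P) 0 - polyline (crv Q) 0‖)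
    {z : ℕ × ℕ} (h : Relation.ReflTransGen (FarStep P Q) (0, 0) z) :
    ∃ (K : ℕ) (F G : ℝ → ℝ), Continuous F ∧ Continuous G ∧ Monotone F ∧ Monotone G ∧
      F 0 = 0 ∧ G 0 = 0 ∧ (∀ s, (K : ℝ) ≤ s → F s = z.1 ∧ G s = z.2) ∧
      ∀ s, 0 ≤ s → 4 ≤ ‖polyline (crv P) (F s) - polyline (crv Q) (G s)‖ := by
  induction h with
  | refl =>
    exact ⟨0, fun _ => 0, fun _ => 0, continuous_const, continuous_const, monotone_const,
      monotone_const, rfl, rfl, by simp, fun _ _ => h0⟩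
  | tail _ hs ih =>
    obtain ⟨K, F, G, cF, cG, mF, mG, F0, G0, hK, hd⟩ := ih
    -- the unit of time after `K` is used for the additional edge
    have cR : Continuous fun s : ℝ => max 0 (min 1 (s - K)) := by fun_prop
    have mR : Monotone fun s : ℝ => max 0 (min 1 (s - K)) := fun s t hst =>
      max_le_max le_rfl (min_le_min le_rfl (by linarith))
    have R1 : ∀ s : ℝ, s ≤ K → max 0 (min 1 (s - K)) = 0 := fun s hs =>
      max_eq_left ((min_le_right _ _).trans (by linarith))
    have R2 : ∀ s : ℝ, (K + 1 : ℕ) ≤ s → max 0 (min 1 (s - K)) = 1 := fun s hs => by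
      push_cast at hs
      rw [min_eq_left (by linarith)]; norm_num
    have R3 : ∀ s : ℝ, max 0 (min 1 (s - K)) ∈ Icc (0 : ℝ) 1 := fun s =>
      ⟨le_max_left _ _, max_le zero_le_one (min_le_left _ _)⟩
    have K0 : (0 : ℝ) ≤ K := Nat.cast_nonneg K
    cases hs with
    | fst i j h =>
      refine ⟨K + 1, fun s => F s + max 0 (min 1 (s - K)), G, cF.add cR, cG, mF.add mR, mG, ?_, G0,
        fun s hs => ?_, fun s hs => ?_⟩
      · simp only [F0, R1 0 K0, add_zero]
      · have hKs : (K : ℝ) ≤ s := by push_cast at hs; linarith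
        simp only [R2 s hs, (hK s hKs).1, (hK s hKs).2]
        push_cast; trivial
      · rcases le_total s K with hsK | hsK
        · simpa only [R1 s hsK, add_zero] using hd s hs
        · simpa only [(hK s hsK).1, (hK s hsK).2] using h _ (R3 s)
    | snd i j h =>
      refine ⟨K + 1, F, fun s => G s + max 0 (min 1 (s - K)), cF, cG.add cR, mF, mG.add mR, F0, ?_,
        fun s hs => ?_, fun s hs => ?_⟩
      · simp only [G0, R1 0 K0, add_zero]
      · have hKs : (K : ℝ) ≤ s := by push_cast at hs; linarith
        simp only [R2 s hs, (hK s hKs).1, (hK s hKs).2]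
        push_cast; trivial
      · rcases le_total s K with hsK | hsK
        · simpa only [R1 s hsK, add_zero] using hd s hs
        · simpa only [(hK s hsK).1, (hK s hsK).2] using h _ (R3 s)

lemma exists_traversal {P Q : ℕ → ℕ × ℕ} (h0 : 4 ≤ ‖polyline (crv P) 0 - polyline (crv Q) 0‖)
    {n : ℕ} (hn : 1 ≤ n) (h : Relation.ReflTransGen (FarStep P Q) (0, 0) (n - 1, n - 1)) :
    ∃ f g, IsTraversal n f ∧ IsTraversal n g ∧ 4 ≤ separation (crv P) (crv Q) f g := by
  obtain ⟨K, F, G, cF, cG, mF, mG, F0, G0, hK, hd⟩ := exists_motion h0 h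
  have hKn : F K = (n : ℝ) - 1 ∧ G K = (n : ℝ) - 1 := by
    have := hK K le_rfl
    simp only [Nat.cast_sub hn, Nat.cast_one] at this
    exact this
  have K0 : (0 : ℝ) ≤ K := Nat.cast_nonneg K
  have trav : ∀ F : ℝ → ℝ, Continuous F → Monotone F → F 0 = 0 → F K = (n : ℝ) - 1 →
      IsTraversal n fun t => F (K * t) := by
    intro F cF mF F0 FK
    have cf : Continuous fun t : ℝ => F (K * t) := by fun_prop
    have mf : Monotone fun t : ℝ => F (K * t) := fun s t hst => mF (by gcongr)
    refine ⟨cf.continuousOn, mf.monotoneOn _, Subset.antisymm ?_ ?_⟩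
    · rintro _ ⟨t, ht, rfl⟩
      have h1 := mf ht.1
      have h2 := mf ht.2
      simp only [mul_zero, mul_one, F0, FK] at h1 h2
      exact ⟨h1, h2⟩
    · have := intermediate_value_Icc zero_le_one (cf.continuousOn (s := Icc 0 1))
      simpa only [mul_zero, mul_one, F0, FK] using this
  refine ⟨_, _, trav F cF mF F0 hKn.1, trav G cG mG G0 hKn.2, le_csInf ?_ ?_⟩
  · exact (nonempty_Icc.2 zero_le_one).image _
  · rintro _ ⟨t, ht, rfl⟩
    exact hd _ (mul_nonneg K0 ht.1)

/-- A point and a segment are at a distance of at least 4 if a linear functional separates them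
sufficiently. -/
lemma four_le_of_functional {u v c α β : ℝ} (hpos : 0 < α ^ 2 + β ^ 2) (hc : 0 ≤ c)
    (hn : 16 * (α ^ 2 + β ^ 2) ≤ c ^ 2) (h : c ≤ α * u + β * v) : 4 ≤ √(u ^ 2 + v ^ 2) := by
  apply Real.le_sqrt_of_sq_le
  have h1 : c ^ 2 ≤ (α * u + β * v) ^ 2 := pow_le_pow_left₀ hc h 2
  have h2 : (α * u + β * v) ^ 2 ≤ (α ^ 2 + β ^ 2) * (u ^ 2 + v ^ 2) := by
    nlinarith [sq_nonneg (α * v - β * u)]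
  have h3 : (α ^ 2 + β ^ 2) * 16 ≤ (α ^ 2 + β ^ 2) * (u ^ 2 + v ^ 2) := by linarith
  have := le_of_mul_le_mul_left h3 hpos
  linarith

section Steps

variable {P Q : ℕ → ℕ × ℕ}

/-- A step of the first agent, certified by the linear functional `(u, v) ↦ α * u + β * v`, which is at
least `c ≥ 4 * √(α ^ 2 + β ^ 2)` at the differences of the positions. -/
lemma farStep_fst {i j : ℕ} {p p' q : ℕ × ℕ} (hp : P i = p) (hp' : P (i + 1) = p') (hq : Q j = q)
    (α β c : ℝ) (hpos : 0 < α ^ 2 + β ^ 2) (hc : 0 ≤ c) (hn : 16 * (α ^ 2 + β ^ 2) ≤ c ^ 2)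
    (h : c ≤ α * (p.1 - q.1) + β * (p.2 - q.2)) (h' : c ≤ α * (p'.1 - q.1) + β * (p'.2 - q.2)) :
    FarStep P Q (i, j) (i + 1, j) := by
  refine .fst i j fun l hl => ?_
  rw [dist_at (at_edge hp hp' hl.1 hl.2 rfl) (at_vertex hq rfl)]
  refine four_le_of_functional hpos hc hn ?_
  have := add_le_add (mul_le_mul_of_nonneg_left h (by linarith [hl.2] : (0 : ℝ) ≤ 1 - l))
    (mul_le_mul_of_nonneg_left h' hl.1)
  linarith

lemma farStep_snd {i j : ℕ} {p q q' : ℕ × ℕ} (hp : P i = p) (hq : Q j = q) (hq' : Q (j + 1) = q')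
    (α β c : ℝ) (hpos : 0 < α ^ 2 + β ^ 2) (hc : 0 ≤ c) (hn : 16 * (α ^ 2 + β ^ 2) ≤ c ^ 2)
    (h : c ≤ α * (p.1 - q.1) + β * (p.2 - q.2)) (h' : c ≤ α * (p.1 - q'.1) + β * (p.2 - q'.2)) :
    FarStep P Q (i, j) (i, j + 1) := by
  refine .snd i j fun l hl => ?_
  rw [dist_at (at_vertex hp rfl) (at_edge hq hq' hl.1 hl.2 rfl)]
  refine four_le_of_functional hpos hc hn ?_
  have := add_le_add (mul_le_mul_of_nonneg_left h (by linarith [hl.2] : (0 : ℝ) ≤ 1 - l))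
    (mul_le_mul_of_nonneg_left h' hl.1)
  linarith

lemma reach_fst {i i' j : ℕ} (hi : i ≤ i')
    (h : ∀ k, i ≤ k → k < i' → FarStep P Q (k, j) (k + 1, j)) :
    Relation.ReflTransGen (FarStep P Q) (i, j) (i', j) := by
  induction i', hi using Nat.le_induction with
  | base => exact .refl
  | succ k hk ih =>
    exact (ih fun k' h1 h2 => h k' h1 (by omega)).tail (h k hk (by omega))

lemma reach_snd {i j j' : ℕ} (hj : j ≤ j')
    (h : ∀ k, j ≤ k → k < j' → FarStep P Q (i, k) (i, k + 1)) :
    Relation.ReflTransGen (FarStep P Q) (i, j) (i, j') := by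
  induction j', hj using Nat.le_induction with
  | base => exact .refl
  | succ k hk ih =>
    exact (ih fun k' h1 h2 => h k' h1 (by omega)).tail (h k hk (by omega))

/-- A round in lockstep. If one agent passes the centre, then the other one waits at its outer vertex
in the meantime. -/
lemma reach_round {i j : ℕ} {b c : Bool} (hbc : ¬ (b = true ∧ c = true))
    (p0 : P i = (if b then 7 else 11, 7))
    (p1 : P (i + 1) = (7, 10)) (p2 : P (i + 2) = (4, 7)) (p3 : P (i + 3) = (7, 4))
    (q0 : Q j = (if c then 7 else 3, 7)) (q1 : Q (j + 1) = (7, 4)) (q2 : Q (j + 2) = (10, 7))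
    (q3 : Q (j + 3) = (7, 10)) :
    Relation.ReflTransGen (FarStep P Q) (i, j) (i + 3, j + 3) := by
  have h1 : Relation.ReflTransGen (FarStep P Q) (i, j) (i + 1, j + 1) := by
    cases c
    · refine (Relation.ReflTransGen.single ?_).tail (b := (i + 1, j)) ?_
      · refine farStep_fst p0 p1 q0 1 0 4 ?_ ?_ ?_ ?_ ?_ <;> cases b <;> norm_num
      · exact farStep_snd p1 q0 q1 3 4 24 (by norm_num) (by norm_num) (by norm_num) (by norm_num)
          (by norm_num)
    · obtain rfl : b = false := by simpa using hbc
      refine (Relation.ReflTransGen.single ?_).tail (b := (i, j + 1)) ?_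
      · exact farStep_snd p0 q0 q1 1 0 4 (by norm_num) (by norm_num) (by norm_num) (by norm_num)
          (by norm_num)
      · exact farStep_fst p0 p1 q1 3 4 24 (by norm_num) (by norm_num) (by norm_num) (by norm_num)
          (by norm_num)
  have h2 : FarStep P Q (i + 1, j + 1) (i + 2, j + 1) :=
    farStep_fst p1 p2 q1 (-1) 1 6 (by norm_num) (by norm_num) (by norm_num) (by norm_num)
      (by norm_num)
  have h3 : FarStep P Q (i + 2, j + 1) (i + 2, j + 2) :=
    farStep_snd p2 q1 q2 (-1) 1 6 (by norm_num) (by norm_num) (by norm_num) (by norm_num)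
      (by norm_num)
  have h4 : FarStep P Q (i + 2, j + 2) (i + 3, j + 2) :=
    farStep_fst p2 p3 q2 (-1) (-1) 6 (by norm_num) (by norm_num) (by norm_num) (by norm_num)
      (by norm_num)
  have h5 : FarStep P Q (i + 3, j + 2) (i + 3, j + 3) :=
    farStep_snd p3 q2 q3 (-1) (-1) 6 (by norm_num) (by norm_num) (by norm_num) (by norm_num)
      (by norm_num)
  exact (((h1.tail h2).tail h3).tail h4).tail h5

lemma reach_next {i j : ℕ} {b c : Bool} (hbc : ¬ (b = true ∧ c = true))
    (p0 : P i = (7, 4)) (p1 : P (i + 1) = (if b then 7 else 11, 7))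
    (q0 : Q j = (7, 10)) (q1 : Q (j + 1) = (if c then 7 else 3, 7)) :
    Relation.ReflTransGen (FarStep P Q) (i, j) (i + 1, j + 1) := by
  cases c
  · refine (Relation.ReflTransGen.single ?_).tail (b := (i, j + 1)) ?_
    · exact farStep_snd p0 q0 q1 3 (-4) 24 (by norm_num) (by norm_num) (by norm_num) (by norm_num)
        (by norm_num)
    · refine farStep_fst p0 p1 q1 1 0 4 ?_ ?_ ?_ ?_ ?_ <;> cases b <;> norm_num
  · obtain rfl : b = false := by simpa using hbc
    refine (Relation.ReflTransGen.single ?_).tail (b := (i + 1, j)) ?_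
    · exact farStep_fst p0 p1 q0 3 (-4) 24 (by norm_num) (by norm_num) (by norm_num) (by norm_num)
        (by norm_num)
    · exact farStep_snd p1 q0 q1 1 0 4 (by norm_num) (by norm_num) (by norm_num) (by norm_num)
        (by norm_num)

end Steps

/-- If a window of rounds has bits disjoint from those of some block, then both agents can walk
through the block and the window in lockstep, and wait far away from each other before and after. -/
theorem Gadgets.exists_far_traversal {N L M n : ℕ} {x : ℕ → ℕ → Bool} {y : ℕ → Bool}
    {P Q : ℕ → ℕ × ℕ} (G : Gadgets N L M n x y P Q) {i m₀ : ℕ} (hi : i < N) (hm : m₀ + L ≤ M)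
    (hxy : ∀ k < L, ¬ (x i k = true ∧ y (m₀ + k) = true)) :
    ∃ f g, IsTraversal n f ∧ IsTraversal n g ∧ 4 ≤ separation (crv P) (crv Q) f g := by
  have hL := G.L_pos
  have hn' := G.hn'
  have hle := G.le_n hi
  have px : ∀ j, (4 : ℝ) ≤ (P j).1 := fun j => by exact_mod_cast G.px j
  -- an agent far in the west is never approached by the first one
  have west : ∀ k j, Q j = (0, 7) → FarStep P Q (k, j) (k + 1, j) := fun k j hq =>
    farStep_fst rfl rfl hq 1 0 4 (by norm_num) (by norm_num) (by norm_num)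
      (by simpa using px k) (by simpa using px (k + 1))
  have h0 : 4 ≤ ‖polyline (crv P) 0 - polyline (crv Q) 0‖ := by
    have := dist_at (at_vertex (P := P) (i := 0) rfl (x := 0) (by simp))
      (at_vertex G.q0 (x := 0) (by simp))
    rw [this]
    refine four_le_of_functional (α := 1) (β := 0) (c := 4) (by norm_num) (by norm_num)
      (by norm_num) ?_
    simpa using px 0
  refine exists_traversal h0 (by omega) ?_
  have r1 : Relation.ReflTransGen (FarStep P Q) (0, 0) ((4 * L + 2) * i, 0) :=
    reach_fst (Nat.zero_le _) fun k _ _ => west k 0 G.q0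
  -- the second agent walks to its window while the first one waits in the far north
  have r2 : Relation.ReflTransGen (FarStep P Q) ((4 * L + 2) * i, 0)
      ((4 * L + 2) * i, 4 * m₀ + 4 + 2) := by
    refine reach_snd (Nat.zero_le _) fun k _ hk => ?_
    have y1 : ((Q k).2 : ℝ) ≤ 10 := by exact_mod_cast G.qy_le k (by omega)
    have y2 : ((Q (k + 1)).2 : ℝ) ≤ 10 := by exact_mod_cast G.qy_le (k + 1) (by omega)
    exact farStep_snd (G.start i hi) rfl rfl 0 1 4 (by norm_num) (by norm_num) (by norm_num)
      (by push_cast; linarith) (by push_cast; linarith)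
  -- the first bit of the block is set, so the second agent is at its outer vertex
  have y0 : y m₀ = false := by simpa [G.first i hi] using hxy 0 hL
  have r3 : FarStep P Q ((4 * L + 2) * i, 4 * m₀ + 4 + 2)
      ((4 * L + 2) * i + 1, 4 * m₀ + 4 + 2) := by
    have q := G.qw m₀ (by omega)
    have p := G.pe i hi 0 hL
    rw [y0] at q
    rw [G.first i hi] at p
    exact farStep_fst (G.start i hi) p q 1 0 4 (by norm_num) (by norm_num) (by norm_num)
      (by norm_num) (by norm_num)
  have r4 : ∀ k < L, Relation.ReflTransGen (FarStep P Q)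
      ((4 * L + 2) * i + 1, 4 * m₀ + 4 + 2)
      ((4 * L + 2) * i + 1 + 4 * k + 3, 4 * (m₀ + k) + 4 + 2 + 3) := by
    have round : ∀ k < L, Relation.ReflTransGen (FarStep P Q)
        ((4 * L + 2) * i + 1 + 4 * k, 4 * (m₀ + k) + 4 + 2)
        ((4 * L + 2) * i + 1 + 4 * k + 3, 4 * (m₀ + k) + 4 + 2 + 3) := fun k hk =>
      reach_round (hxy k hk) (G.pe i hi k hk) (G.pn i hi k hk) (G.pw i hi k hk) (G.ps i hi k hk)
        (G.qw _ (by omega)) (G.qs _ (by omega)) (G.qe_succ (by omega)) (G.qn_succ (by omega))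
    intro k
    induction k with
    | zero => exact fun hk => round 0 hk
    | succ k ih =>
      intro hk
      refine (ih (by omega)).trans (.trans ?_ (round (k + 1) hk))
      exact reach_next (i := (4 * L + 2) * i + 1 + 4 * k + 3) (hxy (k + 1) hk)
        (G.ps i hi k (by omega)) (G.pe_succ hi hk)
        (G.qn_succ (by omega)) (G.qw (m₀ + (k + 1)) (by omega))
  have hidx : (4 * L + 2) * i + 1 + 4 * (L - 1) + 3 + 1 = (4 * L + 2) * i + 1 + 4 * L := by omega
  have pT := G.finish i hi
  rw [← hidx] at pT
  have hE : 4 * (m₀ + (L - 1)) + 4 + 2 + 3 = 4 * (m₀ + (L - 1)) + 4 + 5 := rfl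
  have r5 : FarStep P Q ((4 * L + 2) * i + 1 + 4 * (L - 1) + 3, 4 * (m₀ + (L - 1)) + 4 + 2 + 3)
      ((4 * L + 2) * i + 1 + 4 * (L - 1) + 3 + 1, 4 * (m₀ + (L - 1)) + 4 + 2 + 3) :=
    farStep_fst (G.ps i hi (L - 1) (by omega)) pT (G.qn_succ (m := m₀ + (L - 1)) (by omega))
      0 (-1) 4 (by norm_num) (by norm_num) (by norm_num) (by norm_num) (by norm_num)
  -- the second agent walks to its end while the first one waits in the far south
  have r6 : Relation.ReflTransGen (FarStep P Q)
      ((4 * L + 2) * i + 1 + 4 * (L - 1) + 3 + 1, 4 * (m₀ + (L - 1)) + 4 + 2 + 3)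
      ((4 * L + 2) * i + 1 + 4 * (L - 1) + 3 + 1, n - 1) := by
    refine reach_snd (by omega) fun k hk _ => ?_
    have y1 : (4 : ℝ) ≤ ((Q k).2 : ℝ) := by exact_mod_cast G.qy_ge k (by omega)
    have y2 : (4 : ℝ) ≤ ((Q (k + 1)).2 : ℝ) := by exact_mod_cast G.qy_ge (k + 1) (by omega)
    exact farStep_snd pT rfl rfl 0 (-1) 4 (by norm_num) (by norm_num) (by norm_num)
      (by push_cast; linarith) (by push_cast; linarith)
  have r7 : Relation.ReflTransGen (FarStep P Q)
      ((4 * L + 2) * i + 1 + 4 * (L - 1) + 3 + 1, n - 1) (n - 1, n - 1) :=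
    reach_fst (by omega) fun k _ _ => west k (n - 1) (G.r3 _ (by omega))
  exact ((((r1.trans r2).tail r3).trans (r4 (L - 1) (by omega))).tail r5).trans (r6.trans r7)

/-! ### The curves of an Orthogonal Vectors instance -/

/-- The `k`-th bit of the code word of the `i`-th vector of the first family: `1 1`, then `0 u` for
each coordinate `u`, then `0`. The array `A` holds the coordinates, vector after vector. -/
def bitFst (D : ℕ) (A : ℕ → ℕ) (i k : ℕ) : Bool :=
  if k < 2 then true else if k % 2 < 1 then false else decide (0 < A (i * D + (k - 3) / 2))

/-- The `z`-th bit of the concatenated code words of the vectors of the second family, each `0 0`, then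
`1 v` for each coordinate `v`, then `1`. The array `B` holds the coordinates, vector after vector. -/
def bitSnd (D : ℕ) (B : ℕ → ℕ) (z : ℕ) : Bool :=
  if z % (2 * D + 3) < 2 then false else if z % (2 * D + 3) % 2 < 1 then true
  else decide (0 < B (z / (2 * D + 3) * D + (z % (2 * D + 3) - 3) / 2))

/-- The vertices of the first curve. -/
def vertFst (N L : ℕ) (x : ℕ → ℕ → Bool) (j : ℕ) : ℕ × ℕ :=
  if j / (4 * L + 2) < N then
    if j % (4 * L + 2) < 1 then (7, 14)
    else if j % (4 * L + 2) < 4 * L + 1 then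
      if (j % (4 * L + 2) - 1) % 4 < 1 then
        (if x (j / (4 * L + 2)) ((j % (4 * L + 2) - 1) / 4) then 7 else 11, 7)
      else if (j % (4 * L + 2) - 1) % 4 < 2 then (7, 10)
      else if (j % (4 * L + 2) - 1) % 4 < 3 then (4, 7) else (7, 4)
    else (7, 0)
  else (7, 0)

/-- The vertices of the second curve. -/
def vertSnd (M : ℕ) (y : ℕ → Bool) (j : ℕ) : ℕ × ℕ :=
  if j < 1 then (0, 7) else if j < 2 then (7, 2) else if j < 3 then (7, 7)
  else if j < 4 then (9, 7) else if j < 5 then (10, 7) else if j < 6 then (7, 10)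
  else if j < 4 * M + 6 then
    if (j - 6) % 4 < 1 then (if y ((j - 6) / 4) then 7 else 3, 7)
    else if (j - 6) % 4 < 2 then (7, 4) else if (j - 6) % 4 < 3 then (10, 7) else (7, 10)
  else if j < 4 * M + 7 then (7, 12) else if j < 4 * M + 8 then (7, 7)
  else if j < 4 * M + 9 then (9, 7) else (0, 7)

/-- The number of vertices of the curves of an instance with `N` vectors of dimension `D`. -/
def curveLength (N D : ℕ) : ℕ := N * (4 * (2 * D + 3) + 2) + 10

/-- The first curve of an instance. -/
def curveFst (N D : ℕ) (A : ℕ → ℕ) : ℕ → ℕ × ℕ := vertFst N (2 * D + 3) (bitFst D A)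

/-- The second curve of an instance. -/
def curveSnd (N D : ℕ) (B : ℕ → ℕ) : ℕ → ℕ × ℕ := vertSnd (N * (2 * D + 3)) (bitSnd D B)

lemma vertFst_block {N L : ℕ} {x : ℕ → ℕ → Bool} {i r : ℕ} (hi : i < N) (hr : r < 4 * L + 2) :
    vertFst N L x ((4 * L + 2) * i + r) =
      if r < 1 then (7, 14)
      else if r < 4 * L + 1 then
        if (r - 1) % 4 < 1 then (if x i ((r - 1) / 4) then 7 else 11, 7)
        else if (r - 1) % 4 < 2 then (7, 10)
        else if (r - 1) % 4 < 3 then (4, 7) else (7, 4)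
      else (7, 0) := by
  have h1 : ((4 * L + 2) * i + r) / (4 * L + 2) = i := by
    rw [Nat.mul_add_div (by omega), Nat.div_eq_of_lt hr, add_zero]
  have h2 : ((4 * L + 2) * i + r) % (4 * L + 2) = r := by
    rw [Nat.mul_add_mod, Nat.mod_eq_of_lt hr]
  unfold vertFst
  rw [h1, h2, if_pos hi]

lemma vertFst_round {N L : ℕ} {x : ℕ → ℕ → Bool} {i k s : ℕ} (hi : i < N) (hk : k < L)
    (hs : s < 4) : vertFst N L x ((4 * L + 2) * i + 1 + 4 * k + s) =
      if s < 1 then (if x i k then 7 else 11, 7) else if s < 2 then (7, 10)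
        else if s < 3 then (4, 7) else (7, 4) := by
  rw [show (4 * L + 2) * i + 1 + 4 * k + s = (4 * L + 2) * i + (1 + 4 * k + s) by ring,
    vertFst_block hi (by omega), if_neg (by omega), if_pos (by omega),
    show (1 + 4 * k + s - 1) % 4 = s by omega, show (1 + 4 * k + s - 1) / 4 = k by omega]

lemma vertSnd_round {M : ℕ} {y : ℕ → Bool} {m s : ℕ} (hm : m < M) (hs : s < 4) :
    vertSnd M y (4 * m + 4 + 2 + s) =
      if s < 1 then (if y m then 7 else 3, 7) else if s < 2 then (7, 4)
        else if s < 3 then (10, 7) else (7, 10) := by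
  unfold vertSnd
  rw [if_neg (by omega), if_neg (by omega), if_neg (by omega), if_neg (by omega),
    if_neg (by omega), if_neg (by omega), if_pos (by omega),
    show (4 * m + 4 + 2 + s - 6) % 4 = s by omega, show (4 * m + 4 + 2 + s - 6) / 4 = m by omega]

lemma vertSnd_tail {M : ℕ} {y : ℕ → Bool} {s : ℕ} :
    vertSnd M y (4 * M + 6 + s) =
      if s < 1 then (7, 12) else if s < 2 then (7, 7) else if s < 3 then (9, 7) else (0, 7) := by
  unfold vertSnd
  rw [if_neg (by omega), if_neg (by omega), if_neg (by omega), if_neg (by omega),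
    if_neg (by omega), if_neg (by omega), if_neg (by omega)]
  split_ifs <;> first | rfl | (exfalso; omega)

lemma ite_ind {α : Type*} {p : α → Prop} {c : Prop} [Decidable c] {a b : α} (ha : c → p a)
    (hb : ¬ c → p b) : p (if c then a else b) := by
  split_ifs with h
  · exact ha h
  · exact hb h

lemma vertFst_bounds {N L : ℕ} {x : ℕ → ℕ → Bool} (j : ℕ) :
    4 ≤ (vertFst N L x j).1 ∧ (vertFst N L x j).1 ≤ 14 ∧ (vertFst N L x j).2 ≤ 14 := by
  unfold vertFst
  repeat'
    refine ite_ind (p := fun z : ℕ × ℕ => 4 ≤ z.1 ∧ z.1 ≤ 14 ∧ z.2 ≤ 14) (fun _ => ?_) fun _ => ?_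
  · norm_num
  · cases x (j / (4 * L + 2)) ((j % (4 * L + 2) - 1) / 4) <;> norm_num
  all_goals norm_num

lemma vertSnd_bounds {M : ℕ} {y : ℕ → Bool} (j : ℕ) :
    (vertSnd M y j).1 ≤ 14 ∧ (vertSnd M y j).2 ≤ 14 := by
  unfold vertSnd
  repeat' refine ite_ind (p := fun z : ℕ × ℕ => z.1 ≤ 14 ∧ z.2 ≤ 14) (fun _ => ?_) fun _ => ?_
  all_goals first | (norm_num; done) | (cases y ((j - 6) / 4) <;> norm_num)

lemma gadgets_vert {N L M n : ℕ} {x : ℕ → ℕ → Bool} {y : ℕ → Bool} (hN : 0 < N) (hL : 0 < L)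
    (hx : ∀ i, x i 0 = true) (h1 : (4 * L + 2) * N ≤ n) (h2 : 4 * M + 10 ≤ n) :
    Gadgets N L M n x y (vertFst N L x) (vertSnd M y) where
  start i hi := by simpa using vertFst_block (x := x) (L := L) (r := 0) hi (by omega)
  pe i hi k hk := by simpa using vertFst_round (x := x) (s := 0) hi hk (by omega)
  pn i hi k hk := by simpa using vertFst_round (x := x) (s := 1) hi hk (by omega)
  pw i hi k hk := by simpa using vertFst_round (x := x) (s := 2) hi hk (by omega)
  ps i hi k hk := by simpa using vertFst_round (x := x) (s := 3) hi hk (by omega)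
  finish i hi := by
    rw [show (4 * L + 2) * i + 1 + 4 * L = (4 * L + 2) * i + (4 * L + 1) by ring,
      vertFst_block hi (by omega), if_neg (by omega), if_neg (by omega)]
  pad j hj := by
    have : ¬ j / (4 * L + 2) < N := by
      rw [not_lt, Nat.le_div_iff_mul_le (by omega)]; linarith
    simp [vertFst, this]
  q0 := by simp [vertSnd]
  q1 := by simp [vertSnd]
  q2 := by simp [vertSnd]
  q3 := by simp [vertSnd]
  qe m hm := by
    rcases m with _ | m
    · simp [vertSnd]
    · have h := vertSnd_round (y := y) (s := 2) (show m < M by omega) (by omega)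
      rw [show 4 * (m + 1) + 4 = 4 * m + 4 + 2 + 2 by ring]
      simpa using h
  qn m hm := by
    rcases m with _ | m
    · simp [vertSnd]
    · have h := vertSnd_round (y := y) (s := 3) (show m < M by omega) (by omega)
      rw [show 4 * (m + 1) + 4 + 1 = 4 * m + 4 + 2 + 3 by ring]
      simpa using h
  qw m hm := by simpa using vertSnd_round (y := y) (s := 0) hm (by omega)
  qs m hm := by simpa using vertSnd_round (y := y) (s := 1) hm (by omega)
  r0 := by simpa using vertSnd_tail (M := M) (y := y) (s := 0)
  r1 := by simpa using vertSnd_tail (M := M) (y := y) (s := 1)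
  r2 := by simpa using vertSnd_tail (M := M) (y := y) (s := 2)
  r3 j hj := by
    obtain ⟨s, rfl⟩ : ∃ s, j = 4 * M + 6 + s := ⟨j - (4 * M + 6), by omega⟩
    rw [vertSnd_tail, if_neg (by omega), if_neg (by omega), if_neg (by omega)]
  first i _ := hx i
  N_pos := hN
  L_pos := hL
  hn := h1
  hn' := h2
  px j := (vertFst_bounds j).1
  qy_le j hj := by
    unfold vertSnd
    repeat' refine ite_ind (p := fun z : ℕ × ℕ => z.2 ≤ 10) (fun h => ?_) fun h => ?_
    all_goals first | (show (_ : ℕ) ≤ _; norm_num; done) | (exfalso; omega)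
  qy_ge j hj := by
    unfold vertSnd
    repeat' refine ite_ind (p := fun z : ℕ × ℕ => 4 ≤ z.2) (fun h => ?_) fun h => ?_
    all_goals first | (show (_ : ℕ) ≤ _; norm_num; done) | (exfalso; omega)

lemma gadgets_curve {N D : ℕ} (hN : 0 < N) (A B : ℕ → ℕ) :
    Gadgets N (2 * D + 3) (N * (2 * D + 3)) (curveLength N D) (bitFst D A) (bitSnd D B)
      (curveFst N D A) (curveSnd N D B) := by
  refine gadgets_vert hN (by omega) (fun i => by simp [bitFst]) ?_ ?_
  · unfold curveLength; nlinarith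
  · unfold curveLength; nlinarith

lemma curve_le {N D : ℕ} (hN : 0 < N) (A B : ℕ → ℕ) (j : ℕ) :
    (curveFst N D A j).1 ≤ curveLength N D ∧ (curveFst N D A j).2 ≤ curveLength N D ∧
      (curveSnd N D B j).1 ≤ curveLength N D ∧ (curveSnd N D B j).2 ≤ curveLength N D := by
  have h : 14 ≤ curveLength N D := by
    unfold curveLength
    have : 1 * (4 * (2 * D + 3) + 2) ≤ N * (4 * (2 * D + 3) + 2) := Nat.mul_le_mul_right _ hN
    omega
  have h1 := (vertFst_bounds (N := N) (L := 2 * D + 3) (x := bitFst D A) j).2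
  have h2 := vertSnd_bounds (M := N * (2 * D + 3)) (y := bitSnd D B) j
  exact ⟨h1.1.trans h, h1.2.trans h, h2.1.trans h, h2.2.trans h⟩

/-- The vectors `i` and `j` of the two families held in the arrays `A` and `B` are orthogonal. -/
def OrthAt (N D : ℕ) (A B : ℕ → ℕ) (i j : ℕ) : Prop :=
  i < N ∧ j < N ∧ ∀ d < D, ¬ (0 < A (i * D + d) ∧ 0 < B (j * D + d))

/-- The code words are disjoint from a window only if the window is aligned: the two initial `1`s fit
only the two initial `0`s of a code word. -/
lemma window_aligned {D : ℕ} (hD : 0 < D) {A B : ℕ → ℕ} {i m : ℕ}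
    (h : ∀ k < 2 * D + 3, ¬ (bitFst D A i k = true ∧ bitSnd D B (m + k) = true)) :
    m % (2 * D + 3) = 0 := by
  have hlt := Nat.mod_lt m (show 2 * D + 3 > 0 by omega)
  have h0 : bitSnd D B m = false := by simpa [bitFst] using h 0 (by omega)
  have h1 : bitSnd D B (m + 1) = false := by simpa [bitFst] using h 1 (by omega)
  by_contra hne
  rcases Nat.lt_or_ge (m % (2 * D + 3) + 1) (2 * D + 3) with hlt' | hge
  · have e : (m + 1) % (2 * D + 3) = m % (2 * D + 3) + 1 := by
      rw [Nat.add_mod, Nat.mod_eq_of_lt (show 1 < 2 * D + 3 by omega), Nat.mod_eq_of_lt hlt']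
    simp only [bitSnd] at h0 h1
    rw [e] at h1
    by_cases hr : m % (2 * D + 3) % 2 < 1
    · rw [if_neg (by omega), if_pos hr] at h0
      exact absurd h0 (by simp)
    · rw [if_neg (by omega), if_pos (by omega)] at h1
      exact absurd h1 (by simp)
  · simp only [bitSnd] at h0
    rw [if_neg (by omega), if_pos (by omega)] at h0
    exact absurd h0 (by simp)

lemma orthAt_of_window {N D : ℕ} (hD : 0 < D) {A B : ℕ → ℕ} {i m : ℕ} (hi : i < N)
    (h : ∀ k < 2 * D + 3, m + k < N * (2 * D + 3) ∧
      ¬ (bitFst D A i k = true ∧ bitSnd D B (m + k) = true)) :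
    ∃ j, m = j * (2 * D + 3) ∧ OrthAt N D A B i j := by
  have h0 := window_aligned hD fun k hk => (h k hk).2
  obtain ⟨j, rfl⟩ := Nat.dvd_of_mod_eq_zero h0
  refine ⟨j, mul_comm _ _, hi, ?_, fun d hd => ?_⟩
  · have := (h 0 (by omega)).1
    rw [add_zero, mul_comm] at this
    exact lt_of_mul_lt_mul_right this (Nat.zero_le _)
  · have := (h (3 + 2 * d) (by omega)).2
    simpa [bitFst, bitSnd, Nat.mul_add_div, Nat.mul_add_mod, Nat.mod_eq_of_lt (show 3 + 2 * d <
      2 * D + 3 by omega), Nat.div_eq_of_lt (show 3 + 2 * d < 2 * D + 3 by omega),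
      show ¬ (3 + 2 * d < 2) by omega, show (3 + 2 * d) % 2 = 1 by omega] using this

lemma window_of_orthAt {N D : ℕ} {A B : ℕ → ℕ} {i j : ℕ} (h : OrthAt N D A B i j) :
    j * (2 * D + 3) + (2 * D + 3) ≤ N * (2 * D + 3) ∧
      ∀ k < 2 * D + 3, ¬ (bitFst D A i k = true ∧ bitSnd D B (j * (2 * D + 3) + k) = true) := by
  refine ⟨?_, fun k hk => ?_⟩
  · have := Nat.mul_le_mul_right (2 * D + 3) h.2.1
    rwa [Nat.succ_mul] at this
  · have e1 : (j * (2 * D + 3) + k) % (2 * D + 3) = k := by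
      rw [mul_comm, Nat.mul_add_mod, Nat.mod_eq_of_lt hk]
    have e2 : (j * (2 * D + 3) + k) / (2 * D + 3) = j := by
      rw [mul_comm, Nat.mul_add_div (by omega), Nat.div_eq_of_lt hk, add_zero]
    simp only [bitFst, bitSnd, e1, e2]
    split_ifs with h1 h2
    · simp
    · simp
    · simpa using h.2.2 ((k - 3) / 2) (by omega)

/-! ### The flipped Fréchet measure of the curves of an instance -/

lemma separation_le {P Q : ℕ → Plane} {f g : ℝ → ℝ} {t : ℝ} (ht : t ∈ Icc (0 : ℝ) 1) :
    separation P Q f g ≤ ‖polyline P (f t) - polyline Q (g t)‖ :=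
  csInf_le ⟨0, by rintro _ ⟨t, _, rfl⟩; exact norm_nonneg _⟩ (mem_image_of_mem _ ht)

lemma separation_le_FF {n : ℕ} (hn : 1 ≤ n) {P Q : ℕ → Plane} {f g : ℝ → ℝ}
    (hf : IsTraversal n f) (hg : IsTraversal n g) : separation P Q f g ≤ FF n n P Q := by
  refine le_csSup ⟨‖polyline P 0 - polyline Q 0‖, ?_⟩ ⟨f, g, hf, hg, rfl⟩
  rintro _ ⟨f, g, hf, hg, rfl⟩
  have := separation_le (P := P) (Q := Q) (f := f) (g := g) (t := 0) (by simp)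
  rwa [hf.apply_zero hn, hg.apply_zero hn] at this

lemma curveLength_pos (N D : ℕ) : 1 ≤ curveLength N D := by unfold curveLength; omega

lemma four_le_FF {N D : ℕ} {A B : ℕ → ℕ} {i j : ℕ} (h : OrthAt N D A B i j) :
    4 ≤ FF (curveLength N D) (curveLength N D) (crv (curveFst N D A)) (crv (curveSnd N D B)) := by
  have hN : 0 < N := (Nat.zero_le _).trans_lt h.1
  obtain ⟨h1, h2⟩ := window_of_orthAt h
  obtain ⟨f, g, hf, hg, hs⟩ := (gadgets_curve hN A B).exists_far_traversal h.1 h1 h2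
  exact hs.trans (separation_le_FF (curveLength_pos N D) hf hg)

/-- Traversals with a separation of more than 3 visit the rounds of two orthogonal vectors at the same
time. The time given here is that of the second round of the first agent in its block. -/
lemma exists_orthAt_of_separation {N D : ℕ} (hN : 0 < N) (hD : 0 < D) {A B : ℕ → ℕ} {f g : ℝ → ℝ}
    (hf : IsTraversal (curveLength N D) f) (hg : IsTraversal (curveLength N D) g)
    (hs : 3 < separation (crv (curveFst N D A)) (crv (curveSnd N D B)) f g) :
    ∃ i j, OrthAt N D A B i j ∧ ∃ t ∈ Icc (0 : ℝ) 1,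
      f t = ((4 * (2 * D + 3) + 2) * i + 5 : ℕ) ∧
      f t < curveLength N D - 1 ∧
      ((4 * (2 * D + 3) * j + 8 : ℕ) : ℝ) + 1 / 2 < g t ∧
      g t < ((4 * (2 * D + 3) * j + 11 : ℕ) : ℝ) + 1 / 2 := by
  have G := gadgets_curve (D := D) hN A B
  have H : FarPath (curveLength N D) (curveFst N D A) (curveSnd N D B) f g :=
    ⟨curveLength_pos N D, hf, hg, fun t ht => hs.trans_le (separation_le ht)⟩
  obtain ⟨i, hi, m, hm⟩ := G.exists_window H
  obtain ⟨j, rfl, hj⟩ := orthAt_of_window hD hi fun k hk => ⟨(hm k hk).1, (hm k hk).2.1⟩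
  -- the second round, as in the first one the second agent may still be on an edge whose index is
  -- attributed to the vector before
  obtain ⟨-, -, h1, h2⟩ := hm 1 (by omega)
  have hle := G.cast_le hi (j := (4 * (2 * D + 3) + 2) * i + 6) (by omega)
  obtain ⟨t, ht, hft⟩ := H.exists_time (x := ((4 * (2 * D + 3) + 2) * i + 5 : ℕ))
    (Nat.cast_nonneg _) (by push_cast at hle ⊢; linarith)
  refine ⟨i, j, hj, t, ht, hft, ?_, ?_, ?_⟩
  · rw [hft]; push_cast at hle ⊢; linarith
  · have := h1 t ht (by rw [hft])
    push_cast at this ⊢; linarith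
  · have := h2 t ht (by rw [hft])
    push_cast at this ⊢; linarith

lemma FF_le_three {N D : ℕ} (hN : 0 < N) (hD : 0 < D) {A B : ℕ → ℕ}
    (h : ¬ ∃ i j, OrthAt N D A B i j) :
    FF (curveLength N D) (curveLength N D) (crv (curveFst N D A)) (crv (curveSnd N D B)) ≤ 3 := by
  refine Real.sSup_le ?_ (by norm_num)
  rintro _ ⟨f, g, hf, hg, rfl⟩
  by_contra hc
  obtain ⟨i, j, hij, -⟩ := exists_orthAt_of_separation hN hD hf hg (not_le.1 hc)
  exact h ⟨i, j, hij⟩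

/-- A piecewise linear traversal with a separation of more than 3 shows a pair of orthogonal vectors
in the edges of one of its pieces. -/
lemma exists_orthAt_of_code {N D : ℕ} (hN : 0 < N) (hD : 0 < D) {A B : ℕ → ℕ} {T : TraversalCode}
    (hT : T.Valid (curveLength N D))
    (hs : 3 < separation (crv (curveFst N D A)) (crv (curveSnd N D B)) T.f T.g) :
    ∃ k < T.m, OrthAt N D A B (T.i k / (4 * (2 * D + 3) + 2)) ((T.j k - 6) / (4 * (2 * D + 3))) := by
  obtain ⟨hfrac, hedge, hf, hg⟩ := hT
  obtain ⟨i, j, hij, t, ht, hft, hlt, hg1, hg2⟩ := exists_orthAt_of_separation hN hD hf hg hs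
  have hf1 := hf.apply_one (curveLength_pos N D)
  have hm : 0 < T.m := by
    by_contra hc
    have h0 : T.m = 0 := by omega
    simp only [TraversalCode.f, h0, Nat.cast_zero, zero_mul] at hf1 hlt
    linarith
  have hm' : (0 : ℝ) < T.m := by exact_mod_cast hm
  have ht1 : t < 1 := by
    rcases ht.2.lt_or_eq with h | rfl
    · exact h
    · linarith
  obtain ⟨k, hk⟩ : ∃ k, k = ⌊(T.m : ℝ) * t⌋₊ := ⟨_, rfl⟩
  have hmt : 0 ≤ (T.m : ℝ) * t := mul_nonneg hm'.le ht.1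
  have hk1 : (k : ℝ) ≤ T.m * t := hk ▸ Nat.floor_le hmt
  have hk2 : T.m * t ≤ k + 1 := hk ▸ (Nat.lt_floor_add_one _).le
  have hkm : k < T.m := by
    have : (k : ℝ) < T.m := hk1.trans_lt (by nlinarith)
    exact_mod_cast this
  -- during its `k`-th piece the traversal stays between the `k`-th and the next position
  have piece : ∀ pos : ℕ → ℝ, MonotoneOn (fun t : ℝ => polyline pos (T.m * t)) (Icc 0 1) →
      pos k ≤ polyline pos (T.m * t) ∧ polyline pos (T.m * t) ≤ pos (k + 1) := by
    intro pos hmono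
    have hc : ∀ l : ℕ, l ≤ T.m → (T.m : ℝ) * (l / T.m) = l ∧ (l : ℝ) / T.m ∈ Icc (0 : ℝ) 1 := by
      intro l hl
      refine ⟨by field_simp, by positivity, ?_⟩
      rw [div_le_one hm']; exact_mod_cast hl
    have h1 := hmono (hc k hkm.le).2 ht (by rw [div_le_iff₀ hm']; linarith)
    have h2 := hmono ht (hc (k + 1) hkm).2 (by rw [le_div_iff₀ hm']; push_cast; linarith)
    simp only [(hc k hkm.le).1, (hc (k + 1) hkm).1, polyline_natCast] at h1 h2
    exact ⟨h1, h2⟩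
  obtain ⟨a1, a2⟩ := piece T.posFst hf.2.1
  obtain ⟨b1, b2⟩ := piece T.posSnd hg.2.1
  obtain ⟨l0, -, u0, -⟩ := hfrac k hkm.le
  obtain ⟨e1, e2⟩ := hedge k hkm
  change T.f t = _ at hft
  change _ ≤ T.f t at a1
  change T.f t ≤ _ at a2
  change _ ≤ T.g t at b1
  change T.g t ≤ _ at b2
  have i1 : T.i k ≤ (4 * (2 * D + 3) + 2) * i + 5 := by
    have : (T.i k : ℝ) ≤ ((4 * (2 * D + 3) + 2) * i + 5 : ℕ) := by
      rw [← hft]; unfold TraversalCode.posFst at a1; linarith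
    exact_mod_cast this
  have i2 : (4 * (2 * D + 3) + 2) * i + 5 ≤ T.i k + 1 := by
    have : (((4 * (2 * D + 3) + 2) * i + 5 : ℕ) : ℝ) ≤ (T.i k + 1 : ℕ) := by
      rw [← hft]; push_cast; linarith
    exact_mod_cast this
  have j1 : T.j k < 4 * (2 * D + 3) * j + 12 := by
    have : (T.j k : ℝ) < (4 * (2 * D + 3) * j + 12 : ℕ) := by
      unfold TraversalCode.posSnd at b1; push_cast at hg2 ⊢; linarith
    exact_mod_cast this
  have j2 : 4 * (2 * D + 3) * j + 8 < T.j k + 1 := by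
    have : ((4 * (2 * D + 3) * j + 8 : ℕ) : ℝ) < (T.j k + 1 : ℕ) := by
      push_cast at hg1 ⊢; linarith
    exact_mod_cast this
  refine ⟨k, hkm, ?_⟩
  have hi : T.i k / (4 * (2 * D + 3) + 2) = i := by
    obtain ⟨r, hr⟩ : ∃ r, T.i k = (4 * (2 * D + 3) + 2) * i + r :=
      ⟨T.i k - (4 * (2 * D + 3) + 2) * i, by omega⟩
    rw [hr, Nat.mul_add_div (by omega), Nat.div_eq_of_lt (by omega), add_zero]
  have hj : (T.j k - 6) / (4 * (2 * D + 3)) = j := by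
    obtain ⟨r, hr⟩ : ∃ r, T.j k = 4 * (2 * D + 3) * j + r := ⟨T.j k - 4 * (2 * D + 3) * j, by omega⟩
    rw [hr, show 4 * (2 * D + 3) * j + r - 6 = 4 * (2 * D + 3) * j + (r - 6) by omega,
      Nat.mul_add_div (by omega), Nat.div_eq_of_lt (by omega), add_zero]
  rw [hi, hj]
  exact hij

/-! ### Computing the curves of an Orthogonal Vectors instance -/

/-- In the following expressions, the registers 0, 2, 4 and 8 hold the number `N` of vectors, the
dimension `D`, the length `2 * D + 3` of the code words and the index of a vertex. -/
def exBlock : Ex := .op .add (.op .mul (.lit 4) (.reg 4)) (.lit 2)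

/-- Four-way case distinction on the value of `s`. -/
def exCase (s a b c d : Ex) : Ex := .ifLt s (.lit 1) a (.ifLt s (.lit 2) b (.ifLt s (.lit 3) c d))

/-- Skeleton of the expressions for the coordinates of the first curve. -/
def exFst (a0 a1 a2 a3 a4 a5 : ℕ) (e : Ex) : Ex :=
  .ifLt (.op .div (.reg 8) exBlock) (.reg 0)
    (.ifLt (.op .mod (.reg 8) exBlock) (.lit 1) (.lit a0)
      (.ifLt (.op .mod (.reg 8) exBlock) (.op .add (.op .mul (.lit 4) (.reg 4)) (.lit 1))
        (exCase (.op .mod (.op .sub (.op .mod (.reg 8) exBlock) (.lit 1)) (.lit 4))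
          e (.lit a1) (.lit a2) (.lit a3)) (.lit a4))) (.lit a5)

/-- The index of the bit in the code word, for the first curve. -/
def exBitIdx : Ex := .op .div (.op .sub (.op .mod (.reg 8) exBlock) (.lit 1)) (.lit 4)

/-- The x-coordinate of the first curve. -/
def exFstX : Ex :=
  exFst 7 7 4 7 7 7
    (.ifLt exBitIdx (.lit 2) (.lit 7) (.ifLt (.op .mod exBitIdx (.lit 2)) (.lit 1) (.lit 11)
      (.ifLt (.lit 0) (.get 0 (.op .add (.op .mul (.op .div (.reg 8) exBlock) (.reg 2))
        (.op .div (.op .sub exBitIdx (.lit 3)) (.lit 2)))) (.lit 7) (.lit 11))))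

/-- The y-coordinate of the first curve. -/
def exFstY : Ex := exFst 14 10 7 4 0 0 (.lit 7)

/-- The number of vertices of the rounds of the second curve. -/
def exRounds : Ex := .op .mul (.lit 4) (.op .mul (.reg 0) (.reg 4))

/-- Skeleton of the expressions for the coordinates of the second curve. -/
def exSnd (a0 a1 a2 a3 a4 a5 b1 b2 b3 c0 c1 c2 c3 : ℕ) (e : Ex) : Ex :=
  .ifLt (.reg 8) (.lit 1) (.lit a0) (.ifLt (.reg 8) (.lit 2) (.lit a1)
  (.ifLt (.reg 8) (.lit 3) (.lit a2) (.ifLt (.reg 8) (.lit 4) (.lit a3)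
  (.ifLt (.reg 8) (.lit 5) (.lit a4) (.ifLt (.reg 8) (.lit 6) (.lit a5)
  (.ifLt (.reg 8) (.op .add exRounds (.lit 6))
    (exCase (.op .mod (.op .sub (.reg 8) (.lit 6)) (.lit 4)) e (.lit b1) (.lit b2) (.lit b3))
  (.ifLt (.reg 8) (.op .add exRounds (.lit 7)) (.lit c0)
  (.ifLt (.reg 8) (.op .add exRounds (.lit 8)) (.lit c1)
  (.ifLt (.reg 8) (.op .add exRounds (.lit 9)) (.lit c2) (.lit c3))))))))))

/-- The index of the round of the second curve. -/
def exRound : Ex := .op .div (.op .sub (.reg 8) (.lit 6)) (.lit 4)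

/-- The x-coordinate of the second curve. -/
def exSndX : Ex :=
  exSnd 0 7 7 9 10 7 7 10 7 7 7 9 0
    (.ifLt (.op .mod exRound (.reg 4)) (.lit 2) (.lit 3)
      (.ifLt (.op .mod (.op .mod exRound (.reg 4)) (.lit 2)) (.lit 1) (.lit 7)
        (.ifLt (.lit 0) (.get 1 (.op .add (.op .mul (.op .div exRound (.reg 4)) (.reg 2))
          (.op .div (.op .sub (.op .mod exRound (.reg 4)) (.lit 3)) (.lit 2)))) (.lit 7) (.lit 3))))

/-- The y-coordinate of the second curve. -/
def exSndY : Ex := exSnd 7 2 7 7 7 10 4 7 10 12 7 7 7 (.lit 7)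

section Eval

variable {σ : State} {N D j : ℕ}

lemma exFstX_eval (h0 : σ.reg 0 = N) (h2 : σ.reg 2 = D) (h4 : σ.reg 4 = 2 * D + 3)
    (h8 : σ.reg 8 = j) : exFstX.eval σ = (curveFst N D (σ.arr 0) j).1 := by
  simp only [exFstX, exFst, exCase, exBitIdx, exBlock, Ex.eval, WordOp.eval, h0, h2, h4, h8,
    curveFst, vertFst, bitFst, apply_ite Prod.fst]
  generalize j / (4 * (2 * D + 3) + 2) = a
  generalize j % (4 * (2 * D + 3) + 2) = r
  congr 4
  generalize (r - 1) / 4 = k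
  split_ifs <;> simp_all

lemma exFstY_eval (h0 : σ.reg 0 = N) (h4 : σ.reg 4 = 2 * D + 3) (h8 : σ.reg 8 = j) :
    exFstY.eval σ = (curveFst N D (σ.arr 0) j).2 := by
  simp only [exFstY, exFst, exCase, exBlock, Ex.eval, WordOp.eval, h0, h4, h8,
    curveFst, vertFst, apply_ite Prod.snd]

lemma exSndX_eval (h0 : σ.reg 0 = N) (h2 : σ.reg 2 = D) (h4 : σ.reg 4 = 2 * D + 3)
    (h8 : σ.reg 8 = j) : exSndX.eval σ = (curveSnd N D (σ.arr 1) j).1 := by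
  simp only [exSndX, exSnd, exCase, exRounds, exRound, Ex.eval, WordOp.eval, h0, h2, h4, h8,
    curveSnd, vertSnd, bitSnd, apply_ite Prod.fst]
  congr 8
  generalize (j - 6) / 4 = k
  split_ifs <;> simp_all

lemma exSndY_eval (h0 : σ.reg 0 = N) (h4 : σ.reg 4 = 2 * D + 3) (h8 : σ.reg 8 = j) :
    exSndY.eval σ = (curveSnd N D (σ.arr 1) j).2 := by
  simp only [exSndY, exSnd, exCase, exRounds, Ex.eval, WordOp.eval, h0, h4, h8,
    curveSnd, vertSnd, apply_ite Prod.snd]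

end Eval

/-- The expression is compiled correctly in every memory with small words. -/
structure Ex.Good (e : Ex) : Prop where
  clean : e.Clean
  poly : e.Poly

lemma exFstX_good : exFstX.Good := by
  constructor <;> simp [exFstX, exFst, exCase, exBitIdx, exBlock, Ex.Clean, Ex.Poly, IsScr]

lemma exFstY_good : exFstY.Good := by
  constructor <;> simp [exFstY, exFst, exCase, exBlock, Ex.Clean, Ex.Poly, IsScr]

lemma exSndX_good : exSndX.Good := by
  constructor <;> simp [exSndX, exSnd, exCase, exRounds, exRound, Ex.Clean, Ex.Poly, IsScr]

lemma exSndY_good : exSndY.Good := by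
  constructor <;> simp [exSndY, exSnd, exCase, exRounds, Ex.Clean, Ex.Poly, IsScr]

lemma Ex.ok_setArr {W a : ℕ} (e : Ex) (he : e.NoGet a) (σ : State) (F : ℕ → ℕ) (h : e.Ok W σ) :
    e.Ok W (σ.setArr a F) := by
  induction e with
  | lit c => exact h
  | reg r => exact h
  | op o x y ihx ihy =>
    exact ⟨ihx he.1 h.1, ihy he.2 h.2.1, by
      rw [State.setArr, Ex.eval_noGet x he.1, Ex.eval_noGet y he.2]; exact h.2.2⟩
  | get b x ih =>
    refine ⟨ih he.2 h.1, ?_⟩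
    rw [State.setArr, Ex.eval_noGet x he.2]
    simpa [Function.update_of_ne he.1] using h.2
  | ifLt x y z w ihx ihy ihz ihw =>
    exact ⟨ihx he.1 h.1, ihy he.2.1 h.2.1, ihz he.2.2.1 h.2.2.1, ihw he.2.2.2 h.2.2.2⟩

lemma Ex.eval_setRarr {a : ℕ} (e : Ex) (σ : State) (F : ℕ → ℝ) :
    e.eval (σ.setRarr a F) = e.eval σ := by
  induction e with
  | lit c => rfl
  | reg r => rfl
  | op o x y ihx ihy => simp [Ex.eval, ihx, ihy]
  | get x e ih => simp only [Ex.eval, ih]; rfl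
  | ifLt x y z w ihx ihy ihz ihw => simp [Ex.eval, ihx, ihy, ihz, ihw]

lemma Ex.ok_setRarr {W a : ℕ} (e : Ex) (σ : State) (F : ℕ → ℝ) (h : e.Ok W σ) :
    e.Ok W (σ.setRarr a F) := by
  induction e with
  | lit c => exact h
  | reg r => exact h
  | op o x y ihx ihy =>
    exact ⟨ihx h.1, ihy h.2.1, by rw [Ex.eval_setRarr, Ex.eval_setRarr]; exact h.2.2⟩
  | get b x ih => exact ⟨ih h.1, by rw [Ex.eval_setRarr]; exact h.2⟩
  | ifLt x y z w ihx ihy ihz ihw => exact ⟨ihx h.1, ihy h.2.1, ihz h.2.2.1, ihw h.2.2.2⟩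

lemma WB.set {V : ℕ} {σ : State} (h : WB V σ) (x : ℕ) {v : ℕ} (hv : v ≤ V) : WB V (σ.set x v) := by
  refine ⟨fun r => ?_, h.2⟩
  by_cases hr : r = x
  · subst hr; simpa [State.set] using hv
  · simpa [State.set, Function.update_of_ne hr] using h.1 r

lemma WB.setArr {V : ℕ} {σ : State} (h : WB V σ) (a : ℕ) {F : ℕ → ℕ} (hF : ∀ x, F x ≤ V) :
    WB V (σ.setArr a F) := by
  refine ⟨h.1, fun b x => ?_⟩
  by_cases hb : b = a
  · subst hb; simpa [State.setArr] using hF x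
  · simpa [State.setArr, Function.update_of_ne hb] using h.2 b x

lemma WB.mono {V V' : ℕ} {σ : State} (h : WB V σ) (hV : V ≤ V') : WB V' σ :=
  ⟨fun r => (h.1 r).trans hV, fun a x => (h.2 a x).trans hV⟩

lemma runs_assign_good {V W : ℕ} {σ : State} {e : Ex} {x : ℕ} (hV : 2 ≤ V) (hσ : WB V σ)
    (he : e.Good) (hW : V ^ e.deg ≤ W) {Q : State → Prop} (hQ : Q (σ.set x (e.eval σ))) :
    Runs W (assign x e) σ (e.cost + 1) Q :=
  runs_assign he.clean (e.ok_of_deg hV hσ he.poly hW) hQ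

section Build

variable {N D : ℕ}

/-- The number of vertices, from the registers 0 and 4. -/
def exLength : Ex :=
  .op .add (.op .mul (.reg 0) exBlock) (.lit 10)

/-- The program computing the coordinates of both curves, into four consecutive arrays. -/
def buildCurves (put : ℕ → Ex → Ex → Prog) (o : ℕ) : Prog :=
  .seq (assign 2 (.reg 1)) (.seq (assign 4 (.op .add (.op .mul (.lit 2) (.reg 2)) (.lit 3)))
    (.seq (assign 1 exLength) (.seq (assign 6 (.reg 1))
      (.seq (fill put o exFstX) (.seq (fill put (o + 1) exFstY)
        (.seq (fill put (o + 2) exSndX) (fill put (o + 3) exSndY)))))))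

/-- The four coordinate tables of the curves. -/
def coordTable (N D : ℕ) (A B : ℕ → ℕ) (a x : ℕ) : ℕ :=
  if a = 0 then (curveFst N D A x).1 else if a = 1 then (curveFst N D A x).2
  else if a = 2 then (curveSnd N D B x).1 else if a = 3 then (curveSnd N D B x).2 else 0

lemma coordTable_le (hN : 0 < N) (A B : ℕ → ℕ) (a x : ℕ) :
    coordTable N D A B a x ≤ curveLength N D := by
  have h := curve_le (D := D) hN A B x
  unfold coordTable
  split_ifs
  exacts [h.1, h.2.1, h.2.2.1, h.2.2.2, Nat.zero_le _]

/-- The memory while the curves are being computed, apart from the tables. -/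
structure BuildState (N D : ℕ) (A B : ℕ → ℕ) (σ : State) : Prop where
  r0 : σ.reg 0 = N
  r1 : σ.reg 1 = curveLength N D
  r2 : σ.reg 2 = D
  r4 : σ.reg 4 = 2 * D + 3
  r6 : σ.reg 6 = curveLength N D
  odd : ∀ r, 1 ≤ r → σ.reg (2 * r + 1) = 0
  a0 : σ.arr 0 = A
  a1 : σ.arr 1 = B
  rr : ∀ r, σ.rreg (2 * r + 1) = 0
  wb : WB (curveLength N D) σ

variable {A B : ℕ → ℕ} {σ : State}

lemma BuildState.set8 (h : BuildState N D A B σ) {x : ℕ} (hx : x ≤ curveLength N D) :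
    BuildState N D A B (σ.set 8 x) where
  r0 := by simpa [State.set] using h.r0
  r1 := by simpa [State.set] using h.r1
  r2 := by simpa [State.set] using h.r2
  r4 := by simpa [State.set] using h.r4
  r6 := by simpa [State.set] using h.r6
  odd r hr := by
    rw [State.set, ← h.odd r hr]; exact Function.update_of_ne (by omega) _ _
  a0 := h.a0
  a1 := h.a1
  rr := h.rr
  wb := h.wb.set 8 hx

lemma BuildState.setArr (h : BuildState N D A B σ) {a : ℕ} (ha : 2 ≤ a) {F : ℕ → ℕ}
    (hF : ∀ x, F x ≤ curveLength N D) : BuildState N D A B (σ.setArr a F) where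
  r0 := h.r0
  r1 := h.r1
  r2 := h.r2
  r4 := h.r4
  r6 := h.r6
  odd := h.odd
  a0 := by rw [State.setArr, ← h.a0]; exact Function.update_of_ne (by omega) _ _
  a1 := by rw [State.setArr, ← h.a1]; exact Function.update_of_ne (by omega) _ _
  rr := h.rr
  wb := h.wb.setArr a hF

lemma BuildState.setRarr (h : BuildState N D A B σ) {a : ℕ} {F : ℕ → ℝ} :
    BuildState N D A B (σ.setRarr a F) :=
  ⟨h.r0, h.r1, h.r2, h.r4, h.r6, h.odd, h.a0, h.a1, h.rr, h.wb⟩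

/-- The first `j` tables have been written to word arrays. -/
def WordTables (N D : ℕ) (A B : ℕ → ℕ) (j : ℕ) (σ : State) : Prop :=
  BuildState N D A B σ ∧
    (∀ a x, σ.arr (a + 2) x =
      if a < j ∧ x < curveLength N D then coordTable N D A B a x else 0) ∧
    ∀ a x, σ.rarr a x = 0

/-- The first `j` tables have been written to real arrays. -/
def RealTables (N D : ℕ) (A B : ℕ → ℕ) (j : ℕ) (σ : State) : Prop :=
  BuildState N D A B σ ∧ (∀ a x, σ.arr (a + 2) x = 0) ∧
    ∀ a x, σ.rarr a x =
      if a < j ∧ x < curveLength N D then (coordTable N D A B a x : ℝ) else 0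

lemma two_le_curveLength (N D : ℕ) : 2 ≤ curveLength N D := by unfold curveLength; omega

lemma runs_fill_word (hN : 0 < N) {W j : ℕ} {e : Ex} (he : e.Good) (hg : e.NoGet (j + 2))
    (hW : curveLength N D ^ e.deg ≤ W) (hnW : curveLength N D ≤ W)
    (heval : ∀ σ x, BuildState N D A B σ → e.eval (σ.set 8 x) = coordTable N D A B j x)
    (hσ : WordTables N D A B j σ) :
    Runs W (fill wput (j + 2) e) σ (curveLength N D * (e.cost + 7) + 3)
      (WordTables N D A B (j + 1)) := by
  have hn2 := two_le_curveLength N D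
  obtain ⟨h1, h2, h3⟩ := hσ
  have hF : (fun x => if x < curveLength N D then e.eval (σ.set 8 x) else σ.arr (j + 2) x) =
      fun x => if x < curveLength N D then coordTable N D A B j x else 0 := by
    funext x
    rw [heval σ x h1, h2]; simp
  refine runs_fill hnW (by omega) h1.r6 he.clean hg (fun k hk => ?_)
    (fun σ F => e.ok_setArr hg σ F) ?_
  · exact e.ok_of_deg hn2 (h1.wb.set 8 hk.le) he.poly hW
  · rw [hF]
    refine ⟨(h1.set8 le_rfl).setArr (by omega) fun x => ?_, fun a x => ?_, h3⟩
    · split_ifs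
      exacts [coordTable_le hN A B j x, Nat.zero_le _]
    · by_cases ha : a = j
      · subst ha; simp [State.setArr]
      · have e1 : a < j + 1 ↔ a < j := by omega
        simp only [e1]
        rw [← h2 a x]
        simp [State.setArr, State.set, Function.update_of_ne (show a + 2 ≠ j + 2 by omega)]

lemma runs_fill_real {W j : ℕ} {e : Ex} (he : e.Good)
    (hW : curveLength N D ^ e.deg ≤ W) (hnW : curveLength N D ≤ W)
    (heval : ∀ σ x, BuildState N D A B σ → e.eval (σ.set 8 x) = coordTable N D A B j x)
    (hσ : RealTables N D A B j σ) :
    Runs W (fill rput j e) σ (curveLength N D * (e.cost + 8) + 3) (RealTables N D A B (j + 1)) := by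
  have hn2 := two_le_curveLength N D
  obtain ⟨h1, h2, h3⟩ := hσ
  have hF : (fun x => if x < curveLength N D then (e.eval (σ.set 8 x) : ℝ) else σ.rarr j x) =
      fun x => if x < curveLength N D then (coordTable N D A B j x : ℝ) else 0 := by
    funext x
    rw [heval σ x h1, h3]; simp
  refine runs_rfill hnW (by omega) h1.r6 he.clean (fun k hk => ?_)
    (fun σ F => e.ok_setRarr σ F) (fun σ F => e.eval_setRarr σ F) ?_
  · exact e.ok_of_deg hn2 (h1.wb.set 8 hk.le) he.poly hW
  · rw [hF]
    refine ⟨(h1.set8 le_rfl).setRarr, h2, fun a x => ?_⟩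
    by_cases ha : a = j
    · subst ha; simp [State.setRarr]
    · have e1 : a < j + 1 ↔ a < j := by omega
      simp only [e1]
      rw [← h3 a x]
      simp [State.setRarr, State.set, Function.update_of_ne ha]

lemma eval_table0 (σ : State) (x : ℕ) (h : BuildState N D A B σ) :
    exFstX.eval (σ.set 8 x) = coordTable N D A B 0 x := by
  rw [exFstX_eval (N := N) (D := D) (j := x) (by simpa [State.set] using h.r0)
    (by simpa [State.set] using h.r2) (by simpa [State.set] using h.r4) (by simp [State.set])]
  simp [coordTable, State.set, h.a0]

lemma eval_table1 (σ : State) (x : ℕ) (h : BuildState N D A B σ) :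
    exFstY.eval (σ.set 8 x) = coordTable N D A B 1 x := by
  rw [exFstY_eval (N := N) (D := D) (j := x) (by simpa [State.set] using h.r0)
    (by simpa [State.set] using h.r4) (by simp [State.set])]
  simp [coordTable, State.set, h.a0]

lemma eval_table2 (σ : State) (x : ℕ) (h : BuildState N D A B σ) :
    exSndX.eval (σ.set 8 x) = coordTable N D A B 2 x := by
  rw [exSndX_eval (N := N) (D := D) (j := x) (by simpa [State.set] using h.r0)
    (by simpa [State.set] using h.r2) (by simpa [State.set] using h.r4) (by simp [State.set])]
  simp [coordTable, State.set, h.a1]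

lemma eval_table3 (σ : State) (x : ℕ) (h : BuildState N D A B σ) :
    exSndY.eval (σ.set 8 x) = coordTable N D A B 3 x := by
  rw [exSndY_eval (N := N) (D := D) (j := x) (by simpa [State.set] using h.r0)
    (by simpa [State.set] using h.r4) (by simp [State.set])]
  simp [coordTable, State.set, h.a1]

/-- The constant of the degree bounds and of the running time of `buildCurves`. -/
def buildConst : ℕ :=
  exFstX.deg + exFstY.deg + exSndX.deg + exSndY.deg + exLength.deg +
    exFstX.cost + exFstY.cost + exSndX.cost + exSndY.cost + exLength.cost + 60

lemma le_pow_of_le {V W K k : ℕ} (hV : 2 ≤ V) (hW : V ^ K ≤ W) (hk : k ≤ K) : V ^ k ≤ W :=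
  (Nat.pow_le_pow_right (by omega) hk).trans hW

lemma ovInput_wb {N D : ℕ} (hN : 0 < N) (hD : 0 < D) (U V : Fin N → Fin D → Bool) :
    WB (N * D + 1) (ovInput U V) := by
  have h1 : N ≤ N * D := Nat.le_mul_of_pos_right _ hD
  have h2 : D ≤ N * D := Nat.le_mul_of_pos_left _ hN
  refine ⟨fun r => ?_, fun a x => ?_⟩
  · simp only [ovInput]; split_ifs <;> omega
  · have hb : ∀ b : Bool, b.toNat ≤ N * D + 1 := fun b => (Bool.toNat_le b).trans (by omega)
    simp only [ovInput]
    split_ifs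
    exacts [hb _, hb _, Nat.zero_le _, Nat.zero_le _]

/-- The preparation of the registers. -/
lemma runs_prepare {N D : ℕ} (hN : 0 < N) (hD : 0 < D) (U V : Fin N → Fin D → Bool) {W T : ℕ}
    {p : Prog} (hW : curveLength N D ^ buildConst ≤ W) {Q : State → Prop}
    (h : ∀ σ, BuildState N D ((ovInput U V).arr 0) ((ovInput U V).arr 1) σ →
      (∀ a x, σ.arr (a + 2) x = 0) → (∀ a x, σ.rarr a x = 0) → Runs W p σ T Q) :
    Runs W (.seq (assign 2 (.reg 1))
      (.seq (assign 4 (.op .add (.op .mul (.lit 2) (.reg 2)) (.lit 3)))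
        (.seq (assign 1 exLength) (.seq (assign 6 (.reg 1)) p)))) (ovInput U V)
      (T + exLength.cost + 20) Q := by
  have hn2 := two_le_curveLength N D
  have hmul : 1 * (2 * D + 3) ≤ N * (2 * D + 3) := Nat.mul_le_mul_right _ hN
  have e1 : curveLength N D = 4 * (N * (2 * D + 3)) + 2 * N + 10 := by unfold curveLength; ring
  have e2 : N * (2 * D + 3) = 2 * (N * D) + 3 * N := by ring
  have wb0 : WB (curveLength N D) (ovInput U V) := (ovInput_wb hN hD U V).mono (by omega)
  have w1 := wb0.set 2 (v := D) (by omega)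
  have w2 := w1.set 4 (v := 2 * D + 3) (by omega)
  have w3 := w2.set 1 (v := curveLength N D) le_rfl
  have w4 := w3.set 6 (v := curveLength N D) le_rfl
  have hle : ∀ k ≤ buildConst, curveLength N D ^ k ≤ W := fun k hk => le_pow_of_le hn2 hW hk
  refine Runs.mono (Runs.seq (T := 2) (T' := T + exLength.cost + 18)
    (Q := fun σ => σ = (ovInput U V).set 2 D) ?_ ?_) (by omega) (fun _ h => h)
  · refine runs_assign_good (e := .reg 1) hn2 wb0 ⟨by simp [Ex.Clean, IsScr], trivial⟩
      (hle _ (by simp only [Ex.deg, buildConst]; omega)) ?_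
    simp [Ex.eval, ovInput]
  rintro _ rfl
  refine Runs.mono (Runs.seq (T := 6) (T' := T + exLength.cost + 6)
    (Q := fun σ => σ = ((ovInput U V).set 2 D).set 4 (2 * D + 3)) ?_ ?_) (by omega) (fun _ h => h)
  · refine runs_assign_good (e := .op .add (.op .mul (.lit 2) (.reg 2)) (.lit 3)) hn2 w1
      ⟨by simp [Ex.Clean, IsScr], by simp [Ex.Poly]⟩
      (hle _ (by simp only [Ex.deg, buildConst]; omega)) ?_
    simp [Ex.eval, State.set, WordOp.eval]
  rintro _ rfl
  refine Runs.mono (Runs.seq (T := exLength.cost + 1) (T' := T + 2)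
    (Q := fun σ => σ = (((ovInput U V).set 2 D).set 4 (2 * D + 3)).set 1 (curveLength N D)) ?_ ?_)
    (by omega) (fun _ h => h)
  · refine runs_assign_good (e := exLength) hn2 w2
      ⟨by simp [exLength, exBlock, Ex.Clean, IsScr], by simp [exLength, exBlock, Ex.Poly]⟩
      (hle _ (by simp only [buildConst]; omega)) ?_
    simp [Ex.eval, State.set, WordOp.eval, exLength, exBlock, ovInput, curveLength]
  rintro _ rfl
  refine Runs.mono (Runs.seq (T := 2) (T' := T)
    (Q := fun σ => σ = ((((ovInput U V).set 2 D).set 4 (2 * D + 3)).set 1 (curveLength N D)).set 6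
      (curveLength N D)) ?_ ?_) (by omega) (fun _ h => h)
  · refine runs_assign_good (e := .reg 1) hn2 w3 ⟨by simp [Ex.Clean, IsScr], trivial⟩
      (hle _ (by simp only [Ex.deg, buildConst]; omega)) ?_
    simp [Ex.eval, State.set]
  rintro _ rfl
  refine h _ ⟨?_, ?_, ?_, ?_, ?_, fun r hr => ?_, rfl, rfl, fun _ => rfl, w4⟩ ?_ (fun _ _ => rfl)
  · simp [State.set, ovInput]
  · simp [State.set]
  · simp [State.set]
  · simp [State.set]
  · simp [State.set]
  · have : 2 * r + 1 ≠ 1 := by omega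
    have h2 : 2 * r + 1 ≠ 2 := by omega
    have h4 : 2 * r + 1 ≠ 4 := by omega
    have h6 : 2 * r + 1 ≠ 6 := by omega
    simp only [State.set, Function.update_of_ne this, Function.update_of_ne h2,
      Function.update_of_ne h4, Function.update_of_ne h6, ovInput]
    simp; omega
  · intro a x
    simp [State.set, ovInput]

lemma buildConst_pos : 60 ≤ buildConst := by unfold buildConst; omega

/-- The word RAM computes the curves in linear time. -/
lemma runs_buildCurves_word {N D : ℕ} (hN : 0 < N) (hD : 0 < D) (U V : Fin N → Fin D → Bool)
    {W : ℕ} (hW : curveLength N D ^ buildConst ≤ W) :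
    Runs W (buildCurves wput 2) (ovInput U V) (curveLength N D * (2 * buildConst))
      (WordTables N D ((ovInput U V).arr 0) ((ovInput U V).arr 1) 4) := by
  have hn2 := two_le_curveLength N D
  have hc := buildConst_pos
  have hle : ∀ k ≤ buildConst, curveLength N D ^ k ≤ W := fun k hk => le_pow_of_le hn2 hW hk
  have hnW : curveLength N D ≤ W := by simpa using hle 1 (by omega)
  refine Runs.mono (runs_prepare hN hD U V (W := W) hW fun σ hσ ha hr =>
    Runs.seq (runs_fill_word (j := 0) hN exFstX_good ?_ (hle _ ?_) hnW eval_table0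
      ⟨hσ, by simpa using ha, hr⟩) fun σ hσ =>
    Runs.seq (runs_fill_word (j := 1) hN exFstY_good ?_ (hle _ ?_) hnW eval_table1 hσ) fun σ hσ =>
    Runs.seq (runs_fill_word (j := 2) hN exSndX_good ?_ (hle _ ?_) hnW eval_table2 hσ) fun σ hσ =>
      runs_fill_word (j := 3) hN exSndY_good ?_ (hle _ ?_) hnW eval_table3 hσ) ?_ (fun _ h => h)
  · simp [exFstX, exFst, exCase, exBitIdx, exBlock, Ex.NoGet]
  · unfold buildConst; omega
  · simp [exFstY, exFst, exCase, exBlock, Ex.NoGet]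
  · unfold buildConst; omega
  · simp [exSndX, exSnd, exCase, exRounds, exRound, Ex.NoGet]
  · unfold buildConst; omega
  · simp [exSndY, exSnd, exCase, exRounds, Ex.NoGet]
  · unfold buildConst; omega
  · obtain ⟨r, hr, hr'⟩ : ∃ r, 2 * buildConst = (exFstX.cost + 7) + (exFstY.cost + 7) +
        (exSndX.cost + 7) + (exSndY.cost + 7) + r ∧ exLength.cost + 40 ≤ r :=
      ⟨2 * buildConst - exFstX.cost - exFstY.cost - exSndX.cost - exSndY.cost - 28,
        by unfold buildConst; omega, by unfold buildConst; omega⟩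
    have e' : 1 * r ≤ curveLength N D * r := Nat.mul_le_mul_right _ (by omega)
    rw [hr]
    simp only [mul_add] at *
    omega

/-- The real RAM computes the curves in linear time. -/
lemma runs_buildCurves_real {N D : ℕ} (hN : 0 < N) (hD : 0 < D) (U V : Fin N → Fin D → Bool)
    {W : ℕ} (hW : curveLength N D ^ buildConst ≤ W) :
    Runs W (buildCurves rput 0) (ovInput U V) (curveLength N D * (2 * buildConst))
      (RealTables N D ((ovInput U V).arr 0) ((ovInput U V).arr 1) 4) := by
  have hn2 := two_le_curveLength N D
  have hc := buildConst_pos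
  have hle : ∀ k ≤ buildConst, curveLength N D ^ k ≤ W := fun k hk => le_pow_of_le hn2 hW hk
  have hnW : curveLength N D ≤ W := by simpa using hle 1 (by omega)
  refine Runs.mono (runs_prepare hN hD U V (W := W) hW fun σ hσ ha hr =>
    Runs.seq (runs_fill_real (j := 0) exFstX_good (hle _ ?_) hnW eval_table0
      ⟨hσ, ha, by simpa using hr⟩) fun σ hσ =>
    Runs.seq (runs_fill_real (j := 1) exFstY_good (hle _ ?_) hnW eval_table1 hσ) fun σ hσ =>
    Runs.seq (runs_fill_real (j := 2) exSndX_good (hle _ ?_) hnW eval_table2 hσ) fun σ hσ =>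
      runs_fill_real (j := 3) exSndY_good (hle _ ?_) hnW eval_table3 hσ) ?_ (fun _ h => h)
  · unfold buildConst; omega
  · unfold buildConst; omega
  · unfold buildConst; omega
  · unfold buildConst; omega
  · obtain ⟨r, hr, hr'⟩ : ∃ r, 2 * buildConst = (exFstX.cost + 8) + (exFstY.cost + 8) +
        (exSndX.cost + 8) + (exSndY.cost + 8) + r ∧ exLength.cost + 40 ≤ r :=
      ⟨2 * buildConst - exFstX.cost - exFstY.cost - exSndX.cost - exSndY.cost - 32,
        by unfold buildConst; omega, by unfold buildConst; omega⟩
    have e' : 1 * r ≤ curveLength N D * r := Nat.mul_le_mul_right _ (by omega)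
    rw [hr]
    simp only [mul_add] at *
    omega

end Build

/-! ### From the flipped Fréchet measure to Orthogonal Vectors -/

/-- The curves of an instance, as an input for the machine model. -/
noncomputable def ovCurves : (M : Model) → {N D : ℕ} → 0 < N → (ℕ → ℕ) → (ℕ → ℕ) →
    CurveInput (curveLength N D) M
  | .wordRAM, N, D, hN, A, B => ⟨(curveFst N D A, curveSnd N D B), fun i _ => curve_le hN A B i⟩
  | .realRAM, N, D, _, A, B => (crv (curveFst N D A), crv (curveSnd N D B))

lemma ovCurves_fst (M : Model) {N D : ℕ} (hN : 0 < N) (A B : ℕ → ℕ) :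
    (ovCurves M (D := D) hN A B).fst = crv (curveFst N D A) := by cases M <;> rfl

lemma ovCurves_snd (M : Model) {N D : ℕ} (hN : 0 < N) (A B : ℕ → ℕ) :
    (ovCurves M (D := D) hN A B).snd = crv (curveSnd N D B) := by cases M <;> rfl

/-- The program that computes the curves on the given model. -/
def buildProg : Model → Prog
  | .wordRAM => buildCurves wput 2
  | .realRAM => buildCurves rput 0

lemma buildProg_for (M : Model) : (buildProg M).For M := by
  cases M
  · simp [buildProg, buildCurves, Prog.For, Prog.WordOnly, assign, fill, countLoop, wput,
      Ex.code_wordOnly, Instr.WordOnly, Cond.WordOnly]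
  · trivial

lemma subReg_eq {N D : ℕ} {A B : ℕ → ℕ} {σ : State} (h : BuildState N D A B σ) :
    (fun r => σ.reg (2 * r + 1)) = fun r => if r = 0 then curveLength N D else 0 := by
  funext r
  rcases r with _ | r
  · simpa using h.r1
  · simpa using h.odd (r + 1) (by omega)

lemma subState_word {N D : ℕ} (hN : 0 < N) {A B : ℕ → ℕ} {σ : State}
    (h : WordTables N D A B 4 σ) : subState σ = (ovCurves .wordRAM (D := D) hN A B).state := by
  obtain ⟨h1, h2, h3⟩ := h
  have e2 : (fun a => σ.arr (a + 2)) = fun a x =>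
      if x < curveLength N D then coordTable N D A B a x else 0 := by
    funext a x
    rw [h2]
    by_cases ha : a < 4
    · simp [ha]
    · have : coordTable N D A B a x = 0 := by
        unfold coordTable
        rw [if_neg (by omega), if_neg (by omega), if_neg (by omega), if_neg (by omega)]
      simp [ha, this]
  have e3 : σ.rarr = fun _ _ => 0 := funext fun a => funext fun x => h3 a x
  have e4 : (fun r => σ.rreg (2 * r + 1)) = fun _ => 0 := funext h1.rr
  unfold subState
  rw [subReg_eq h1, e2, e3, e4]
  rfl

lemma subState_real {N D : ℕ} (hN : 0 < N) {A B : ℕ → ℕ} {σ : State}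
    (h : RealTables N D A B 4 σ) : subState σ = (ovCurves .realRAM (D := D) hN A B).state := by
  obtain ⟨h1, h2, h3⟩ := h
  have e2 : (fun a => σ.arr (a + 2)) = fun _ _ => 0 := funext fun a => funext fun x => h2 a x
  have e3 : σ.rarr = fun a x => if x < curveLength N D then
      if a = 0 then crv (curveFst N D A) x 0 else if a = 1 then crv (curveFst N D A) x 1
      else if a = 2 then crv (curveSnd N D B) x 0 else if a = 3 then crv (curveSnd N D B) x 1
      else 0 else 0 := by
    funext a x
    rw [h3]
    by_cases hx : x < curveLength N D
    · rcases a with _ | _ | _ | _ | a <;> simp [hx, coordTable, gridPoint]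
    · simp [hx]
  have e4 : (fun r => σ.rreg (2 * r + 1)) = fun _ => 0 := funext h1.rr
  unfold subState
  rw [subReg_eq h1, e2, e3, e4]
  rfl

lemma runs_buildProg (M : Model) {N D : ℕ} (hN : 0 < N) (hD : 0 < D)
    (U V : Fin N → Fin D → Bool) {W : ℕ} (hW : curveLength N D ^ buildConst ≤ W) :
    Runs W (buildProg M) (ovInput U V) (curveLength N D * (2 * buildConst))
      (fun σ => BuildState N D ((ovInput U V).arr 0) ((ovInput U V).arr 1) σ ∧
        subState σ =
          (ovCurves M (D := D) hN ((ovInput U V).arr 0) ((ovInput U V).arr 1)).state) := by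
  cases M
  · exact (runs_buildCurves_word hN hD U V hW).mono le_rfl fun σ h => ⟨h.1, subState_word hN h⟩
  · exact (runs_buildCurves_real hN hD U V hW).mono le_rfl fun σ h => ⟨h.1, subState_real hN h⟩

lemma mul_add_div_mod {k d D : ℕ} (hd : d < D) : (k * D + d) / D = k ∧ (k * D + d) % D = d := by
  rw [mul_comm, Nat.mul_add_div (by omega), Nat.div_eq_of_lt hd, Nat.mul_add_mod,
    Nat.mod_eq_of_lt hd]
  simp

lemma exists_orthAt_iff {N D : ℕ} (U V : Fin N → Fin D → Bool) :
    (∃ i j, OrthAt N D ((ovInput U V).arr 0) ((ovInput U V).arr 1) i j) ↔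
      HasOrthogonalPair U V := by
  have hA : ∀ i : Fin N, ∀ d : Fin D,
      (0 < (ovInput U V).arr 0 (i * D + d) ↔ U i d = true) := by
    intro i d
    obtain ⟨h1, h2⟩ := mul_add_div_mod (k := i) d.2
    simp only [ovInput, h1, h2]
    rw [dif_pos ⟨i.2, d.2⟩]
    cases U i d <;> simp
  have hB : ∀ i : Fin N, ∀ d : Fin D,
      (0 < (ovInput U V).arr 1 (i * D + d) ↔ V i d = true) := by
    intro i d
    obtain ⟨h1, h2⟩ := mul_add_div_mod (k := i) d.2
    simp only [ovInput, h1, h2]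
    rw [dif_pos ⟨i.2, d.2⟩]
    cases V i d <;> simp
  constructor
  · rintro ⟨i, j, hi, hj, h⟩
    refine ⟨⟨i, hi⟩, ⟨j, hj⟩, fun d hd => h d d.2 ?_⟩
    exact ⟨(hA ⟨i, hi⟩ d).2 hd.1, (hB ⟨j, hj⟩ d).2 hd.2⟩
  · rintro ⟨i, j, h⟩
    refine ⟨i, j, i.2, j.2, fun d hd hc => h ⟨d, hd⟩ ?_⟩
    exact ⟨(hA i ⟨d, hd⟩).1 hc.1, (hB j ⟨d, hd⟩).1 hc.2⟩

/-- The memory after the run of an algorithm for curves. -/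
structure AfterRun (N D V : ℕ) (A B : ℕ → ℕ) (σ : State) : Prop where
  r0 : σ.reg 0 = N
  r2 : σ.reg 2 = D
  r4 : σ.reg 4 = 2 * D + 3
  a0 : σ.arr 0 = A
  a1 : σ.arr 1 = B
  wb : WB V σ

lemma ovCurves_wb (M : Model) {N D : ℕ} (hN : 0 < N) (A B : ℕ → ℕ) :
    WB (curveLength N D) (ovCurves M (D := D) hN A B).state := by
  cases M
  · refine ⟨fun r => ?_, fun a x => ?_⟩
    · simp only [CurveInput.state]; split_ifs <;> simp
    · exact ite_ind (p := fun z => z ≤ curveLength N D)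
        (fun _ => coordTable_le hN A B a x) fun _ => Nat.zero_le _
  · refine ⟨fun r => ?_, fun a x => Nat.zero_le _⟩
    simp only [CurveInput.state]; split_ifs <;> simp

lemma curveLength_le {N D : ℕ} (hN : 0 < N) (hD : 0 < D) : curveLength N D ≤ 32 * (N * D) := by
  have h1 : N * 1 ≤ N * D := Nat.mul_le_mul_left _ hD
  unfold curveLength
  have : N * (4 * (2 * D + 3) + 2) = 8 * (N * D) + 14 * N := by ring
  omega

lemma curveLength_succ_le {N D : ℕ} (hN : 0 < N) (hD : 0 < D) :
    curveLength N D + 1 ≤ (N * D + 1) ^ 6 := by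
  have h1 := curveLength_le hN hD
  have h2 : 0 < N * D := Nat.mul_pos hN hD
  have h3 : 2 ^ 5 ≤ (N * D + 1) ^ 5 := Nat.pow_le_pow_left (by omega) 5
  have h4 : 2 ^ 5 * (N * D + 1) ≤ (N * D + 1) ^ 5 * (N * D + 1) := Nat.mul_le_mul_right _ h3
  rw [pow_succ]
  omega

/-- Orthogonal Vectors by means of an algorithm `p` for curves, and a program `post` that finds the
answer in the output of `p`. -/
lemma ovSolvable_of_curves {M : Model} {δ : ℝ} (hδ0 : 0 < δ) (hδ1 : δ ≤ 1) (p post : Prog)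
    (hp : p.For M) (hpost : post.For M) (C : ℝ) (κ E : ℕ)
    (h : ∀ N D (hN : 0 < N), 0 < D → ∀ A B : ℕ → ℕ, ∃ (t tm : ℕ) (s : State),
      Exec ((curveLength N D + 1) ^ κ) p (ovCurves M (D := D) hN A B).state t s ∧
      (t : ℝ) + tm ≤ C * D * (curveLength N D : ℝ) ^ (2 - δ) ∧
      ∀ W σ, AfterRun N D ((curveLength N D + 1) ^ (κ + 1)) A B σ → subState σ = s →
        ((curveLength N D + 1) ^ (κ + 1)) ^ E ≤ W →
        Runs W post σ tm (fun σ => σ.reg 0 = 1 ↔ ∃ i j, OrthAt N D A B i j)) :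
    OVSolvable M δ := by
  refine ⟨.seq (buildProg M) (.seq p.sub post), (2 * buildConst + |C|) * 1024, 3,
    6 * ((κ + 1) * (E + buildConst)), ?_, ?_⟩
  · have h1 := buildProg_for M
    have h2 := Prog.sub_for hp
    cases M
    · exact ⟨h1, h2, hpost⟩
    · trivial
  intro N D hN hD U V
  obtain ⟨t, tm, s, hex, htime, hrun⟩ := h N D hN hD ((ovInput U V).arr 0) ((ovInput U V).arr 1)
  set n := curveLength N D with hn
  have hn1 : 1 ≤ n := curveLength_pos N D
  -- the factor 6 of the exponent is that of `curveLength_succ_le`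
  obtain ⟨W, hWdef⟩ : ∃ W, W = (N * D + 1) ^ (6 * ((κ + 1) * (E + buildConst))) := ⟨_, rfl⟩
  have hW : (n + 1) ^ ((κ + 1) * (E + buildConst)) ≤ W := by
    rw [hWdef, pow_mul (N * D + 1) 6]
    exact Nat.pow_le_pow_left (curveLength_succ_le hN hD) _
  have hWle : ∀ k ≤ (κ + 1) * (E + buildConst), (n + 1) ^ k ≤ W := fun k hk =>
    le_pow_of_le (by omega) hW hk
  have hbc := buildConst_pos
  have hmain : Runs W (.seq (buildProg M) (.seq p.sub post)) (ovInput U V)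
      (n * (2 * buildConst) + (t + tm)) (fun σ => σ.reg 0 = 1 ↔ HasOrthogonalPair U V) := by
    refine Runs.seq (runs_buildProg M hN hD U V ?_) ?_
    · refine (Nat.pow_le_pow_left (Nat.le_succ n) _).trans (hWle _ ?_)
      have : 1 * buildConst ≤ (κ + 1) * (E + buildConst) := Nat.mul_le_mul (by omega) (by omega)
      omega
    rintro σ ⟨hb, hs⟩
    refine Runs.seq (runs_sub (W := (n + 1) ^ κ) (hWle _ ?_) (hs ▸ hex)
      (Q := fun σ' => AfterRun N D ((n + 1) ^ (κ + 1)) ((ovInput U V).arr 0)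
        ((ovInput U V).arr 1) σ' ∧ subState σ' = s) ?_) ?_
    · have : (κ + 1) * 1 ≤ (κ + 1) * (E + buildConst) := Nat.mul_le_mul le_rfl (by omega)
      omega
    · intro σ' h1 h2
      have hnV : n ≤ (n + 1) ^ (κ + 1) := (Nat.le_succ n).trans (Nat.le_self_pow (by omega) _)
      have hκV : (n + 1) ^ κ ≤ (n + 1) ^ (κ + 1) := Nat.pow_le_pow_right (by omega) (by omega)
      have hsw : WB ((n + 1) ^ (κ + 1)) s := hex.wb hκV ((ovCurves_wb M hN _ _).mono hnV)
      refine ⟨⟨?_, ?_, ?_, ?_, ?_, fun r => ?_, fun a x => ?_⟩, h1⟩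
      · rw [h2.1 0 rfl, hb.r0]
      · rw [h2.1 2 rfl, hb.r2]
      · rw [h2.1 4 rfl, hb.r4]
      · rw [h2.2 0 (by norm_num), hb.a0]
      · rw [h2.2 1 (by norm_num), hb.a1]
      · rcases Nat.even_or_odd' r with ⟨q, rfl | rfl⟩
        · rw [h2.1 _ (by omega)]; exact (hb.wb.1 _).trans hnV
        · have := hsw.1 q
          rwa [← h1] at this
      · rcases Nat.lt_or_ge a 2 with ha | ha
        · rw [h2.2 a ha]; exact (hb.wb.2 _ _).trans hnV
        · obtain ⟨a, rfl⟩ := Nat.exists_eq_add_of_le' ha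
          have := hsw.2 a x
          rwa [← h1] at this
    · rintro σ' ⟨h1, h2⟩
      refine (hrun W σ' h1 h2 ?_).mono le_rfl fun σ'' h => h.trans (exists_orthAt_iff U V)
      rw [← pow_mul]
      exact hWle _ (Nat.mul_le_mul le_rfl (by omega))
  obtain ⟨t', s', σ', k1, k2, k3, k4⟩ := hmain _ (Agree.refl _)
  refine ⟨t', s', hWdef ▸ k1, ?_, ?_⟩
  · have hnR : (1 : ℝ) ≤ n := by exact_mod_cast hn1
    have hDR : (1 : ℝ) ≤ D := by exact_mod_cast hD
    have hNR : (1 : ℝ) ≤ N := by exact_mod_cast hN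
    have e1 : (t' : ℝ) ≤ n * (2 * buildConst) + (t + tm) := by exact_mod_cast k2
    have e2 : (n : ℝ) ≤ D * (n : ℝ) ^ (2 - δ) := by
      have : (n : ℝ) ^ (1 : ℝ) ≤ (n : ℝ) ^ (2 - δ) :=
        Real.rpow_le_rpow_of_exponent_le hnR (by linarith)
      rw [Real.rpow_one] at this
      nlinarith
    have hpos : 0 ≤ (D : ℝ) * (n : ℝ) ^ (2 - δ) := by positivity
    have e3 : C * D * (n : ℝ) ^ (2 - δ) ≤ |C| * (D * (n : ℝ) ^ (2 - δ)) := by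
      rw [mul_assoc]; exact mul_le_mul_of_nonneg_right (le_abs_self C) hpos
    have e4 : (t' : ℝ) ≤ (2 * buildConst + |C|) * (D * (n : ℝ) ^ (2 - δ)) := by
      have : (n : ℝ) * (2 * buildConst) ≤ D * (n : ℝ) ^ (2 - δ) * (2 * buildConst) :=
        mul_le_mul_of_nonneg_right e2 (by positivity)
      nlinarith
    have e5 : (n : ℝ) ^ (2 - δ) ≤ 1024 * (D : ℝ) ^ 2 * (N : ℝ) ^ (2 - δ) := by
      have b1 : (n : ℝ) ≤ 32 * D * N := by
        have : (n : ℝ) ≤ 32 * (N * D) := by exact_mod_cast curveLength_le hN hD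
        linarith
      have b2 : (n : ℝ) ^ (2 - δ) ≤ (32 * D * N : ℝ) ^ (2 - δ) :=
        Real.rpow_le_rpow (by positivity) b1 (by linarith)
      have b3 : (32 * D * N : ℝ) ^ (2 - δ) = (32 * D : ℝ) ^ (2 - δ) * (N : ℝ) ^ (2 - δ) :=
        Real.mul_rpow (by positivity) (by positivity)
      have b4 : (32 * D : ℝ) ^ (2 - δ) ≤ (32 * D : ℝ) ^ (2 : ℝ) :=
        Real.rpow_le_rpow_of_exponent_le (by linarith) (by linarith)
      have b5 : (32 * D : ℝ) ^ (2 : ℝ) = 1024 * (D : ℝ) ^ 2 := by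
        rw [Real.rpow_two]; ring
      rw [b3] at b2
      rw [b5] at b4
      exact b2.trans (mul_le_mul_of_nonneg_right b4 (by positivity))
    have hc0 : (0 : ℝ) ≤ 2 * buildConst + |C| := by positivity
    calc (t' : ℝ) ≤ (2 * buildConst + |C|) * (D * (n : ℝ) ^ (2 - δ)) := e4
      _ ≤ (2 * buildConst + |C|) * (D * (1024 * (D : ℝ) ^ 2 * (N : ℝ) ^ (2 - δ))) := by gcongr
      _ = _ := by ring
  · rw [k3.1 0 (by simp [IsScr])]
    exact k4

lemma three_lt_mul {β : ℝ} (hβ : Real.sqrt 5 / (2 * Real.sqrt 2) ≤ β) : 3 < β * 4 := by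
  have h2 : 0 < √(2 : ℝ) := by positivity
  have h5 : 0 ≤ √(5 : ℝ) := by positivity
  have s2 : √(2 : ℝ) ^ 2 = 2 := Real.sq_sqrt (by norm_num)
  have s5 : √(5 : ℝ) ^ 2 = 5 := Real.sq_sqrt (by norm_num)
  have h : 3 * √(2 : ℝ) < 2 * √(5 : ℝ) :=
    lt_of_pow_lt_pow_left₀ 2 (by positivity) (by rw [mul_pow, mul_pow, s2, s5]; norm_num)
  rw [div_le_iff₀ (by positivity)] at hβ
  nlinarith

/-! ### Approximations of the value -/

lemma rpow_normalise {C δ : ℝ} {n : ℕ} (hn : 1 ≤ n) :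
    C * (n : ℝ) ^ (2 - δ) ≤ |C| * (n : ℝ) ^ (2 - min δ 1) := by
  have hnR : (1 : ℝ) ≤ n := by exact_mod_cast hn
  have h1 : (n : ℝ) ^ (2 - δ) ≤ (n : ℝ) ^ (2 - min δ 1) :=
    Real.rpow_le_rpow_of_exponent_le hnR (by linarith [min_le_left δ 1])
  exact (mul_le_mul_of_nonneg_right (le_abs_self C) (by positivity)).trans
    (mul_le_mul_of_nonneg_left h1 (abs_nonneg C))

/-- The comparison of the output with 3; the answer goes to register 0. -/
def compareThree : Model → Prog
  | .wordRAM => assign 0 (.ifLt (.op .mul (.lit 3) (.reg 3)) (.reg 1) (.lit 1) (.lit 0))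
  | .realRAM => .seq ((Ex.lit 3).code 0) (.seq (.instr (.rcast 0 (scr 0)))
      (.ite (.rlt 0 1) (assign 0 (.lit 1)) (assign 0 (.lit 0))))

lemma compareThree_for (M : Model) : (compareThree M).For M := by
  cases M
  · exact ⟨Ex.code_wordOnly _ _, trivial⟩
  · trivial

lemma runs_compareThree (M : Model) {V W : ℕ} {σ : State} {v : ℝ} (hV : 2 ≤ V) (hσ : WB V σ)
    (hW : V ^ 8 ≤ W) (hv : OutputsValue (subState σ) v M) :
    Runs W (compareThree M) σ 10 (fun σ => σ.reg 0 = 1 ↔ 3 < v) := by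
  cases M
  · obtain ⟨hpos, rfl⟩ := hv
    refine (runs_assign_good hV hσ ⟨by simp [Ex.Clean, IsScr], by simp [Ex.Poly]⟩
      (le_trans (Nat.pow_le_pow_right (by omega) ?_) hW) ?_).mono ?_ (fun _ h => h)
    · simp [Ex.deg]
    · have e : (3 : ℝ) < ((subState σ).reg 0 : ℝ) / ((subState σ).reg 1 : ℝ) ↔
          3 * σ.reg 3 < σ.reg 1 := by
        rw [lt_div_iff₀ (by exact_mod_cast hpos)]
        exact_mod_cast Iff.rfl
      rw [e]
      by_cases h : 3 * σ.reg 3 < σ.reg 1 <;> simp [State.set, Ex.eval, WordOp.eval, h]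
    · simp [Ex.cost]
  · intro s hs
    have hv' : v = σ.rreg 1 := hv
    have h3W : 3 ≤ W := le_trans (by have := Nat.pow_le_pow_left hV 8; omega) hW
    obtain ⟨t, s1, h1, h2, h3, h4, -⟩ := (Ex.lit 3).code_exec (W := W) (σ := σ) trivial h3W 0 s hs
    have h4' : s1.reg (scr 0) = 3 := h4
    -- even real registers are not part of the memory of the subroutine
    have a2 : Agree ((Instr.rcast 0 (scr 0)).apply s1) σ := by
      refine ⟨h3.1, h3.2.1, fun r => ?_, h3.2.2.2⟩
      have : 2 * r + 1 ≠ 0 := by omega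
      simpa [Instr.apply, Function.update_of_ne this] using h3.2.2.1 r
    have x2 : Exec W (.instr (.rcast 0 (scr 0))) s1 1 ((Instr.rcast 0 (scr 0)).apply s1) :=
      .instr _ _ (by simpa [Instr.Fits, h4'] using h3W)
    have hc : (Cond.rlt 0 1).Holds ((Instr.rcast 0 (scr 0)).apply s1) ↔ 3 < v := by
      have := h3.2.2.1 0
      simp only [mul_zero, zero_add] at this
      simp [Cond.Holds, Instr.apply, h4', this, hv']
    have fin : ∀ b ≤ 1, ∃ t s' σ', Exec W (assign 0 (.lit b))
        ((Instr.rcast 0 (scr 0)).apply s1) t s' ∧ t ≤ 2 ∧ Agree s' σ' ∧ σ'.reg 0 = b := by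
      intro b hb
      exact runs_assign (e := .lit b) (x := 0) (Q := fun σ' => σ'.reg 0 = b) trivial
        (show b ≤ W by omega) (by simp [State.set, Ex.eval]) _ a2
    have h2' : t ≤ 1 := h2
    by_cases h : 3 < v
    · obtain ⟨t', s', σ', k1, k2, k3, k4⟩ := fin 1 le_rfl
      exact ⟨_, s', σ', .seq h1 (.seq x2 (.iteTrue (hc.2 h) k1)), by omega, k3, by simp [k4, h]⟩
    · obtain ⟨t', s', σ', k1, k2, k3, k4⟩ := fin 0 (by omega)
      exact ⟨_, s', σ', .seq h1 (.seq x2 (.iteFalse (fun h' => h (hc.1 h')) k1)), by omega, k3,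
        by simp [k4, h]⟩

/-- An approximation of the flipped Fréchet measure decides Orthogonal Vectors, since the measure is at
least 4 if there is an orthogonal pair and at most 3 otherwise. -/
lemma ovSolvable_of_ffValueSolvable {M : Model} {β δ : ℝ}
    (hβ : Real.sqrt 5 / (2 * Real.sqrt 2) ≤ β) (hδ : 0 < δ) (h : FFValueSolvable M β δ) :
    OVSolvable M (min δ 1) := by
  obtain ⟨p, C, κ, hp, h⟩ := h
  refine ovSolvable_of_curves (lt_min hδ one_pos) (min_le_right _ _) p (compareThree M) hp
    (compareThree_for M) (|C| + 10) κ 8 fun N D hN hD A B => ?_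
  have hn := curveLength_pos N D
  obtain ⟨t, s, v, hex, ht, hout, hv1, hv2⟩ := h _ hn (ovCurves M hN A B)
  rw [ovCurves_fst, ovCurves_snd] at hv1 hv2
  refine ⟨t, 10, s, hex, ?_, fun W σ hσ hs hW => ?_⟩
  · have hnR : (1 : ℝ) ≤ curveLength N D := by exact_mod_cast hn
    have hDR : (1 : ℝ) ≤ D := by exact_mod_cast hD
    have h1 := ht.trans (rpow_normalise (C := C) (δ := δ) hn)
    have h2 : (1 : ℝ) ≤ (curveLength N D : ℝ) ^ (2 - min δ 1) :=
      Real.one_le_rpow hnR (by linarith [min_le_right δ 1])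
    have h3 : (|C| + 10) * 1 * (curveLength N D : ℝ) ^ (2 - min δ 1) ≤
        (|C| + 10) * D * (curveLength N D : ℝ) ^ (2 - min δ 1) := by gcongr
    push_cast
    nlinarith
  · subst hs
    have hV : 2 ≤ (curveLength N D + 1) ^ (κ + 1) :=
      le_trans (by omega) (Nat.le_self_pow (by omega) _)
    refine (runs_compareThree M hV hσ.wb hW hout).mono le_rfl fun σ' h' => h'.trans ?_
    have h3 := three_lt_mul hβ
    constructor
    · intro hv
      by_contra hno
      have := FF_le_three hN hD hno
      linarith
    · rintro ⟨i, j, hij⟩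
      have h4 := four_le_FF hij
      have hβ0 : 0 < β := by linarith
      nlinarith

/-! ### Searching a traversal for an orthogonal pair -/

section Scan

variable (c : ℕ → ℕ) (D N : ℕ) (u v : ℕ → ℕ)

/-- Numbering pairs of a candidate `k` and a coordinate `d < D` as `x = k * D + d`, whether `c` has
been positive for some coordinate of the current candidate before `x`. -/
def scanBad : ℕ → ℕ
  | 0 => 0
  | x + 1 => if 0 < c x then 1 else if x % D < 1 then 0 else scanBad x

/-- Whether some candidate `k` has passed before `x`, that is, has `u k, v k < N` and `c = 0` for all
coordinates. -/
def scanAns : ℕ → ℕ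
  | 0 => 0
  | x + 1 => if x % D + 1 < D then scanAns x else if scanBad c D (x + 1) < 1 then
      if u (x / D) < N then if v (x / D) < N then 1 else scanAns x else scanAns x else scanAns x

variable {c D N u v}

lemma scanBad_le (x : ℕ) : scanBad c D x ≤ 1 := by
  induction x with
  | zero => exact Nat.zero_le _
  | succ x ih => simp only [scanBad]; split_ifs <;> omega

lemma scanAns_le (x : ℕ) : scanAns c D N u v x ≤ 1 := by
  induction x with
  | zero => exact Nat.zero_le _
  | succ x ih => simp only [scanAns]; split_ifs <;> omega

lemma scanBad_lt_one {k d : ℕ} (hd : d < D) :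
    scanBad c D (k * D + d + 1) < 1 ↔ ∀ e ≤ d, c (k * D + e) = 0 := by
  induction d with
  | zero =>
    rw [scanBad, Nat.mul_mod_left]
    constructor
    · intro h e he
      obtain rfl : e = 0 := by omega
      by_contra h0
      rw [if_pos (show 0 < c (k * D) from Nat.pos_of_ne_zero h0)] at h
      omega
    · intro h
      have : c (k * D) = 0 := h 0 le_rfl
      rw [if_neg (by omega), if_pos (by omega)]
      omega
  | succ d ih =>
    rw [scanBad, (mul_add_div_mod (k := k) hd).2, ← add_assoc]
    by_cases h0 : 0 < c (k * D + d + 1)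
    · rw [if_pos h0]
      refine ⟨fun h => by omega, fun h => ?_⟩
      have : c (k * D + d + 1) = 0 := h (d + 1) le_rfl
      omega
    · rw [if_neg h0, if_neg (by omega), ih (by omega)]
      refine ⟨fun h e he => ?_, fun h e he => h e (by omega)⟩
      rcases Nat.lt_or_eq_of_le he with h' | rfl
      · exact h e (by omega)
      · rw [← add_assoc]; omega

lemma scanAns_eq_one (hD : 0 < D) (m : ℕ) : scanAns c D N u v (m * D) = 1 ↔
    ∃ k < m, u k < N ∧ v k < N ∧ ∀ d < D, c (k * D + d) = 0 := by
  induction m with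
  | zero => simp [scanAns]
  | succ m ih =>
    have hconst : ∀ d < D, scanAns c D N u v (m * D + d) = scanAns c D N u v (m * D) := by
      intro d
      induction d with
      | zero => intro _; rfl
      | succ d ihd =>
        intro hd
        rw [← add_assoc, scanAns, (mul_add_div_mod (k := m) (show d < D by omega)).2,
          if_pos hd, ihd (by omega)]
    have hlt : D - 1 < D := by omega
    have e : (m + 1) * D = m * D + (D - 1) + 1 := by rw [add_mul]; omega
    have hb := scanBad_lt_one (c := c) (k := m) hlt
    have hc := hconst _ hlt
    have hall : (∀ d ≤ D - 1, c (m * D + d) = 0) ↔ ∀ d < D, c (m * D + d) = 0 :=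
      ⟨fun h d hd => h d (by omega), fun h d hd => h d (by omega)⟩
    have hsplit : (∃ k < m + 1, u k < N ∧ v k < N ∧ ∀ d < D, c (k * D + d) = 0) ↔
        (∃ k < m, u k < N ∧ v k < N ∧ ∀ d < D, c (k * D + d) = 0) ∨
          (u m < N ∧ v m < N ∧ ∀ d < D, c (m * D + d) = 0) := by
      constructor
      · rintro ⟨k, hk, h⟩
        rcases Nat.lt_succ_iff_lt_or_eq.1 hk with h' | rfl
        exacts [.inl ⟨k, h', h⟩, .inr h]
      · rintro (⟨k, hk, h⟩ | h)
        exacts [⟨k, by omega, h⟩, ⟨m, by omega, h⟩]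
    rw [e, scanAns, (mul_add_div_mod (k := m) hlt).1, (mul_add_div_mod (k := m) hlt).2, hc,
      if_neg (by omega), hsplit, ← ih, ← hall, ← hb]
    split_ifs <;> simp_all

end Scan

/-- The index of the candidate. -/
def exCand : Ex := .op .div (.reg 8) (.reg 2)

/-- The index of the coordinate. -/
def exCoord : Ex := .op .mod (.reg 8) (.reg 2)

/-- The vector of the first family in the candidate, from the index of the edge in the array 2. -/
def exCandFst : Ex := .op .div (.get 2 exCand) exBlock

/-- The vector of the second family in the candidate, from the index of the edge in the array `a`. -/
def exCandSnd (a : ℕ) : Ex :=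
  .op .div (.op .sub (.get a exCand) (.lit 6)) (.op .mul (.lit 4) (.reg 4))

/-- The product of the two entries. -/
def exEntries (a : ℕ) : Ex :=
  .op .mul (.get 0 (.op .add (.op .mul exCandFst (.reg 2)) exCoord))
    (.get 1 (.op .add (.op .mul (exCandSnd a) (.reg 2)) exCoord))

/-- The update of `scanBad`, in the register 10. -/
def exBad (a : ℕ) : Ex :=
  .ifLt (.lit 0) (exEntries a) (.lit 1) (.ifLt exCoord (.lit 1) (.lit 0) (.reg 10))

/-- The update of `scanAns`, in the register 12. -/
def exAns (a : ℕ) : Ex :=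
  .ifLt (.op .add exCoord (.lit 1)) (.reg 2) (.reg 12) (.ifLt (.reg 10) (.lit 1)
    (.ifLt exCandFst (.reg 0) (.ifLt (exCandSnd a) (.reg 0) (.lit 1) (.reg 12)) (.reg 12)) (.reg 12))

lemma exBad_good (a : ℕ) : (exBad a).Good := by
  constructor <;> simp [exBad, exEntries, exCandFst, exCandSnd, exCand, exCoord, exBlock, Ex.Clean,
    Ex.Poly, IsScr]

lemma exAns_good (a : ℕ) : (exAns a).Good := by
  constructor <;> simp [exAns, exCandFst, exCandSnd, exCand, exCoord, exBlock, Ex.Clean,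
    Ex.Poly, IsScr]

/-- The search, in the output of a program that computes traversals, for a piece whose edges show a
pair of orthogonal vectors; `a` is the array that holds the edges of the second curve. -/
def searchTraversal (a : ℕ) : Prog :=
  .seq (assign 6 (.op .mul (.reg 1) (.reg 2))) (.seq (assign 8 (.lit 0)) (.seq (assign 10 (.lit 0))
    (.seq (assign 12 (.lit 0)) (.seq (countLoop (.seq (assign 10 (exBad a)) (assign 12 (exAns a))))
      (assign 0 (.reg 12))))))

lemma searchTraversal_for (a : ℕ) (M : Model) : (searchTraversal a).For M := by
  cases M
  · simp [searchTraversal, Prog.For, Prog.WordOnly, assign, countLoop,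
      Ex.code_wordOnly, Instr.WordOnly, Cond.WordOnly]
  · trivial

/-- The constant of the degree bounds and of the running time of `searchTraversal`. -/
def searchConst (a : ℕ) : ℕ := (exBad a).cost + (exAns a).cost + (exBad a).deg + (exAns a).deg + 10

/-- The memory during the search. -/
def scanState (σ : State) (x b r : ℕ) : State := ((σ.set 8 x).set 10 b).set 12 r

lemma runs_searchTraversal {N D V W a : ℕ} (hD : 0 < D) {A B : ℕ → ℕ} {σ : State} (hV : 2 ≤ V)
    (h : AfterRun N D V A B σ) (hW : V ^ (2 * searchConst a) ≤ W) :
    Runs W (searchTraversal a) σ (σ.reg 1 * D * searchConst a + 20) (fun σ' => σ'.reg 0 = 1 ↔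
      ∃ k < σ.reg 1, OrthAt N D A B (σ.arr 2 k / (4 * (2 * D + 3) + 2))
        ((σ.arr a k - 6) / (4 * (2 * D + 3)))) := by
  obtain ⟨m, hm⟩ : ∃ m, m = σ.reg 1 := ⟨_, rfl⟩
  rw [← hm]
  have hD2 : D ≤ V := h.r2 ▸ h.wb.1 2
  have hmV : m ≤ V := hm ▸ h.wb.1 1
  -- the number of rounds of the loop is bounded by `V ^ 2` rather than by `V`
  have hmD : m * D ≤ V ^ 2 := by rw [pow_two]; exact Nat.mul_le_mul hmV hD2
  have hV2 : V ≤ V ^ 2 := Nat.le_self_pow (by omega) _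
  have hle : ∀ k ≤ searchConst a, (V ^ 2) ^ k ≤ W := fun k hk => by
    rw [← pow_mul]; exact le_pow_of_le hV hW (by omega)
  have hVW : V ^ 2 ≤ W := by simpa using hle 1 (by unfold searchConst; omega)
  have wb0 : WB (V ^ 2) σ := h.wb.mono hV2
  set u : ℕ → ℕ := fun k => σ.arr 2 k / (4 * (2 * D + 3) + 2) with hu
  set v : ℕ → ℕ := fun k => (σ.arr a k - 6) / (4 * (2 * D + 3)) with hv
  set c : ℕ → ℕ := fun x => A (u (x / D) * D + x % D) * B (v (x / D) * D + x % D) with hc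
  set σ0 := σ.set 6 (m * D) with hσ0
  have wb1 : WB (V ^ 2) σ0 := wb0.set 6 hmD
  have wbs : ∀ x ≤ m * D, ∀ b ≤ 1, ∀ r ≤ 1, WB (V ^ 2) (scanState σ0 x b r) :=
    fun x hx b hb r hr => ((wb1.set 8 (hx.trans hmD)).set 10 (by omega)).set 12 (by omega)
  have hreg : ∀ x b r, (scanState σ0 x b r).reg 0 = N ∧ (scanState σ0 x b r).reg 2 = D ∧
      (scanState σ0 x b r).reg 4 = 2 * D + 3 ∧ (scanState σ0 x b r).reg 6 = m * D ∧
      (scanState σ0 x b r).reg 8 = x ∧ (scanState σ0 x b r).reg 10 = b ∧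
      (scanState σ0 x b r).reg 12 = r ∧ (scanState σ0 x b r).arr = σ.arr := by
    intro x b r
    simp [scanState, State.set, hσ0, h.r0, h.r2, h.r4]
  have hbad : ∀ x r, (exBad a).eval (scanState σ0 x (scanBad c D x) r) = scanBad c D (x + 1) := by
    intro x r
    obtain ⟨h0, h2, h4, -, h8, h10, h12, ha⟩ := hreg x (scanBad c D x) r
    generalize scanState σ0 x (scanBad c D x) r = s at h2 h4 h8 h10 ha ⊢
    simp only [exBad, exEntries, exCandFst, exCandSnd, exCand, exCoord, exBlock, Ex.eval,
      WordOp.eval, h2, h4, h8, h10, ha, h.a0, h.a1, scanBad]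
    rfl
  have hans : ∀ x, (exAns a).eval (scanState σ0 x (scanBad c D (x + 1)) (scanAns c D N u v x)) =
      scanAns c D N u v (x + 1) := by
    intro x
    obtain ⟨h0, h2, h4, -, h8, h10, h12, ha⟩ :=
      hreg x (scanBad c D (x + 1)) (scanAns c D N u v x)
    generalize scanState σ0 x (scanBad c D (x + 1)) (scanAns c D N u v x) = s
      at h0 h2 h4 h8 h10 h12 ha ⊢
    simp only [exAns, exCandFst, exCandSnd, exCand, exCoord, exBlock, Ex.eval,
      WordOp.eval, h0, h2, h4, h8, h10, h12, ha, scanAns]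
    rfl
  have hset10 : ∀ x b r w, (scanState σ0 x b r).set 10 w = scanState σ0 x w r := by
    intro x b r w
    simp only [scanState, State.set]
    congr 1
    funext i
    by_cases h1 : i = 10 <;> by_cases h2 : i = 12 <;> simp_all
  have hset12 : ∀ x b r w, (scanState σ0 x b r).set 12 w = scanState σ0 x b w := by
    intro x b r w
    simp [scanState, State.set]
  have hset8 : ∀ x b r w, (scanState σ0 x b r).set 8 w = scanState σ0 w b r := by
    intro x b r w
    simp only [scanState, State.set]
    congr 1
    funext i
    by_cases h1 : i = 10 <;> by_cases h2 : i = 12 <;> by_cases h3 : i = 8 <;> simp_all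
  have lit0 : ∀ {σ : State} (x : ℕ) {Q : State → Prop}, Q (σ.set x 0) →
      Runs W (assign x (.lit 0)) σ 2 Q := fun x Q hQ =>
    runs_assign (e := .lit 0) trivial (Nat.zero_le _) hQ
  refine Runs.mono (T := 4 + (2 + (2 + (2 + ((m * D * (((exBad a).cost + 1) + ((exAns a).cost + 1)
    + 5) + 1) + 2))))) ?_ ?_ (fun _ h => h)
  · refine Runs.seq (Q := fun σ' => σ' = σ0) ?_ ?_
    · refine runs_assign_good (e := .op .mul (.reg 1) (.reg 2)) (le_trans hV hV2) wb0
        ⟨by simp [Ex.Clean, IsScr], by simp [Ex.Poly]⟩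
        (hle _ (by simp only [Ex.deg, searchConst]; omega)) ?_
      simp [Ex.eval, WordOp.eval, hσ0, h.r2, hm]
    rintro _ rfl
    refine Runs.seq (lit0 8 (Q := fun σ' => σ' = σ0.set 8 0) rfl) ?_
    rintro _ rfl
    refine Runs.seq (lit0 10 (Q := fun σ' => σ' = (σ0.set 8 0).set 10 0) rfl) ?_
    rintro _ rfl
    refine Runs.seq (lit0 12 (Q := fun σ' => σ' = scanState σ0 0 0 0) rfl) ?_
    rintro _ rfl
    refine Runs.seq (runs_countLoop (n := m * D) (T := ((exBad a).cost + 1) + ((exAns a).cost + 1))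
      (fun x σ' => σ' = scanState σ0 x (scanBad c D x) (scanAns c D N u v x))
      (hmD.trans hVW) (by omega) ?_ ?_ rfl) ?_
    · rintro x _ rfl
      obtain ⟨-, -, -, h6, h8, -⟩ := hreg x (scanBad c D x) (scanAns c D N u v x)
      exact ⟨h8, h6⟩
    · rintro x hx _ rfl
      refine Runs.seq (Q := fun σ' => σ' = scanState σ0 x (scanBad c D (x + 1))
        (scanAns c D N u v x)) ?_ ?_
      · refine runs_assign_good (le_trans hV hV2) (wbs x hx.le _ (scanBad_le x) _ (scanAns_le x))
          (exBad_good a) (hle _ (by simp only [searchConst]; omega)) ?_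
        rw [hbad, hset10]
      rintro _ rfl
      refine runs_assign_good (le_trans hV hV2)
        (wbs x hx.le _ (scanBad_le (x + 1)) _ (scanAns_le x))
        (exAns_good a) (hle _ (by simp only [searchConst]; omega)) ?_
      rw [hans, hset12, hset8]
      exact ⟨(hreg _ _ _).2.2.2.2.1, rfl⟩
    · rintro _ rfl
      refine runs_assign_good (e := .reg 12) (le_trans hV hV2)
        (wbs _ le_rfl _ (scanBad_le _) _ (scanAns_le _))
        ⟨by simp [Ex.Clean, IsScr], by simp [Ex.Poly]⟩
        (hle _ (by simp only [Ex.deg, searchConst]; omega)) ?_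
      have e12 : (Ex.reg 12).eval (scanState σ0 (m * D) (scanBad c D (m * D))
          (scanAns c D N u v (m * D))) = scanAns c D N u v (m * D) := (hreg _ _ _).2.2.2.2.2.2.1
      have key : ∀ k d, d < D → (c (k * D + d) = 0 ↔ ¬ (0 < A (u k * D + d) ∧ 0 < B (v k * D + d))) := by
        intro k d hd
        obtain ⟨e1, e2⟩ := mul_add_div_mod (k := k) hd
        simp only [hc, e1, e2, Nat.mul_eq_zero]
        omega
      rw [e12]
      simp only [State.set, Function.update_self]
      rw [scanAns_eq_one hD]
      constructor
      · rintro ⟨k, hk, h1, h2, h3⟩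
        exact ⟨k, hk, h1, h2, fun d hd => (key k d hd).1 (h3 d hd)⟩
      · rintro ⟨k, hk, h1, h2, h3⟩
        exact ⟨k, hk, h1, h2, fun d hd => (key k d hd).2 (h3 d hd)⟩
  · have : m * D * (((exBad a).cost + 1) + ((exAns a).cost + 1) + 5) ≤ m * D * searchConst a :=
      Nat.mul_le_mul_left _ (by unfold searchConst; omega)
    omega

/-- The array that holds the edges of the second curve after a run of the subroutine. -/
def sndArray : Model → ℕ
  | .wordRAM => 5
  | .realRAM => 3

lemma outputsTraversal_edges {M : Model} {σ : State} {T : TraversalCode}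
    (h : OutputsTraversal (subState σ) T M) : T.m = σ.reg 1 ∧
      ∀ k ≤ T.m, T.i k = σ.arr 2 k ∧ T.j k = σ.arr (sndArray M) k := by
  cases M
  · exact ⟨h.1, fun k hk => ⟨(h.2 k hk).1, (h.2 k hk).2.2.2.1⟩⟩
  · exact ⟨h.1, fun k hk => ⟨(h.2 k hk).1, (h.2 k hk).2.2.1⟩⟩

/-- A traversal that nearly attains the flipped Fréchet measure shows an orthogonal pair, if there is
one; as it has a subquadratic number of pieces, the pair is found by testing all of them. -/
lemma ovSolvable_of_ffTraversalSolvable {M : Model} {β δ : ℝ}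
    (hβ : Real.sqrt 5 / (2 * Real.sqrt 2) ≤ β) (hδ : 0 < δ) (h : FFTraversalSolvable M β δ) :
    OVSolvable M (min δ 1) := by
  obtain ⟨p, C, κ, hp, h⟩ := h
  set a := sndArray M with ha
  refine ovSolvable_of_curves (lt_min hδ one_pos) (min_le_right _ _) p (searchTraversal a) hp
    (searchTraversal_for a M) ((1 + searchConst a) * |C| + 20) κ (2 * searchConst a)
    fun N D hN hD A B => ?_
  have hn := curveLength_pos N D
  obtain ⟨t, s, T, hex, ht, hout, hT, hsep⟩ := h _ hn (ovCurves M hN A B)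
  rw [ovCurves_fst, ovCurves_snd] at hsep
  refine ⟨t, T.m * D * searchConst a + 20, s, hex, ?_, fun W σ hσ hs hW => ?_⟩
  · have hnR : (1 : ℝ) ≤ curveLength N D := by exact_mod_cast hn
    have hDR : (1 : ℝ) ≤ D := by exact_mod_cast hD
    have h1 := ht.trans (rpow_normalise (C := C) (δ := δ) hn)
    have h2 : (1 : ℝ) ≤ (curveLength N D : ℝ) ^ (2 - min δ 1) :=
      Real.one_le_rpow hnR (by linarith [min_le_right δ 1])
    set X := (curveLength N D : ℝ) ^ (2 - min δ 1) with hX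
    have hm0 : (0 : ℝ) ≤ T.m := Nat.cast_nonneg _
    have ht0 : (0 : ℝ) ≤ t := Nat.cast_nonneg _
    have hCX : 0 ≤ |C| * X := by positivity
    have b1 : (t : ℝ) ≤ |C| * X * D := by nlinarith
    have b2 : (T.m : ℝ) * D * searchConst a ≤ |C| * X * D * searchConst a := by
      gcongr; linarith
    have b3 : (1 : ℝ) ≤ D * X := by nlinarith
    push_cast
    calc (t : ℝ) + (T.m * D * searchConst a + 20)
        ≤ |C| * X * D + (|C| * X * D * searchConst a + 20 * (D * X)) := by linarith
      _ = _ := by ring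
  · subst hs
    obtain ⟨hm, hedges⟩ := outputsTraversal_edges hout
    have hV : 2 ≤ (curveLength N D + 1) ^ (κ + 1) :=
      le_trans (by omega) (Nat.le_self_pow (by omega) _)
    rw [hm]
    refine (runs_searchTraversal hD hV hσ hW).mono le_rfl fun σ' h' => h'.trans ?_
    constructor
    · rintro ⟨k, -, hk⟩
      exact ⟨_, _, hk⟩
    · rintro ⟨i, j, hij⟩
      have h3 := three_lt_mul hβ
      have h4 := four_le_FF hij
      have hβ0 : 0 < β := by linarith
      obtain ⟨k, hk, hk'⟩ := exists_orthAt_of_code hN hD hT (A := A) (B := B)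
        (by nlinarith)
      obtain ⟨e1, e2⟩ := hedges k hk.le
      rw [e1, e2] at hk'
      exact ⟨k, hm ▸ hk, hk'⟩

/-! ### From satisfiability to Orthogonal Vectors -/

/-- `1` if the literal with the variable `z` and the sign `s` is not satisfied by the assignment of the
variables below `h` given by the bits of `a`, else `0`. -/
def litLow (h a z s : ℕ) : ℕ := if z < h then (a >>> z % 2 + s) % 2 else 1

/-- `1` if the literal with the variable `z` and the sign `s` is not satisfied by the assignment of the
variables from `h` on given by the bits of `a`, else `0`. -/
def litHigh (h a z s : ℕ) : ℕ := if z < h then 1 else (a >>> (z - h) % 2 + s) % 2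

/-- The vectors of a family, one after another, in dimension `m + 1`: the coordinate `j < m` tells
whether no literal of the clause `j` is satisfied, the last coordinate is 0. `X` and `S` are the
variables and the signs of the literals. -/
def satTable (lit : ℕ → ℕ → ℕ → ℕ) (k m : ℕ) (X S : ℕ → ℕ) (x : ℕ) : ℕ :=
  if x % (m + 1) < m then
    ∏ l ∈ Finset.range k,
      lit (x / (m + 1)) (X (x % (m + 1) * k + l)) (S (x % (m + 1) * k + l))
  else 0

lemma litLow_ne_zero {h a z : ℕ} {s : Bool} :
    litLow h a z s.toNat ≠ 0 ↔ ¬ (z < h ∧ a.testBit z = s) := by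
  unfold litLow
  rw [Nat.shiftRight_eq_div_pow, ← Nat.toNat_testBit]
  by_cases hz : z < h <;> cases a.testBit z <;> cases s <;> simp [hz]

lemma litHigh_ne_zero {h a z : ℕ} {s : Bool} :
    litHigh h a z s.toNat ≠ 0 ↔ ¬ (h ≤ z ∧ a.testBit (z - h) = s) := by
  unfold litHigh
  rw [Nat.shiftRight_eq_div_pow, ← Nat.toNat_testBit]
  by_cases hz : z < h
  · simp [hz]
  · cases a.testBit (z - h) <;> cases s <;> simp [hz]

lemma litLow_le (h a z s : ℕ) : litLow h a z s ≤ 1 := by unfold litLow; split_ifs <;> omega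

lemma litHigh_le (h a z s : ℕ) : litHigh h a z s ≤ 1 := by unfold litHigh; split_ifs <;> omega

lemma satTable_le {lit : ℕ → ℕ → ℕ → ℕ} (hl : ∀ a z s, lit a z s ≤ 1) (k m : ℕ) (X S : ℕ → ℕ)
    (x : ℕ) : satTable lit k m X S x ≤ 1 := by
  unfold satTable
  split_ifs
  · exact Finset.prod_le_one' fun l _ => hl _ _ _
  · exact Nat.zero_le _

/-- The family of vectors with the given table. -/
def tableVectors (N D : ℕ) (t : ℕ → ℕ) : Fin N → Fin D → Bool := fun a d => decide (t (a * D + d) ≠ 0)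

/-- The table of the literals satisfied by assignments of the lower half of the variables. -/
def tableLow {k n m : ℕ} (F : KCNF k n m) : ℕ → ℕ :=
  satTable (litLow ((n + 1) / 2)) k m ((satInput F).arr 0) ((satInput F).arr 1)

/-- The table of the literals satisfied by assignments of the upper half of the variables. -/
def tableHigh {k n m : ℕ} (F : KCNF k n m) : ℕ → ℕ :=
  satTable (litHigh ((n + 1) / 2)) k m ((satInput F).arr 0) ((satInput F).arr 1)

lemma satTable_ne_zero {k n m : ℕ} (F : KCNF k n m) (lit : ℕ → ℕ → ℕ → ℕ) (a d : ℕ)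
    (hd : d < m + 1) :
    satTable lit k m ((satInput F).arr 0) ((satInput F).arr 1) (a * (m + 1) + d) ≠ 0 ↔
      ∃ h : d < m, ∀ l, lit a (F ⟨d, h⟩ l).1 (F ⟨d, h⟩ l).2.toNat ≠ 0 := by
  obtain ⟨e1, e2⟩ := mul_add_div_mod (k := a) hd
  unfold satTable
  rw [e1, e2]
  by_cases h : d < m
  · simp only [h, if_true, exists_true_left, Finset.prod_ne_zero_iff, Finset.mem_range]
    have key : ∀ l (hl : l < k), (satInput F).arr 0 (d * k + l) = (F ⟨d, h⟩ ⟨l, hl⟩).1 ∧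
        (satInput F).arr 1 (d * k + l) = (F ⟨d, h⟩ ⟨l, hl⟩).2.toNat := by
      intro l hl
      obtain ⟨e3, e4⟩ := mul_add_div_mod (k := d) hl
      simp [satInput, e3, e4, h, hl]
    constructor
    · intro H l
      have := H l l.2
      rwa [(key l l.2).1, (key l l.2).2] at this
    · intro H l hl
      rw [(key l hl).1, (key l hl).2]
      exact H ⟨l, hl⟩
  · simp [h]

lemma hasOrthogonalPair_iff {k n m : ℕ} (F : KCNF k n m) :
    HasOrthogonalPair (tableVectors (2 ^ ((n + 1) / 2)) (m + 1) (tableLow F))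
      (tableVectors (2 ^ ((n + 1) / 2)) (m + 1) (tableHigh F)) ↔ F.Satisfiable := by
  obtain ⟨h, hh⟩ : ∃ h, h = (n + 1) / 2 := ⟨_, rfl⟩
  have key : ∀ a b : ℕ, (∀ d : Fin (m + 1), ¬ (tableLow F (a * (m + 1) + d) ≠ 0 ∧
      tableHigh F (b * (m + 1) + d) ≠ 0)) ↔
      ∀ j, ∃ l, (if ((F j l).1 : ℕ) < h then a.testBit (F j l).1
        else b.testBit ((F j l).1 - h)) = (F j l).2 := by
    intro a b
    have e : ∀ d : Fin (m + 1), (tableLow F (a * (m + 1) + d) ≠ 0 ∧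
        tableHigh F (b * (m + 1) + d) ≠ 0) ↔ ∃ hd : (d : ℕ) < m, ∀ l,
          ¬ (if ((F ⟨d, hd⟩ l).1 : ℕ) < h then a.testBit (F ⟨d, hd⟩ l).1
            else b.testBit ((F ⟨d, hd⟩ l).1 - h)) = (F ⟨d, hd⟩ l).2 := by
      intro d
      rw [tableLow, tableHigh, satTable_ne_zero F _ a d d.2, satTable_ne_zero F _ b d d.2, ← hh]
      simp only [litLow_ne_zero, litHigh_ne_zero]
      constructor
      · rintro ⟨⟨hd, h1⟩, ⟨_, h2⟩⟩
        refine ⟨hd, fun l => ?_⟩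
        have h1 := h1 l
        have h2 := h2 l
        split_ifs with hc
        · exact fun h => h1 ⟨hc, h⟩
        · exact fun h => h2 ⟨not_lt.1 hc, h⟩
      · rintro ⟨hd, H⟩
        refine ⟨⟨hd, fun l hl => H l ?_⟩, ⟨hd, fun l hl => H l ?_⟩⟩
        · rw [if_pos hl.1]; exact hl.2
        · rw [if_neg (not_lt.2 hl.1)]; exact hl.2
    simp only [e]
    constructor
    · intro H j
      have := H ⟨j, by omega⟩
      by_contra hc
      exact this ⟨j.2, fun l hl => hc ⟨l, hl⟩⟩
    · rintro H d ⟨hd, H'⟩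
      obtain ⟨l, hl⟩ := H ⟨d, hd⟩
      exact H' l hl
  have unfoldPair : HasOrthogonalPair (tableVectors (2 ^ ((n + 1) / 2)) (m + 1) (tableLow F))
      (tableVectors (2 ^ ((n + 1) / 2)) (m + 1) (tableHigh F)) ↔
      ∃ a b : Fin (2 ^ h), ∀ d : Fin (m + 1), ¬ (tableLow F (a * (m + 1) + d) ≠ 0 ∧
        tableHigh F (b * (m + 1) + d) ≠ 0) := by
    subst hh
    simp [HasOrthogonalPair, tableVectors]
  rw [unfoldPair]
  simp only [key]
  constructor
  · rintro ⟨a, b, H⟩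
    exact ⟨fun z => if (z : ℕ) < h then (a : ℕ).testBit z else (b : ℕ).testBit (z - h), H⟩
  · rintro ⟨x, H⟩
    refine ⟨⟨Nat.ofBits fun z : Fin h => if hz : (z : ℕ) < n then x ⟨z, hz⟩ else false,
      Nat.ofBits_lt_two_pow _⟩, ⟨Nat.ofBits fun z : Fin h =>
        if hz : (z : ℕ) + h < n then x ⟨z + h, hz⟩ else false, Nat.ofBits_lt_two_pow _⟩, fun j => ?_⟩
    obtain ⟨l, hl⟩ := H j
    refine ⟨l, ?_⟩
    rw [← hl]
    generalize (F j l).1 = z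
    split_ifs with hz
    · rw [Nat.testBit_ofBits_lt _ _ hz]
      simp
    · have hz' : (z : ℕ) - h < h := by have := z.2; omega
      rw [Nat.testBit_ofBits_lt _ _ hz']
      have : (z : ℕ) - h + h = z := by omega
      simp [this]

section SatBuild

/-- In the following expressions, the registers 1, 2, 3, 4 and 8 hold the number of vectors of a family,
the number `m` of clauses, the dimension `m + 1`, the number of variables of the lower half and the
index of an entry of a family. The index of the vector: -/
def exVec : Ex := .op .div (.reg 8) (.reg 3)

/-- The index of the clause. -/
def exClause : Ex := .op .mod (.reg 8) (.reg 3)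

/-- The entry for the literal `l` of the clause, of the variables in array 0 or the signs in array 1. -/
def exLit (k a l : ℕ) : Ex := .get a (.op .add (.op .mul exClause (.lit k)) (.lit l))

/-- The sum modulo 2 of the bit `z` of the index of the vector and of the sign of the literal `l`. -/
def exParity (k l : ℕ) (z : Ex) : Ex :=
  .op .mod (.op .add (.op .mod (.op .shr exVec z) (.lit 2)) (exLit k 1 l)) (.lit 2)

/-- The value of `litLow`. -/
def exLow (k l : ℕ) : Ex :=
  .ifLt (exLit k 0 l) (.reg 4) (exParity k l (exLit k 0 l)) (.lit 1)

/-- The value of `litHigh`. -/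
def exHigh (k l : ℕ) : Ex :=
  .ifLt (exLit k 0 l) (.reg 4) (.lit 1) (exParity k l (.op .sub (exLit k 0 l) (.reg 4)))

/-- The product of the values of `f 0, …, f (k - 1)`. -/
def exProd (f : ℕ → Ex) : ℕ → Ex
  | 0 => .lit 1
  | k + 1 => .op .mul (exProd f k) (f k)

/-- The value of `satTable`. -/
def exTable (f : ℕ → ℕ → Ex) (k : ℕ) : Ex := .ifLt exClause (.reg 2) (exProd (f k) k) (.lit 0)

lemma exProd_eval (f : ℕ → Ex) (σ : State) (k : ℕ) :
    (exProd f k).eval σ = ∏ l ∈ Finset.range k, (f l).eval σ := by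
  induction k with
  | zero => rfl
  | succ k ih => rw [Finset.prod_range_succ, ← ih]; rfl

lemma exProd_good {f : ℕ → Ex} (hf : ∀ l, (f l).Good) (k : ℕ) : (exProd f k).Good := by
  induction k with
  | zero => exact ⟨trivial, trivial⟩
  | succ k ih => exact ⟨⟨ih.clean, (hf k).clean⟩, by simp, ih.poly, (hf k).poly⟩

lemma exProd_noGet {f : ℕ → Ex} {a : ℕ} (hf : ∀ l, (f l).NoGet a) (k : ℕ) :
    (exProd f k).NoGet a := by
  induction k with
  | zero => trivial
  | succ k ih => exact ⟨ih, hf k⟩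

lemma exTable_good {f : ℕ → ℕ → Ex} (hf : ∀ k l, (f k l).Good) (k : ℕ) : (exTable f k).Good := by
  have := exProd_good (hf k) k
  constructor
  · simp [exTable, exClause, Ex.Clean, IsScr, this.clean]
  · simp [exTable, exClause, Ex.Poly, this.poly]

lemma exTable_noGet {f : ℕ → ℕ → Ex} {a : ℕ} (hf : ∀ k l, (f k l).NoGet a) (k : ℕ) :
    (exTable f k).NoGet a := by
  simp [exTable, exClause, Ex.NoGet, exProd_noGet (hf k) k]

lemma exLow_good (k l : ℕ) : (exLow k l).Good := by
  constructor <;> simp [exLow, exParity, exLit, exVec, exClause, Ex.Clean, Ex.Poly, IsScr]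

lemma exHigh_good (k l : ℕ) : (exHigh k l).Good := by
  constructor <;> simp [exHigh, exParity, exLit, exVec, exClause, Ex.Clean, Ex.Poly, IsScr]

lemma exLow_noGet {a : ℕ} (ha : 2 ≤ a) (k l : ℕ) : (exLow k l).NoGet a := by
  simp [exLow, exParity, exLit, exVec, exClause, Ex.NoGet]; omega

lemma exHigh_noGet {a : ℕ} (ha : 2 ≤ a) (k l : ℕ) : (exHigh k l).NoGet a := by
  simp [exHigh, exParity, exLit, exVec, exClause, Ex.NoGet]; omega

/-- The program computing an Orthogonal Vectors instance from a `k`-CNF formula. -/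
def buildVectors (k : ℕ) : Prog :=
  .seq (assign 2 (.reg 1)) (.seq (assign 4 (.op .div (.op .add (.reg 0) (.lit 1)) (.lit 2)))
    (.seq (assign 1 (.op .shl (.lit 1) (.reg 4))) (.seq (assign 3 (.op .add (.reg 2) (.lit 1)))
      (.seq (assign 6 (.op .mul (.reg 1) (.reg 3)))
        (.seq (fill wput 2 (exTable exLow k)) (fill wput 3 (exTable exHigh k)))))))

/-- The memory while the vectors are being computed, from the lists `X` and `S` of the variables and
signs of the literals, with `h` variables in the lower half and words bounded by `V`, apart from the
tables. -/
structure VectorState (V h m : ℕ) (X S : ℕ → ℕ) (σ : State) : Prop where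
  r1 : σ.reg 1 = 2 ^ h
  r2 : σ.reg 2 = m
  r3 : σ.reg 3 = m + 1
  r4 : σ.reg 4 = h
  r6 : σ.reg 6 = 2 ^ h * (m + 1)
  odd : ∀ r, 2 ≤ r → σ.reg (2 * r + 1) = 0
  a0 : σ.arr 0 = X
  a1 : σ.arr 1 = S
  rr : ∀ r, σ.rreg (2 * r + 1) = 0
  ra : ∀ a x, σ.rarr a x = 0
  wb : WB V σ

variable {V h m k : ℕ} {X S : ℕ → ℕ} {σ : State}

lemma VectorState.set8 (H : VectorState V h m X S σ) {x : ℕ} (hx : x ≤ V) :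
    VectorState V h m X S (σ.set 8 x) where
  r1 := by simpa [State.set] using H.r1
  r2 := by simpa [State.set] using H.r2
  r3 := by simpa [State.set] using H.r3
  r4 := by simpa [State.set] using H.r4
  r6 := by simpa [State.set] using H.r6
  odd r hr := by
    rw [State.set, ← H.odd r hr]; exact Function.update_of_ne (by omega) _ _
  a0 := H.a0
  a1 := H.a1
  rr := H.rr
  ra := H.ra
  wb := H.wb.set 8 hx

lemma VectorState.setArr (H : VectorState V h m X S σ) {a : ℕ} (ha : 2 ≤ a) {F : ℕ → ℕ}
    (hF : ∀ x, F x ≤ V) : VectorState V h m X S (σ.setArr a F) where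
  r1 := H.r1
  r2 := H.r2
  r3 := H.r3
  r4 := H.r4
  r6 := H.r6
  odd := H.odd
  a0 := by rw [State.setArr, ← H.a0]; exact Function.update_of_ne (by omega) _ _
  a1 := by rw [State.setArr, ← H.a1]; exact Function.update_of_ne (by omega) _ _
  rr := H.rr
  ra := H.ra
  wb := H.wb.setArr a hF

lemma exTable_eval {f : ℕ → ℕ → Ex} {lit : ℕ → ℕ → ℕ → ℕ}
    (hf : ∀ σ x l, VectorState V h m X S σ → (f k l).eval (σ.set 8 x) =
      lit (x / (m + 1)) (X (x % (m + 1) * k + l)) (S (x % (m + 1) * k + l)))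
    (H : VectorState V h m X S σ) (x : ℕ) :
    (exTable f k).eval (σ.set 8 x) = satTable lit k m X S x := by
  simp only [exTable, Ex.eval, exProd_eval, hf σ x _ H, satTable]
  simp [exClause, Ex.eval, WordOp.eval, State.set, H.r2, H.r3]

lemma exLow_eval (σ : State) (x l : ℕ) (H : VectorState V h m X S σ) :
    (exLow k l).eval (σ.set 8 x) =
      litLow h (x / (m + 1)) (X (x % (m + 1) * k + l)) (S (x % (m + 1) * k + l)) := by
  simp [exLow, exParity, exLit, exVec, exClause, Ex.eval, WordOp.eval, State.set, H.r3,
    H.r4, H.a0, H.a1, litLow]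

lemma exHigh_eval (σ : State) (x l : ℕ) (H : VectorState V h m X S σ) :
    (exHigh k l).eval (σ.set 8 x) =
      litHigh h (x / (m + 1)) (X (x % (m + 1) * k + l)) (S (x % (m + 1) * k + l)) := by
  simp [exHigh, exParity, exLit, exVec, exClause, Ex.eval, WordOp.eval, State.set, H.r3,
    H.r4, H.a0, H.a1, litHigh]

/-- The tables `t 0, …, t (j - 1)` have been written to the arrays from 2 on, the others are empty. -/
def VectorTables (V h m : ℕ) (X S : ℕ → ℕ) (t : ℕ → ℕ → ℕ) (j : ℕ) (σ : State) : Prop :=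
  VectorState V h m X S σ ∧ ∀ a x, σ.arr (a + 2) x = if a < j ∧ x < 2 ^ h * (m + 1) then t a x else 0

lemma runs_fill_vectors {W j : ℕ} {f : ℕ → ℕ → Ex} {t : ℕ → ℕ → ℕ} (hV : 2 ≤ V)
    (hn : 2 ^ h * (m + 1) ≤ V) (he : ∀ k l, (f k l).Good) (hg : ∀ k l, (f k l).NoGet (j + 2))
    (hW : V ^ (exTable f k).deg ≤ W) (hVW : V ≤ W) (ht : ∀ x, t j x ≤ 1)
    (heval : ∀ σ x, VectorState V h m X S σ → (exTable f k).eval (σ.set 8 x) = t j x)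
    (hσ : VectorTables V h m X S t j σ) :
    Runs W (fill wput (j + 2) (exTable f k)) σ (2 ^ h * (m + 1) * ((exTable f k).cost + 7) + 3)
      (VectorTables V h m X S t (j + 1)) := by
  obtain ⟨h1, h2⟩ := hσ
  have hgood := exTable_good he k
  have hng := exTable_noGet hg k
  have hF : (fun x => if x < 2 ^ h * (m + 1) then (exTable f k).eval (σ.set 8 x)
      else σ.arr (j + 2) x) = fun x => if x < 2 ^ h * (m + 1) then t j x else 0 := by
    funext x
    rw [heval σ x h1, h2]; simp
  refine runs_fill (hn.trans hVW) (by omega) h1.r6 hgood.clean hng (fun x hx => ?_)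
    (fun σ F => Ex.ok_setArr _ hng σ F) ?_
  · exact Ex.ok_of_deg hV (h1.wb.set 8 (by omega)) _ hgood.poly hW
  · rw [hF]
    refine ⟨(h1.set8 hn).setArr (by omega) fun x => ?_, fun a x => ?_⟩
    · have := ht x
      split_ifs <;> omega
    · by_cases ha : a = j
      · subst ha; simp [State.setArr]
      · have e1 : a < j + 1 ↔ a < j := by omega
        simp only [e1]
        rw [← h2 a x]
        simp [State.setArr, State.set, Function.update_of_ne (show a + 2 ≠ j + 2 by omega)]

end SatBuild

lemma half_pow_le (n m : ℕ) : 2 ^ ((n + 1) / 2) * (m + 1) + 1 ≤ 2 ^ n * (m + 2) := by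
  have h1 : 2 ^ ((n + 1) / 2) ≤ 2 ^ n := Nat.pow_le_pow_right (by norm_num) (by omega)
  have h2 : 1 ≤ 2 ^ n := Nat.one_le_two_pow
  have h3 := Nat.mul_le_mul_right (m + 1) h1
  have h4 : 2 ^ n * (m + 2) = 2 ^ n * (m + 1) + 2 ^ n := by ring
  omega

lemma satInput_wb {k n m : ℕ} (F : KCNF k n m) : WB (2 ^ n * (m + 2)) (satInput F) := by
  have h1 : n ≤ 2 ^ n := Nat.lt_two_pow_self.le
  have h2 : 1 ≤ 2 ^ n := Nat.one_le_two_pow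
  have h3 : 2 ^ n * 2 ≤ 2 ^ n * (m + 2) := Nat.mul_le_mul_left _ (by omega)
  have h4 : 1 * (m + 2) ≤ 2 ^ n * (m + 2) := Nat.mul_le_mul_right _ h2
  refine ⟨fun r => ?_, fun a x => ?_⟩
  · simp only [satInput]; split_ifs <;> omega
  · simp only [satInput]
    split_ifs with h h'
    · have := (F ⟨x / k, h.1⟩ ⟨x % k, h.2⟩).1.2
      omega
    · have := Bool.toNat_le (F ⟨x / k, h.1⟩ ⟨x % k, h.2⟩).2
      omega
    · exact Nat.zero_le _
    · exact Nat.zero_le _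

/-- The constant of the degree bounds and of the running time of `buildVectors`. -/
def vectorConst (k : ℕ) : ℕ :=
  (exTable exLow k).deg + (exTable exHigh k).deg + (exTable exLow k).cost +
    (exTable exHigh k).cost + 60

lemma runs_buildVectors {k n m W : ℕ} (F : KCNF k n m)
    (hW : (2 ^ n * (m + 2)) ^ vectorConst k ≤ W) :
    Runs W (buildVectors k) (satInput F) (2 ^ ((n + 1) / 2) * (m + 1) * vectorConst k) (fun σ =>
      subState σ = ovInput (tableVectors (2 ^ ((n + 1) / 2)) (m + 1) (tableLow F))
        (tableVectors (2 ^ ((n + 1) / 2)) (m + 1) (tableHigh F))) := by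
  obtain ⟨V, hVdef⟩ : ∃ V, V = 2 ^ n * (m + 2) := ⟨_, rfl⟩
  obtain ⟨h, hh⟩ : ∃ h, h = (n + 1) / 2 := ⟨_, rfl⟩
  have hNV := half_pow_le n m
  have wb0 := satInput_wb F
  rw [← hVdef] at hW hNV wb0
  rw [← hh] at hNV ⊢
  have hpos : 1 ≤ 2 ^ h := Nat.one_le_two_pow
  have hm1 : 1 * (m + 1) ≤ 2 ^ h * (m + 1) := Nat.mul_le_mul_right _ hpos
  have hN1 : 2 ^ h * 1 ≤ 2 ^ h * (m + 1) := Nat.mul_le_mul_left _ (by omega)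
  have hhlt : h < 2 ^ h := Nat.lt_two_pow_self
  have hV : 2 ≤ V := by omega
  have hle : ∀ d ≤ vectorConst k, V ^ d ≤ W := fun d hd => le_pow_of_le hV hW hd
  have hVW : V ≤ W := by simpa using hle 1 (by unfold vectorConst; omega)
  have w1 := wb0.set 2 (v := m) (by omega)
  have w2 := w1.set 4 (v := h) (by omega)
  have w3 := w2.set 1 (v := 2 ^ h) (by omega)
  have w4 := w3.set 3 (v := m + 1) (by omega)
  have w5 := w4.set 6 (v := 2 ^ h * (m + 1)) (by omega)
  set t : ℕ → ℕ → ℕ := fun a => if a = 0 then tableLow F else tableHigh F with ht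
  have hlow : t 0 = satTable (litLow h) k m ((satInput F).arr 0) ((satInput F).arr 1) := by
    rw [hh]; rfl
  have hhigh : t 1 = satTable (litHigh h) k m ((satInput F).arr 0) ((satInput F).arr 1) := by
    rw [hh]; rfl
  have htle : ∀ a x, t a x ≤ 1 := by
    intro a x
    by_cases ha : a = 0
    · simp only [ht, ha, if_true]
      exact satTable_le (litLow_le _) _ _ _ _ _
    · simp only [ht, ha, if_false]
      exact satTable_le (litHigh_le _) _ _ _ _ _
  have build : Runs W (buildVectors k) (satInput F)
      (2 + (6 + (4 + (4 + (4 + ((2 ^ h * (m + 1) * ((exTable exLow k).cost + 7) + 3) +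
        (2 ^ h * (m + 1) * ((exTable exHigh k).cost + 7) + 3)))))))
      (VectorTables V h m ((satInput F).arr 0) ((satInput F).arr 1) t 2) := by
    refine Runs.seq (Q := fun σ => σ = (satInput F).set 2 m) ?_ ?_
    · refine runs_assign_good (e := .reg 1) hV wb0 ⟨by simp [Ex.Clean, IsScr], trivial⟩
        (hle _ (by simp only [Ex.deg, vectorConst]; omega)) ?_
      simp [Ex.eval, satInput]
    rintro _ rfl
    refine Runs.seq (Q := fun σ => σ = ((satInput F).set 2 m).set 4 h) ?_ ?_
    · refine runs_assign_good (e := .op .div (.op .add (.reg 0) (.lit 1)) (.lit 2)) hV w1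
        ⟨by simp [Ex.Clean, IsScr], by simp [Ex.Poly]⟩
        (hle _ (by simp only [Ex.deg, vectorConst]; omega)) ?_
      simp [Ex.eval, WordOp.eval, State.set, satInput, hh]
    rintro _ rfl
    refine Runs.seq (Q := fun σ => σ = (((satInput F).set 2 m).set 4 h).set 1 (2 ^ h)) ?_ ?_
    · refine runs_assign (e := .op .shl (.lit 1) (.reg 4)) (by simp [Ex.Clean, IsScr])
        ⟨show 1 ≤ W by omega, (w2.1 4).trans hVW, ?_⟩ ?_
      · simp only [Ex.eval, WordOp.eval, State.set, Function.update_self, Nat.one_shiftLeft]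
        omega
      · simp [Ex.eval, WordOp.eval, State.set, Nat.one_shiftLeft]
    rintro _ rfl
    refine Runs.seq (Q := fun σ => σ =
      ((((satInput F).set 2 m).set 4 h).set 1 (2 ^ h)).set 3 (m + 1)) ?_ ?_
    · refine runs_assign_good (e := .op .add (.reg 2) (.lit 1)) hV w3
        ⟨by simp [Ex.Clean, IsScr], by simp [Ex.Poly]⟩
        (hle _ (by simp only [Ex.deg, vectorConst]; omega)) ?_
      simp [Ex.eval, WordOp.eval, State.set]
    rintro _ rfl
    refine Runs.seq (Q := fun σ => σ =
      (((((satInput F).set 2 m).set 4 h).set 1 (2 ^ h)).set 3 (m + 1)).set 6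
        (2 ^ h * (m + 1))) ?_ ?_
    · refine runs_assign_good (e := .op .mul (.reg 1) (.reg 3)) hV w4
        ⟨by simp [Ex.Clean, IsScr], by simp [Ex.Poly]⟩
        (hle _ (by simp only [Ex.deg, vectorConst]; omega)) ?_
      simp [Ex.eval, WordOp.eval, State.set]
    rintro _ rfl
    refine Runs.seq (runs_fill_vectors (j := 0) (t := t) hV (by omega) exLow_good
      (exLow_noGet (by omega)) (hle _ (by unfold vectorConst; omega)) hVW (htle 0) ?_ ?_)
      fun σ hσ => runs_fill_vectors (j := 1) (t := t) hV (by omega) exHigh_good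
      (exHigh_noGet (by omega)) (hle _ (by unfold vectorConst; omega)) hVW (htle 1) ?_ hσ
    · intro σ x H
      rw [hlow]; exact exTable_eval exLow_eval H x
    · refine ⟨⟨?_, ?_, ?_, ?_, ?_, fun r hr => ?_, rfl, rfl, fun _ => rfl, fun _ _ => rfl, w5⟩, ?_⟩
      · simp [State.set]
      · simp [State.set]
      · simp [State.set]
      · simp [State.set]
      · simp [State.set]
      · simp only [State.set, satInput]
        rw [Function.update_of_ne (by omega), Function.update_of_ne (by omega),
          Function.update_of_ne (by omega), Function.update_of_ne (by omega),
          Function.update_of_ne (by omega), if_neg (by omega), if_neg (by omega)]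
      · intro a x
        simp [State.set, satInput]
    · intro σ x H
      rw [hhigh]; exact exTable_eval exHigh_eval H x
  refine build.mono ?_ fun σ hσ => ?_
  · obtain ⟨r, hr, hr'⟩ : ∃ r, vectorConst k = ((exTable exLow k).cost + 7) +
        ((exTable exHigh k).cost + 7) + r ∧ 26 ≤ r :=
      ⟨vectorConst k - (exTable exLow k).cost - (exTable exHigh k).cost - 14,
        by unfold vectorConst; omega, by unfold vectorConst; omega⟩
    have e' : 1 * r ≤ 2 ^ h * (m + 1) * r := Nat.mul_le_mul_right _ (by omega)
    rw [hr]
    simp only [mul_add (2 ^ h * (m + 1))] at *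
    omega
  · obtain ⟨H, Ht⟩ := hσ
    have e1 : (fun r => σ.reg (2 * r + 1)) =
        fun r => if r = 0 then 2 ^ h else if r = 1 then m + 1 else 0 := by
      funext r
      rcases r with _ | _ | r
      · simpa using H.r1
      · simpa using H.r3
      · simpa using H.odd (r + 2) (by omega)
    have e2 : (fun a => σ.arr (a + 2)) =
        (ovInput (tableVectors (2 ^ h) (m + 1) (tableLow F))
          (tableVectors (2 ^ h) (m + 1) (tableHigh F))).arr := by
      have hnat : ∀ x, x ≤ 1 → (decide (x ≠ 0)).toNat = x := by
        intro x hx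
        interval_cases x <;> rfl
      funext a x
      rw [Ht]
      have hx : x < 2 ^ h * (m + 1) ↔ x / (m + 1) < 2 ^ h ∧ x % (m + 1) < m + 1 := by
        rw [Nat.div_lt_iff_lt_mul (by omega)]
        have := Nat.mod_lt x (show 0 < m + 1 by omega)
        omega
      have hdm : x / (m + 1) * (m + 1) + x % (m + 1) = x := Nat.div_add_mod' x (m + 1)
      simp only [ovInput, tableVectors, hdm, hx]
      by_cases hc : x / (m + 1) < 2 ^ h ∧ x % (m + 1) < m + 1
      · rw [dif_pos hc]
        rcases a with _ | _ | a
        · simpa [hc, ht] using (hnat _ (htle 0 x)).symm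
        · simpa [hc, ht] using (hnat _ (htle 1 x)).symm
        · simp
      · rw [dif_neg hc, if_neg fun h => hc h.2]
    have e3 : σ.rarr = fun _ _ => 0 := funext fun a => funext fun x => H.ra a x
    have e4 : (fun r => σ.rreg (2 * r + 1)) = fun _ => 0 := funext H.rr
    unfold subState
    rw [e1, e2, e3, e4]
    rfl

lemma buildVectors_for (k : ℕ) (M : Model) : (buildVectors k).For M := by
  cases M
  · simp [buildVectors, Prog.For, Prog.WordOnly, assign, fill, countLoop, wput,
      Ex.code_wordOnly, Instr.WordOnly, Cond.WordOnly]
  · trivial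

/-- Split and list: satisfiability reduces to Orthogonal Vectors for the families of the `2 ^ (n / 2)`
assignments of one half of the variables. -/
lemma kSATSolvable_of_ovSolvable {M : Model} {ε : ℝ} (hε0 : 0 < ε) (hε : ε ≤ 1) (h : OVSolvable M ε) (k : ℕ) :
    KSATSolvable M k (ε / 2) := by
  obtain ⟨p, C, c, κ, hp, h⟩ := h
  refine ⟨.seq (buildVectors k) (.seq p.sub (assign 0 (.reg 1))),
    (vectorConst k + |C| + 2) * 4, c + 1, κ + 1 + vectorConst k, ?_, ?_⟩
  · have h1 := buildVectors_for k M
    have h2 := Prog.sub_for hp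
    cases M
    · exact ⟨h1, h2, Ex.code_wordOnly _ _, trivial⟩
    · trivial
  intro n m F
  obtain ⟨N, hN⟩ : ∃ N, N = 2 ^ ((n + 1) / 2) := ⟨_, rfl⟩
  have hN1 : 1 ≤ N := hN ▸ Nat.one_le_two_pow
  have hb := fun W => runs_buildVectors (W := W) F
  have hiff := hasOrthogonalPair_iff F
  have hNV := half_pow_le n m
  rw [← hN] at hb hiff hNV
  obtain ⟨t, s, hex, ht, hs⟩ := h N (m + 1) hN1 (by omega)
    (tableVectors N (m + 1) (tableLow F)) (tableVectors N (m + 1) (tableHigh F))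
  obtain ⟨V, hV⟩ : ∃ V, V = 2 ^ n * (m + 2) := ⟨_, rfl⟩
  rw [← hV] at hb hNV ⊢
  have hV1 : 1 ≤ V := by omega
  have hle : ∀ d ≤ κ + 1 + vectorConst k, V ^ d ≤ V ^ (κ + 1 + vectorConst k) := fun d hd =>
    Nat.pow_le_pow_right hV1 hd
  have hκ : (N * (m + 1) + 1) ^ κ ≤ V ^ (κ + 1 + vectorConst k) :=
    (Nat.pow_le_pow_left hNV κ).trans (hle _ (by omega))
  have hwb : WB (V ^ (κ + 1 + vectorConst k)) s :=
    hex.wb hκ ((ovInput_wb hN1 (by omega) _ _).mono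
      (hNV.trans (Nat.le_self_pow (by omega) _)))
  have hmain : Runs (V ^ (κ + 1 + vectorConst k))
      (.seq (buildVectors k) (.seq p.sub (assign 0 (.reg 1)))) (satInput F)
      (N * (m + 1) * vectorConst k + (t + 2)) (fun σ => σ.reg 0 = 1 ↔ F.Satisfiable) := by
    refine Runs.seq (hb _ (hle _ (by omega))) fun σ hσ => ?_
    refine Runs.seq (Q := fun σ => subState σ = s)
      (runs_sub hκ (hσ ▸ hex) fun σ' h1 _ => h1) fun σ' h1 => ?_
    have e1 : σ'.reg 1 = s.reg 0 := by rw [← h1]; rfl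
    refine runs_assign (e := .reg 1) (by simp [Ex.Clean, IsScr]) ?_ ?_
    · show σ'.reg 1 ≤ _
      rw [e1]; exact hwb.1 0
    · have : ((σ'.set 0 ((Ex.reg 1).eval σ')).reg 0) = s.reg 0 := by
        simp [State.set, Ex.eval, e1]
      rw [this]
      exact hs.trans hiff
  obtain ⟨t', s', σ', k1, k2, k3, k4⟩ := hmain _ (Agree.refl _)
  refine ⟨t', s', k1, ?_, ?_⟩
  · have hNR : (1 : ℝ) ≤ N := by exact_mod_cast hN1
    have hmR : (1 : ℝ) ≤ (m : ℝ) + 1 := by have := Nat.cast_nonneg (α := ℝ) m; linarith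
    have e1 : (t' : ℝ) ≤ N * (m + 1) * vectorConst k + (t + 2) := by exact_mod_cast k2
    have e2 : (N : ℝ) ≤ (N : ℝ) ^ (2 - ε) := by
      have := Real.rpow_le_rpow_of_exponent_le hNR (show (1 : ℝ) ≤ 2 - ε by linarith)
      rwa [Real.rpow_one] at this
    have e3 : (N : ℝ) ^ (2 - ε) ≤ 4 * (2 : ℝ) ^ ((1 - ε / 2) * (n : ℝ)) := by
      have hcast : (((n + 1) / 2 : ℕ) : ℝ) ≤ ((n : ℝ) + 1) / 2 := by
        have := Nat.cast_div_le (α := ℝ) (m := n + 1) (n := 2)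
        push_cast at this
        exact this
      have hexp : (((n + 1) / 2 : ℕ) : ℝ) * (2 - ε) ≤ 2 + (1 - ε / 2) * n := by
        have := mul_le_mul_of_nonneg_right hcast (show 0 ≤ 2 - ε by linarith)
        linarith
      rw [hN, Nat.cast_pow, Nat.cast_ofNat, ← Real.rpow_natCast, ← Real.rpow_mul (by norm_num)]
      refine (Real.rpow_le_rpow_of_exponent_le (by norm_num) hexp).trans ?_
      rw [Real.rpow_add (by norm_num)]
      norm_num
    set X := (N : ℝ) ^ (2 - ε) with hX
    set Y := (2 : ℝ) ^ ((1 - ε / 2) * (n : ℝ)) with hY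
    have hX1 : 1 ≤ X := hNR.trans e2
    have hc1 : (1 : ℝ) ≤ ((m : ℝ) + 1) ^ c := one_le_pow₀ hmR
    have hP1 : (1 : ℝ) ≤ ((m : ℝ) + 1) ^ (c + 1) := one_le_pow₀ hmR
    have hPm : (m : ℝ) + 1 ≤ ((m : ℝ) + 1) ^ (c + 1) := le_self_pow₀ hmR (by omega)
    have hPc : ((m : ℝ) + 1) ^ c ≤ ((m : ℝ) + 1) ^ (c + 1) := pow_le_pow_right₀ hmR (by omega)
    set P := ((m : ℝ) + 1) ^ (c + 1) with hP
    have f1 : (t : ℝ) ≤ |C| * (P * X) := by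
      push_cast at ht
      calc (t : ℝ) ≤ C * ((m : ℝ) + 1) ^ c * X := ht
        _ ≤ |C| * ((m : ℝ) + 1) ^ c * X := by gcongr; exact le_abs_self C
        _ ≤ |C| * P * X := by gcongr
        _ = |C| * (P * X) := by ring
    have f2 : (N : ℝ) * (m + 1) * vectorConst k ≤ vectorConst k * (P * X) := by
      calc (N : ℝ) * (m + 1) * vectorConst k ≤ X * P * vectorConst k := by gcongr
        _ = vectorConst k * (P * X) := by ring
    have f3 : 1 ≤ P * X := one_le_mul_of_one_le_of_one_le hP1 hX1
    calc (t' : ℝ) ≤ (vectorConst k + |C| + 2) * (P * X) := by linarith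
      _ ≤ (vectorConst k + |C| + 2) * (P * (4 * Y)) := by gcongr
      _ = _ := by ring
  · rw [k3.1 0 (by simp [IsScr])]
    exact k4

theorem mainTheorem2 (M : Model) (h : OVHypothesis M ∨ SETH M) (β δ : ℝ)
    (hβ : Real.sqrt 5 / (2 * Real.sqrt 2) ≤ β) (hδ : 0 < δ) :
    ¬ FFValueSolvable M β δ ∧ ¬ FFTraversalSolvable M β δ := by
  have hpos : 0 < min δ 1 := lt_min hδ one_pos
  have key : ¬ OVSolvable M (min δ 1) := by
    rcases h with h | h
    · exact h _ hpos
    · intro hov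
      obtain ⟨k, hk⟩ := h (min δ 1 / 2) (by linarith)
      exact hk (kSATSolvable_of_ovSolvable hpos (min_le_right _ _) hov k)
  exact ⟨fun hv => key (ovSolvable_of_ffValueSolvable hβ hδ hv),
    fun ht => key (ovSolvable_of_ffTraversalSolvable hβ hδ ht)⟩
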